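/- **Setting.** Let $f:\mathbb R^d\to\mathbb R$ be differentiable and $L$-smooth (its gradient is $L$-Lipschitz in the $\ell_2$ norm) with a global minimum. *Oblivious-noise oracle* $\mathcal O_{\alpha,\sigma,f}$: a query at $x$ returns $\nabla f(\gamma,x)+\xi$ with fresh independent $\gamma\sim Q$ and $\xi\sim D_\xi$ ($\xi$ is also independent of $x$), where $\Pr[\xi=0]\ge\alpha$, $\mathbb E_\gamma[\nabla f(\gamma,x)]=\nabla f(x)$ and $\mathbb E_\gamma\|\nabla f(\gamma,x)-\nabla f(x)\|^2\le\sigma^2$ for all $x$. *Inexact learner.* An algorithm $\mathcal A_G$ with access to a gradient oracle is a $(\beta,\epsilon)$-inexact learner for $f$ if, whenever every query $x$ is answered by some vector $g_x$ with $\|g_x-\nabla f(x)\|\le\beta$, it outputs $\hat x$ with $\|\nabla f(\hat x)\|\le\beta+\epsilon$. *List-decodable mean estimation.* Let $\mathcal D_\sigma$ be the set of distributions $D$ on $\mathbb R^d$ with $\mathbb E_D\|x-\mathbb E_D[x]\|^2\le\sigma^2$. A (randomized) procedure $\mathcal A_{ME}$ is an $(\alpha,\beta,s)$-LDME algorithm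 for $\mathcal D_\sigma$ with $m_{ME}$ samples and failure probability $\delta_{ME}$ if, for every $D\in\mathcal D_\sigma$ and every $D_\xi$ with $\Pr[\xi=0]\ge\alpha$, given $m_{ME}$ independent samples $z_i+\xi_i$ ($z_i\sim D$, $\xi_i\sim D_\xi$ independent), it returns with probability at least $1-\delta_{ME}$ a list of $s$ points one of which is within $\beta$ of $\mathbb E_D[x]$. Moreover, for a fixed constant $c_0\in(0,1/2)$, it is required that $s=1$ when $1-\alpha\le c_0$. Running time is the number of arithmetic operations, comparisons and oracle calls in the real-number model (algebraic computation trees with oracle calls), in the worst case; a call of the black box $\mathcal A_{ME}$ counts as one step. **Theorem.** Let $0<c_{ME}<c_G$ be constants. There are constants $C,k$ depending only on $c_{ME},c_G$ such that the following holds for all $d,m_{ME},s$, $T_G\ge1$, $\alpha,\eta,\delta\in(0,1)$ and $\sigma>0$. For every algorithm $\mathcal A_G$ with running time at most $T_G$ there is an algorithm $\mathcal B$, with access to an oblivious-noise oracle and to a mean estimator, such that 1. $\mathcal B$ makes at most $$m_{ME}+s\cdot C\Big(1+\log\frac{(d+1)T_G}{\alpha\eta\delta}\Big)^{k}\;T_G\,\frac{(C/\alpha)^{2/\eta}}{\eta^{5}}$$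 oracle queries, i.e. $m_{ME}+s\cdot\tilde O\big(T_G (O(1)/\alpha)^{2/\eta}/\eta^5\big)$, and calls the mean estimator at most once; 2. $\mathcal B$ runs in time at most $$m_{ME}+s\cdot T_G\cdot C\Big(d+\tfrac1\eta+(C/\alpha)^{1/\eta}+\log\frac{T_G}{\delta\eta\alpha}\Big)^{k},$$ i.e. $m_{ME}+s\cdot T_G\cdot\mathrm{poly}\big(d,1/\eta,(O(1)/\alpha)^{1/\eta},\log(T_G/\delta\eta\alpha)\big)$; 3. $\mathcal B$ outputs a list of $s$ points, and for every $(\alpha,c_{ME}\eta\sigma,s)$-LDME algorithm $\mathcal A_{ME}$ for $\mathcal D_\sigma$ with $m_{ME}$ samples and failure probability $\delta_{ME}$, every $\epsilon$, every differentiable $L$-smooth $f$ with a global minimum for which $\mathcal A_G$ is a $(c_G\eta\sigma,\epsilon)$-inexact learner, and every oracle $\mathcal O_{\alpha,\sigma,f}$, with probability at least $1-\delta_{ME}-\delta$ some point $x$ of the list satisfies $\|\nabla f(x)\|\le c_G\eta\sigma+\epsilon$. If $1-\alpha\le c_0$, then $s=1$, and with the same probability the single output point satisfies this bound. -/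

import Mathlib

open MeasureTheory ProbabilityTheory
open scoped ENNReal NNReal

noncomputable section

/-- Euclidean space `ℝᵈ` with the `ℓ₂` norm. -/
abbrev Vec (d : ℕ) : Type := EuclideanSpace ℝ (Fin d)

/-! ### Algorithms: oracle computation trees over the reals, with a step count -/

/-- The external procedures an algorithm may call. A call of the procedure `o` passes a tuple of
reals indexed by `In o` and receives a tuple of reals indexed by `Out o`. -/
structure Interface where
  Op : Type
  In : Op → Type
  Out : Op → Type

/-- The four arithmetic operations of the real-number model. -/
inductive Arith where
  | add
  | sub
  | mul
  | div

/-- Value of an arithmetic operation. -/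
def Arith.eval : Arith → ℝ → ℝ → ℝ
  | .add, x, y => x + y
  | .sub, x, y => x - y
  | .mul, x, y => x * y
  | .div, x, y => x / y

/-- The memory of the machine: real registers, named by natural numbers. -/
abbrev Mem : Type := ℕ → ℝ

/-- An algorithm in the real-number model with oracles: an algebraic computation tree on real
registers. The tree is plain data: what is done next depends on register contents only through
comparisons, and register contents change only by the instructions below.
* `const r c`: put the real constant `c` into register `r`;
* `arith o r a b`: put the result of `o` on registers `a`, `b` into register `r`;
* `branch a b p q`: go on with `p` if register `a` is at most register `b`, otherwise with `q`;
* `call o src dst`: call procedure `o` on the contents of the registers `src i` and put its answer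
  into the registers `dst j`. -/
inductive Prog (I : Interface) : Type where
  | halt : Prog I
  | const (r : ℕ) (c : ℝ) (p : Prog I) : Prog I
  | arith (o : Arith) (r a b : ℕ) (p : Prog I) : Prog I
  | branch (a b : ℕ) (p q : Prog I) : Prog I
  | call (o : I.Op) (src : I.In o → ℕ) (dst : I.Out o ↪ ℕ) (p : Prog I) : Prog I

namespace Prog

variable {I : Interface}

/-- Running time: the largest number of instructions executed along a path of the tree
(every arithmetic operation, constant, comparison and call is one step). -/
def time : Prog I → ℕ
  | halt => 0
  | const _ _ p => p.time + 1
  | arith _ _ _ _ p => p.time + 1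
  | branch _ _ p q => max p.time q.time + 1
  | call _ _ _ p => p.time + 1

/-- The largest number of calls of the procedure `o` along a path of the tree. -/
def calls [DecidableEq I.Op] (o : I.Op) : Prog I → ℕ
  | halt => 0
  | const _ _ p => p.calls o
  | arith _ _ _ _ p => p.calls o
  | branch _ _ p q => max (p.calls o) (q.calls o)
  | call o' _ _ p => p.calls o + if o' = o then 1 else 0

/-- `p.Surely R S μ`: started in memory `μ`, the algorithm ends in a memory in `S`, whatever the
answers to its calls are, as long as every answer `y` to a call of `o` on `x` satisfies
`R o x y`. -/
def Surely (R : ∀ o : I.Op, (I.In o → ℝ) → (I.Out o → ℝ) → Prop) (S : Set Mem) :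
    Prog I → Mem → Prop
  | halt, μ => μ ∈ S
  | const r c p, μ => p.Surely R S (Function.update μ r c)
  | arith o r a b p, μ => p.Surely R S (Function.update μ r (o.eval (μ a) (μ b)))
  | branch a b p q, μ => (μ a ≤ μ b → p.Surely R S μ) ∧ (¬ μ a ≤ μ b → q.Surely R S μ)
  | call o src dst p, μ =>
      ∀ y : I.Out o → ℝ, R o (fun i => μ (src i)) y → p.Surely R S (Function.extend dst y μ)

open Classical in
/-- `p.prob κ S μ`: the probability that the algorithm, started in memory `μ`, ends in a memory
in `S`, when each call of `o` on `x` is answered by a fresh draw from the distribution `κ o x`,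
independent of everything that happened before. -/
def prob (κ : ∀ o : I.Op, (I.In o → ℝ) → Measure (I.Out o → ℝ)) (S : Set Mem) :
    Prog I → Mem → ℝ≥0∞
  | halt, μ => if μ ∈ S then 1 else 0
  | const r c p, μ => p.prob κ S (Function.update μ r c)
  | arith o r a b p, μ => p.prob κ S (Function.update μ r (o.eval (μ a) (μ b)))
  | branch a b p q, μ => if μ a ≤ μ b then p.prob κ S μ else q.prob κ S μ
  | call o src dst p, μ =>
      ∫⁻ y, p.prob κ S (Function.extend dst y μ) ∂(κ o (fun i => μ (src i)))

end Prog

/-- The list of points an algorithm leaves in its registers: point number `j` is in the registers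
`j * d, …, j * d + d - 1`. -/
def outputPoint (d : ℕ) (μ : Mem) (j : ℕ) : Vec d :=
  WithLp.toLp 2 fun i : Fin d => μ (j * d + i)

/-! ### Objectives and inexact learners -/

/-- `f` is differentiable and `L`-smooth and has a global minimum. -/
structure IsObjective {d : ℕ} (f : Vec d → ℝ) (L : ℝ≥0) : Prop where
  differentiable : Differentiable ℝ f
  smooth : LipschitzWith L (gradient f)
  exists_min : ∃ x₀, ∀ x, f x₀ ≤ f x

/-- The only procedure is a gradient oracle: it takes a point and returns a vector. -/
abbrev gradientAccess (d : ℕ) : Interface where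
  Op := Unit
  In := fun _ => Fin d
  Out := fun _ => Fin d

/-- `A` is a `(β, ε)`-inexact learner for `f`: whenever each query `x` is answered by some vector
`g` with `‖g - ∇f(x)‖ ≤ β`, the point `x̂` that `A` outputs satisfies `‖∇f(x̂)‖ ≤ β + ε`. -/
def IsInexactLearner {d : ℕ} (A : Prog (gradientAccess d)) (f : Vec d → ℝ) (β ε : ℝ) : Prop :=
  A.Surely
    (fun _ x g => ‖(WithLp.toLp 2 g : Vec d) - gradient f (WithLp.toLp 2 x)‖ ≤ β)
    {μ | ‖gradient f (outputPoint d μ 0)‖ ≤ β + ε}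
    (fun _ => 0)

/-! ### The oblivious-noise oracle -/

/-- The data of an oblivious-noise oracle for `f`: observation noise `γ ∼ Q` and oblivious noise
`ξ ∼ Dξ` with `Pr[ξ = 0] ≥ α`; the stochastic gradients `∇F(γ, x)` have mean `∇f(x)` and expected
squared distance at most `σ²` from it. -/
structure IsObliviousNoiseOracle {d : ℕ} {Γ : Type*} [MeasurableSpace Γ] (F : Γ → Vec d → ℝ)
    (Q : Measure Γ) (Dξ : Measure (Vec d)) (f : Vec d → ℝ) (α σ : ℝ) : Prop where
  prob_Q : IsProbabilityMeasure Q
  prob_noise : IsProbabilityMeasure Dξ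
  differentiable : ∀ γ, Differentiable ℝ (F γ)
  measurable : Measurable fun p : Γ × Vec d => gradient (F p.1) p.2
  mean : ∀ x, ∫ γ, gradient (F γ) x ∂Q = gradient f x
  variance : ∀ x, ∫⁻ γ, ‖gradient (F γ) x - gradient f x‖ₑ ^ 2 ∂Q ≤ ENNReal.ofReal (σ ^ 2)
  atom : ENNReal.ofReal α ≤ Dξ {0}

/-- Law of the answer `∇F(γ, x) + ξ` to a query at `x`, with `γ ∼ Q` and `ξ ∼ Dξ` independent. -/
def answerLaw {d : ℕ} {Γ : Type*} [MeasurableSpace Γ] (F : Γ → Vec d → ℝ) (Q : Measure Γ)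
    (Dξ : Measure (Vec d)) (x : Vec d) : Measure (Vec d) :=
  (Q.prod Dξ).map fun p => gradient (F p.1) x + p.2

/-! ### List-decodable mean estimation -/

/-- The class of distributions with `E‖x - E x‖² ≤ σ²` (a finite left side makes the mean
exist). -/
def boundedVarianceClass (d : ℕ) (σ : ℝ) : Set (Measure (Vec d)) :=
  {D | IsProbabilityMeasure D ∧ ∫⁻ x, ‖x - ∫ y, y ∂D‖ₑ ^ 2 ∂D ≤ ENNReal.ofReal (σ ^ 2)}

/-- `A`, a randomized procedure that turns `m` samples into a list of `s` points, is an
`(α, β, s)`-list-decodable mean estimator for the class `𝒟` with failure probability `δ`. Each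
sample is `z + ξ` with independent `z ∼ D ∈ 𝒟` and `ξ ∼ Dξ`, `Pr[ξ = 0] ≥ α`. In the regime
`1 - α ≤ c₀` the list has to be a single point. -/
structure IsLDME {d m s : ℕ} (A : Kernel (Fin m → Vec d) (Fin s → Vec d))
    (𝒟 : Set (Measure (Vec d))) (c₀ α β δ : ℝ) : Prop where
  success : ∀ D ∈ 𝒟, ∀ Dξ : Measure (Vec d), IsProbabilityMeasure Dξ →
    ENNReal.ofReal α ≤ Dξ {0} →
      1 - ENNReal.ofReal δ ≤
        (Measure.pi fun _ : Fin m => Measure.conv D Dξ).bind A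
          {l | ∃ j, ‖l j - ∫ x, x ∂D‖ ≤ β}
  singleton : 1 - α ≤ c₀ → s = 1

/-! ### Algorithms that use the noisy oracle and a mean estimator -/

/-- The two procedures available to the optimization algorithm. -/
inductive OptOp where
  | oracle
  | meanEstimator
  deriving DecidableEq

/-- Access to the oblivious-noise oracle and to a black-box mean estimator from `m` samples to
lists of `s` points. -/
abbrev optAccess (d m s : ℕ) : Interface where
  Op := OptOp
  In := fun o => match o with
    | .oracle => Fin d
    | .meanEstimator => Fin m × Fin d
  Out := fun o => match o with
    | .oracle => Fin d
    | .meanEstimator => Fin s × Fin d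

/-- How the two procedures answer: the oracle by a fresh noisy gradient at the queried point, the
mean estimator by a run (with fresh internal randomness) on the samples passed to it. -/
def optAnswers {d m s : ℕ} {Γ : Type*} [MeasurableSpace Γ] (F : Γ → Vec d → ℝ) (Q : Measure Γ)
    (Dξ : Measure (Vec d)) (A : Kernel (Fin m → Vec d) (Fin s → Vec d)) :
    ∀ o : (optAccess d m s).Op,
      ((optAccess d m s).In o → ℝ) → Measure ((optAccess d m s).Out o → ℝ)
  | .oracle => fun x : Fin d → ℝ =>
      (answerLaw F Q Dξ (WithLp.toLp 2 x)).map fun (g : Vec d) (i : Fin d) => g i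
  | .meanEstimator => fun z : Fin m × Fin d → ℝ =>
      (A fun i => WithLp.toLp 2 fun k => z (i, k)).map
        fun (l : Fin s → Vec d) (p : Fin s × Fin d) => l p.1 p.2

end

/-! The mean estimator is used once, at the origin: it turns `m` oracle answers at `0` into
candidates `g` for `∇f(0)`, one of which has an error `b = ∇f(0) - g` of norm at most `cME * η * σ`.
For each candidate the inexact learner is simulated, and each of its queries `x` is answered by
location estimation. The oblivious noise has the same law at every point. Up to the observation
noise, answers at `0` are therefore distributed around `g` as answers at `x` are around `c = ∇f(x) -
b`: both deviations equal `ξ + b` plus a centred error of variance at most `σ²`. If `c` is found to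
within `(cG - cME) * η * σ`, it is an admissible answer, being within `‖b‖` of `∇f(x)`.

The noise `ξ` may be arbitrarily heavy-tailed, so means are compared through a bounded field: `c` is
approximately the point `u` at which the mean of `Ψ(t(Y - u))` over fresh answers `Y` at `x` equals
that of `Ψ(t(X - g))` over fresh answers `X` at `0`. The field `Ψ = avgField M` is a rational
stand-in for `arctan ‖x‖ • x / ‖x‖`, computable by arithmetic alone. Three properties carry the
proof. It is bounded by a harmonic sum `H`, hence logarithmically in `M`, so empirical means
concentrate independently of the dimension (`measure_norm_mean_sub_ge_le`). It is linear up to a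
remainder `5 H ‖z‖² / (1 + ‖x‖²)`, so the centred observation noise causes a bias of second order
only (`norm_integral_avgField_sub_le`). It is strongly monotone with modulus `1 / (1 + ‖x‖²)`, up to
`3 / M` (`inner_avgField_sub_ge`).

The weight `1 / (1 + ‖x‖²)` occurs both in the bias and in the modulus. Its mean over the noise
therefore cancels, and the relative bias is of order `H (tσ)²` however the noise is spread. With `t`
of order `η / (σH)` the relative error `r` is of order `η² / H`, and `r / t` is of order `ησ`. The
atom of the noise at `0` only has to keep the mean weight above a multiple of `α`.

The zero of the field is reached by gradient descent (`descent_iterate_norm_le`). It needs a start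
at bounded distance; this is an answer `Y i` that passes a coordinatewise test with the monotone
function `squash` at a coarser scale. The required sample size is about `1 / (η⁴ α²)` times
logarithms, well below the permitted `(C/α)^(2/η) / η⁵`.

The rest concerns the machine model. Estimation is compiled into call-free blocks
(`computes_estimate`), and the learner is simulated with every write going to fresh registers, so
that no stored data are lost (`pow_mul_le_prob_simulate`). Since each query draws fresh samples,
success probabilities multiply over at most `T` queries. -/

noncomputable section

/-! ### Sequential composition and call-free blocks -/

namespace Prog

variable {I : Interface}

/-- Run `p`, then `q`. -/
def seq : Prog I → Prog I → Prog I
  | halt, q => q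
  | const r c p, q => const r c (p.seq q)
  | arith o r a b p, q => arith o r a b (p.seq q)
  | branch a b p p', q => branch a b (p.seq q) (p'.seq q)
  | call o src dst p, q => call o src dst (p.seq q)

/-- `p` makes no calls and writes only to registers from `n` on. -/
def LocalAbove (n : ℕ) : Prog I → Prop
  | halt => True
  | const r _ p => n ≤ r ∧ p.LocalAbove n
  | arith _ r _ _ p => n ≤ r ∧ p.LocalAbove n
  | branch _ _ p q => p.LocalAbove n ∧ q.LocalAbove n
  | call _ _ _ _ => False

open Classical in
/-- The final memory of a call-free program. -/
def exec : Prog I → Mem → Mem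
  | halt, μ => μ
  | const r c p, μ => p.exec (Function.update μ r c)
  | arith o r a b p, μ => p.exec (Function.update μ r (o.eval (μ a) (μ b)))
  | branch a b p q, μ => if μ a ≤ μ b then p.exec μ else q.exec μ
  | call _ _ _ _, μ => μ

theorem LocalAbove.mono {n n' : ℕ} (h : n ≤ n') {p : Prog I} (hp : p.LocalAbove n') :
    p.LocalAbove n := by
  induction p with
  | halt => trivial
  | const r c p ih => exact ⟨h.trans hp.1, ih hp.2⟩
  | arith o r a b p ih => exact ⟨h.trans hp.1, ih hp.2⟩
  | branch a b p q ihp ihq => exact ⟨ihp hp.1, ihq hp.2⟩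
  | call o src dst p ih => exact hp.elim

theorem LocalAbove.seq {n : ℕ} {p q : Prog I} (hp : p.LocalAbove n) (hq : q.LocalAbove n) :
    (p.seq q).LocalAbove n := by
  induction p with
  | halt => exact hq
  | const r c p ih => exact ⟨hp.1, ih hp.2⟩
  | arith o r a b p ih => exact ⟨hp.1, ih hp.2⟩
  | branch a b p q ihp ihq => exact ⟨ihp hp.1, ihq hp.2⟩
  | call o src dst p ih => exact hp.elim

theorem LocalAbove.exec_eq {n : ℕ} {p : Prog I} (hp : p.LocalAbove n) (μ : Mem) {r : ℕ}
    (hr : r < n) : p.exec μ r = μ r := by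
  induction p generalizing μ with
  | halt => rfl
  | const r' c p ih =>
    rw [exec, ih hp.2, Function.update_of_ne]
    have := hp.1; omega
  | arith o r' a b p ih =>
    rw [exec, ih hp.2, Function.update_of_ne]
    have := hp.1; omega
  | branch a b p q ihp ihq =>
    rw [exec]; split_ifs
    · exact ihp hp.1 μ
    · exact ihq hp.2 μ
  | call o src dst p ih => exact hp.elim

theorem LocalAbove.exec_seq {n : ℕ} {p q : Prog I} (hp : p.LocalAbove n) (μ : Mem) :
    (p.seq q).exec μ = q.exec (p.exec μ) := by
  induction p generalizing μ with
  | halt => rfl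
  | const r' c p ih => exact ih hp.2 _
  | arith o r' a b p ih => exact ih hp.2 _
  | branch a b p q ihp ihq =>
    simp only [Prog.seq, exec]; split_ifs
    · exact ihp hp.1 μ
    · exact ihq hp.2 μ
  | call o src dst p ih => exact hp.elim

theorem LocalAbove.prob_seq {n : ℕ} {p q : Prog I} (hp : p.LocalAbove n)
    (κ : ∀ o : I.Op, (I.In o → ℝ) → Measure (I.Out o → ℝ)) (S : Set Mem) (μ : Mem) :
    (p.seq q).prob κ S μ = q.prob κ S (p.exec μ) := by
  induction p generalizing μ with
  | halt => rfl
  | const r' c p ih => exact ih hp.2 _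
  | arith o r' a b p ih => exact ih hp.2 _
  | branch a b p q ihp ihq =>
    simp only [Prog.seq, exec, prob]; split_ifs
    · exact ihp hp.1 μ
    · exact ihq hp.2 μ
  | call o src dst p ih => exact hp.elim

theorem LocalAbove.calls_seq [DecidableEq I.Op] {n : ℕ} {p q : Prog I} (hp : p.LocalAbove n)
    (o : I.Op) : (p.seq q).calls o = q.calls o := by
  induction p with
  | halt => rfl
  | const r' c p ih => exact ih hp.2
  | arith o r' a b p ih => exact ih hp.2
  | branch a b p q ihp ihq => simp only [Prog.seq, calls, ihp hp.1, ihq hp.2, max_self]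
  | call o src dst p ih => exact hp.elim

theorem time_seq_le (p q : Prog I) : (p.seq q).time ≤ p.time + q.time := by
  induction p with
  | halt => simp [seq, time]
  | const r' c p ih => simp only [seq, time]; omega
  | arith o r' a b p ih => simp only [seq, time]; omega
  | branch a b p q ihp ihq => simp only [seq, time]; omega
  | call o src dst p ih => simp only [seq, time]; omega

end Prog

/-! ### Functions computed by call-free blocks -/

section Computes

variable (I : Interface) {ι : Type}

/-- Given registers `ρ` in `[lo, n)` for the arguments, a call-free block of at most `t` steps that
writes only from `n` on leaves the value of `Φ` in the registers `out`, which lie in `[lo, n')`. -/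
def Computes {d : ℕ} (t : ℕ) (Φ : (ι → ℝ) → Fin d → ℝ) : Prop :=
  ∀ (ρ : ι → ℕ) (lo n : ℕ), lo ≤ n → (∀ i, ρ i ∈ Set.Ico lo n) →
    ∃ (p : Prog I) (out : Fin d → ℕ) (n' : ℕ), n ≤ n' ∧ (∀ k, out k ∈ Set.Ico lo n') ∧
      p.LocalAbove n ∧
      p.time ≤ t ∧ ∀ μ k, p.exec μ (out k) = Φ (fun i => μ (ρ i)) k

/-- The scalar version of `Computes`. -/
def ComputesReal (t : ℕ) (φ : (ι → ℝ) → ℝ) : Prop :=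
  ∀ (ρ : ι → ℕ) (lo n : ℕ), lo ≤ n → (∀ i, ρ i ∈ Set.Ico lo n) →
    ∃ (p : Prog I) (out n' : ℕ), n ≤ n' ∧ out ∈ Set.Ico lo n' ∧ p.LocalAbove n ∧
      p.time ≤ t ∧ ∀ μ, p.exec μ out = φ (fun i => μ (ρ i))

variable {I}

theorem ComputesReal.mono {t t' : ℕ} {φ : (ι → ℝ) → ℝ} (h : ComputesReal I t φ) (htt : t ≤ t') :
    ComputesReal I t' φ := fun ρ lo n hlo hρ => by
  obtain ⟨p, out, n', h1, h2, h3, h4, h5⟩ := h ρ lo n hlo hρ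
  exact ⟨p, out, n', h1, h2, h3, h4.trans htt, h5⟩

theorem Computes.mono {d t t' : ℕ} {Φ : (ι → ℝ) → Fin d → ℝ} (h : Computes I t Φ)
    (htt : t ≤ t') : Computes I t' Φ := fun ρ lo n hlo hρ => by
  obtain ⟨p, out, n', h1, h2, h3, h4, h5⟩ := h ρ lo n hlo hρ
  exact ⟨p, out, n', h1, h2, h3, h4.trans htt, h5⟩

theorem ComputesReal.arg (i : ι) : ComputesReal I 0 (fun e => e i) := fun ρ _ n _ hρ =>
  ⟨.halt, ρ i, n, le_rfl, hρ i, trivial, le_rfl, fun _ => rfl⟩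

theorem ComputesReal.const (c : ℝ) : ComputesReal I 1 (fun _ : ι → ℝ => c) := fun ρ lo n hlo hρ =>
  ⟨.const n c .halt, n, n + 1, by omega, ⟨hlo, by omega⟩, ⟨le_rfl, trivial⟩, le_rfl,
    fun _ => by simp [Prog.exec]⟩

theorem ComputesReal.arith {t₁ t₂ : ℕ} {φ ψ : (ι → ℝ) → ℝ} (o : Arith) (h₁ : ComputesReal I t₁ φ)
    (h₂ : ComputesReal I t₂ ψ) : ComputesReal I (t₁ + t₂ + 1) (fun e => o.eval (φ e) (ψ e)) := by
  intro ρ lo n hlo hρ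
  obtain ⟨p, a, n₁, hn, ha, hp, ht, hv⟩ := h₁ ρ lo n hlo hρ
  obtain ⟨q, b, n₂, hn', hb, hq, ht', hv'⟩ :=
    h₂ ρ lo n₁ (hlo.trans hn) (fun i => Set.Ico_subset_Ico_right hn (hρ i))
  refine ⟨p.seq (q.seq (.arith o n₂ a b .halt)), n₂, n₂ + 1, by omega, ⟨by omega, by omega⟩,
    hp.seq ((hq.mono hn).seq ⟨by omega, trivial⟩), ?_, fun μ => ?_⟩
  · refine (Prog.time_seq_le _ _).trans ?_
    have := Prog.time_seq_le q (.arith o n₂ a b .halt)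
    simp only [Prog.time] at this
    omega
  · rw [hp.exec_seq, hq.exec_seq]
    simp only [Prog.exec, Function.update_self]
    rw [hq.exec_eq _ ha.2, hv, hv']
    congr 3
    funext i
    exact hp.exec_eq _ (hρ i).2

theorem ComputesReal.add {t₁ t₂ : ℕ} {φ ψ : (ι → ℝ) → ℝ} (h₁ : ComputesReal I t₁ φ)
    (h₂ : ComputesReal I t₂ ψ) : ComputesReal I (t₁ + t₂ + 1) (fun e => φ e + ψ e) :=
  h₁.arith .add h₂

theorem ComputesReal.sub {t₁ t₂ : ℕ} {φ ψ : (ι → ℝ) → ℝ} (h₁ : ComputesReal I t₁ φ)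
    (h₂ : ComputesReal I t₂ ψ) : ComputesReal I (t₁ + t₂ + 1) (fun e => φ e - ψ e) :=
  h₁.arith .sub h₂

theorem ComputesReal.mul {t₁ t₂ : ℕ} {φ ψ : (ι → ℝ) → ℝ} (h₁ : ComputesReal I t₁ φ)
    (h₂ : ComputesReal I t₂ ψ) : ComputesReal I (t₁ + t₂ + 1) (fun e => φ e * ψ e) :=
  h₁.arith .mul h₂

theorem ComputesReal.div {t₁ t₂ : ℕ} {φ ψ : (ι → ℝ) → ℝ} (h₁ : ComputesReal I t₁ φ)
    (h₂ : ComputesReal I t₂ ψ) : ComputesReal I (t₁ + t₂ + 1) (fun e => φ e / ψ e) :=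
  h₁.arith .div h₂

-- Both branches have to deliver their result in the same register. Each branch therefore ends by
-- adding a freshly written `0` to its result and storing the sum in a register beyond the scratch
-- space of both.
open Classical in
theorem ComputesReal.ite {t₁ t₂ t₃ t₄ : ℕ} {a b φ ψ : (ι → ℝ) → ℝ} (ha : ComputesReal I t₁ a)
    (hb : ComputesReal I t₂ b) (hφ : ComputesReal I t₃ φ) (hψ : ComputesReal I t₄ ψ) :
    ComputesReal I (t₁ + t₂ + t₃ + t₄ + 3) (fun e => if a e ≤ b e then φ e else ψ e) := by
  intro ρ lo n hlo hρ
  obtain ⟨p, ra, n₁, hn, hra, hp, ht, hv⟩ := ha ρ lo n hlo hρ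
  obtain ⟨q, rb, n₂, hn', hrb, hq, ht', hv'⟩ :=
    hb ρ lo n₁ (hlo.trans hn) (fun i => Set.Ico_subset_Ico_right hn (hρ i))
  obtain ⟨p₃, r₃, n₃, hn₃, hr₃, hp₃, ht₃, hv₃⟩ :=
    hφ ρ lo n₂ (hlo.trans (hn.trans hn')) (fun i => Set.Ico_subset_Ico_right (hn.trans hn') (hρ i))
  obtain ⟨p₄, r₄, n₄, hn₄, hr₄, hp₄, ht₄, hv₄⟩ :=
    hψ ρ lo n₂ (hlo.trans (hn.trans hn')) (fun i => Set.Ico_subset_Ico_right (hn.trans hn') (hρ i))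
  have env : ∀ (μ : Mem), (fun i => q.exec (p.exec μ) (ρ i)) = fun i => μ (ρ i) := fun μ => by
    funext i
    rw [hq.exec_eq _ ((hρ i).2.trans_le hn), hp.exec_eq _ (hρ i).2]
  refine ⟨p.seq (q.seq (.branch ra rb
      (p₃.seq (.const (n₃ + n₄) 0 (.arith .add (n₃ + n₄ + 1) r₃ (n₃ + n₄) .halt)))
      (p₄.seq (.const (n₃ + n₄) 0 (.arith .add (n₃ + n₄ + 1) r₄ (n₃ + n₄) .halt))))),
    n₃ + n₄ + 1, n₃ + n₄ + 2, by omega, ⟨by omega, by omega⟩, ?_, ?_, fun μ => ?_⟩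
  · refine hp.seq ((hq.mono hn).seq ⟨(hp₃.mono (by omega)).seq ?_, (hp₄.mono (by omega)).seq ?_⟩)
    · exact ⟨by omega, by omega, trivial⟩
    · exact ⟨by omega, by omega, trivial⟩
  · refine (Prog.time_seq_le _ _).trans ?_
    have h := Prog.time_seq_le q (.branch ra rb
      (p₃.seq (.const (n₃ + n₄) 0 (.arith .add (n₃ + n₄ + 1) r₃ (n₃ + n₄) .halt)))
      (p₄.seq (.const (n₃ + n₄) 0 (.arith .add (n₃ + n₄ + 1) r₄ (n₃ + n₄) .halt))))
    have h3 := Prog.time_seq_le p₃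
      (.const (n₃ + n₄) 0 (.arith .add (n₃ + n₄ + 1) r₃ (n₃ + n₄) .halt))
    have h4 := Prog.time_seq_le p₄
      (.const (n₃ + n₄) 0 (.arith .add (n₃ + n₄ + 1) r₄ (n₃ + n₄) .halt))
    simp only [Prog.time] at h h3 h4
    omega
  · rw [hp.exec_seq, hq.exec_seq]
    simp only [Prog.exec]
    rw [hq.exec_eq _ hra.2, hv, hv', hp₃.exec_seq, hp₄.exec_seq]
    have e1 : (fun i => p.exec μ (ρ i)) = fun i => μ (ρ i) := funext fun i => hp.exec_eq _ (hρ i).2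
    rw [e1]
    split_ifs
    · simp only [Prog.exec, Function.update_self, Arith.eval]
      rw [Function.update_of_ne (by have := hr₃.2; omega), hv₃, env]; simp
    · simp only [Prog.exec, Function.update_self, Arith.eval]
      rw [Function.update_of_ne (by have := hr₄.2; omega), hv₄, env]; simp

theorem ComputesReal.sum {N t : ℕ} {φ : Fin N → (ι → ℝ) → ℝ}
    (h : ∀ i, ComputesReal I t (φ i)) :
    ComputesReal I (N * (t + 1) + 1) (fun e => ∑ i, φ i e) := by
  induction N with
  | zero => simpa using (ComputesReal.const (I := I) (ι := ι) 0)
  | succ N ih =>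
    simp only [Fin.sum_univ_castSucc]
    refine ((ih (fun i => h i.castSucc)).add (h (Fin.last N))).mono ?_
    ring_nf; omega

/-- Each coordinate is computed into fresh registers, so the arguments survive and a vector update
is simultaneous in all coordinates. -/
theorem Computes.of_coords {d t : ℕ} {Φ : (ι → ℝ) → Fin d → ℝ}
    (h : ∀ k, ComputesReal I t (fun e => Φ e k)) : Computes I (d * t) Φ := by
  induction d with
  | zero =>
    intro ρ lo n hlo hρ
    exact ⟨.halt, Fin.elim0, n, le_rfl, fun k => k.elim0, trivial, by simp [Prog.time],
      fun μ k => k.elim0⟩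
  | succ d ih =>
    intro ρ lo n hlo hρ
    obtain ⟨p, out, n₁, hn, ho, hp, ht, hv⟩ :=
      ih (Φ := fun e k => Φ e k.castSucc) (fun k => h k.castSucc) ρ lo n hlo hρ
    obtain ⟨q, b, n₂, hn', hb, hq, ht', hv'⟩ :=
      h (Fin.last d) ρ lo n₁ (hlo.trans hn) (fun i => Set.Ico_subset_Ico_right hn (hρ i))
    refine ⟨p.seq q, Fin.snoc out b, n₂, by omega, fun k => ?_, hp.seq (hq.mono hn), ?_,
      fun μ k => ?_⟩
    · refine Fin.lastCases ?_ (fun k => ?_) k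
      · simpa using hb
      · simpa using Set.Ico_subset_Ico_right hn' (ho k)
    · refine (Prog.time_seq_le _ _).trans ?_
      have : (d + 1) * t = d * t + t := by ring
      omega
    · rw [hp.exec_seq]
      refine Fin.lastCases ?_ (fun k => ?_) k
      · simp only [Fin.snoc_last]
        rw [hv']
        congr 1
        funext i
        exact hp.exec_eq _ (hρ i).2
      · simp only [Fin.snoc_castSucc]
        rw [hq.exec_eq _ (ho k).2, hv]

theorem Computes.bind {d d' t t' : ℕ} {Φ : (ι → ℝ) → Fin d → ℝ}
    {Ψ : (ι ⊕ Fin d → ℝ) → Fin d' → ℝ} (hΦ : Computes I t Φ) (hΨ : Computes I t' Ψ) :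
    Computes I (t + t') (fun e => Ψ (Sum.elim e (Φ e))) := by
  intro ρ lo n hlo hρ
  obtain ⟨p, out, n₁, hn, ho, hp, ht, hv⟩ := hΦ ρ lo n hlo hρ
  obtain ⟨q, out', n₂, hn', ho', hq, ht', hv'⟩ := hΨ (Sum.elim ρ out) lo n₁ (hlo.trans hn) (by
    rintro (i | k)
    · exact Set.Ico_subset_Ico_right hn (hρ i)
    · exact ho k)
  refine ⟨p.seq q, out', n₂, hn.trans hn', ho', hp.seq (hq.mono hn), ?_, fun μ k => ?_⟩
  · exact (Prog.time_seq_le _ _).trans (by omega)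
  · rw [hp.exec_seq, hv']
    congr 1
    funext i
    rcases i with i | k
    · exact hp.exec_eq _ (hρ i).2
    · exact hv μ k

/-- The list is fixed when the tree is built, so the loop is simply unrolled. -/
theorem Computes.foldl {β : Type} {d t₀ t : ℕ} {Φ : (ι → ℝ) → Fin d → ℝ}
    {Ψ : β → (ι → ℝ) → (Fin d → ℝ) → Fin d → ℝ} (hΦ : Computes I t₀ Φ)
    (hΨ : ∀ b k, ComputesReal I t
      (fun e : ι ⊕ Fin d → ℝ => Ψ b (fun i => e (.inl i)) (fun i => e (.inr i)) k))
    (L : List β) :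
    Computes I (t₀ + L.length * (d * t)) (fun e => L.foldl (fun u b => Ψ b e u) (Φ e)) := by
  induction L generalizing Φ t₀ with
  | nil => exact hΦ.mono (by simp)
  | cons b L ih =>
    have h1 : Computes I (t₀ + d * t) (fun e => Ψ b e (Φ e)) :=
      hΦ.bind (Computes.of_coords (hΨ b))
    refine (ih h1).mono ?_
    simp only [List.length_cons]
    ring_nf; omega

end Computes

/-! ### A Hoeffding bound in Hilbert space -/

section Hoeffding

theorem lintegral_pi_fin_succ {Ω : Type*} [MeasurableSpace Ω] (ν : Measure Ω)
    [IsProbabilityMeasure ν] (n : ℕ) {g : (Fin (n + 1) → Ω) → ℝ≥0∞} (hg : Measurable g) :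
    ∫⁻ ω, g ω ∂(Measure.pi fun _ : Fin (n + 1) => ν) =
      ∫⁻ x, ∫⁻ y, g (Fin.cons x y) ∂(Measure.pi fun _ : Fin n => ν) ∂ν := by
  have h := (measurePreserving_piFinSuccAbove (fun _ : Fin (n + 1) => ν) 0).symm
  rw [← h.lintegral_comp hg, lintegral_prod]
  · simp [MeasurableEquiv.piFinSuccAbove, Fin.insertNthEquiv]
  · exact (hg.comp h.measurable).aemeasurable

/-- `r ↦ cosh r` is a convex function of `r ^ 2`. -/
theorem cosh_le_of_sq_eq {r r₁ r₂ θ : ℝ} (h0 : 0 ≤ θ) (h1 : θ ≤ 1)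
    (h : r ^ 2 = θ * r₁ ^ 2 + (1 - θ) * r₂ ^ 2) :
    Real.cosh r ≤ θ * Real.cosh r₁ + (1 - θ) * Real.cosh r₂ := by
  refine hasSum_le (fun n => ?_) (Real.hasSum_cosh r)
    (((Real.hasSum_cosh r₁).mul_left θ).add ((Real.hasSum_cosh r₂).mul_left (1 - θ)))
  have key : (r ^ 2) ^ n ≤ θ * (r₁ ^ 2) ^ n + (1 - θ) * (r₂ ^ 2) ^ n := by
    rw [h]
    have := (convexOn_pow (𝕜 := ℝ) n).2 (Set.mem_Ici.2 (sq_nonneg r₁))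
      (Set.mem_Ici.2 (sq_nonneg r₂)) h0 (sub_nonneg.2 h1) (by ring)
    simpa using this
  simp only [pow_mul]
  rw [← mul_div_assoc, ← mul_div_assoc, ← add_div]
  gcongr

/-! ### Dimension-free moments of `cosh ‖·‖`. -/

variable {E : Type*} [NormedAddCommGroup E] [InnerProductSpace ℝ E]

/-- `‖s + x‖²` is at most a convex combination of `(‖s‖ + b)²` and `(‖s‖ - b)²`, and `cosh` is
convex as a function of the square. The bound obtained is affine in `x`, so it integrates exactly
when `x` is a centred random vector. -/
theorem cosh_norm_add_le (s x : E) {b l : ℝ} (hb : 0 < b) (hx : ‖x‖ ≤ b) (hl : 0 ≤ l) :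
    Real.cosh (l * ‖s + x‖) ≤ Real.cosh (l * ‖s‖) * Real.cosh (l * b) +
      Real.sinh (l * ‖s‖) * Real.sinh (l * b) / (‖s‖ * b) * inner ℝ s x := by
  rcases eq_or_ne s 0 with rfl | hs
  · simp only [zero_add, norm_zero, mul_zero, Real.cosh_zero, one_mul, Real.sinh_zero, zero_mul,
      inner_zero_left, add_zero]
    rw [Real.cosh_le_cosh, abs_of_nonneg (by positivity), abs_of_nonneg (by positivity)]
    gcongr
  have hs0 : 0 < ‖s‖ := norm_pos_iff.2 hs
  set a := ‖s‖
  set c := inner ℝ s x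
  have hc : |c| ≤ a * b := (abs_real_inner_le_norm s x).trans (by gcongr)
  have hc' := abs_le.1 hc
  have hab : 0 < a * b := by positivity
  -- The weight for which `θ (a + b)² + (1 - θ) (a - b)² = a² + 2c + b²`.
  set θ : ℝ := (1 + c / (a * b)) / 2
  have hθ0 : 0 ≤ θ := by
    have : -1 ≤ c / (a * b) := by rw [le_div_iff₀ hab]; linarith
    simp only [θ]; linarith
  have hθ1 : θ ≤ 1 := by
    have : c / (a * b) ≤ 1 := by rw [div_le_iff₀ hab]; linarith
    simp only [θ]; linarith
  have hq : 0 ≤ a ^ 2 + 2 * c + b ^ 2 := by nlinarith [sq_nonneg (a - b)]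
  have h1 : Real.cosh (l * ‖s + x‖) ≤ Real.cosh (l * √(a ^ 2 + 2 * c + b ^ 2)) := by
    rw [Real.cosh_le_cosh, abs_of_nonneg (by positivity), abs_of_nonneg (by positivity)]
    gcongr
    apply Real.le_sqrt_of_sq_le
    rw [norm_add_sq_real]
    have : ‖x‖ ^ 2 ≤ b ^ 2 := by gcongr
    linarith
  have h2 := cosh_le_of_sq_eq (r := l * √(a ^ 2 + 2 * c + b ^ 2)) (r₁ := l * a + l * b)
    (r₂ := l * a - l * b) hθ0 hθ1 (by
      rw [mul_pow, Real.sq_sqrt hq]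
      simp only [θ]
      field_simp
      ring)
  refine h1.trans (h2.trans (le_of_eq ?_))
  rw [Real.cosh_add, Real.cosh_sub]
  simp only [θ]
  field_simp
  ring

variable [MeasurableSpace E] [BorelSpace E] [SecondCountableTopology E] [CompleteSpace E]
  {Ω : Type*} [MeasurableSpace Ω] {ν : Measure Ω} [IsProbabilityMeasure ν]

/-- A supermartingale argument: conditionally on the past, a centred increment multiplies the
expectation of `cosh` by at most `cosh (l b)`. The starting point `s` has to be arbitrary for the
induction. -/
theorem lintegral_cosh_norm_add_sum_le {Z : Ω → E} (hZ : Measurable Z) {b l : ℝ} (hb : 0 < b)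
    (hZb : ∀ ω, ‖Z ω‖ ≤ b) (hZ0 : ∫ ω, Z ω ∂ν = 0) (hl : 0 ≤ l) (n : ℕ) (s : E) :
    ∫⁻ ω, ENNReal.ofReal (Real.cosh (l * ‖s + ∑ i, Z (ω i)‖))
        ∂(Measure.pi fun _ : Fin n => ν) ≤
      ENNReal.ofReal (Real.cosh (l * ‖s‖) * Real.cosh (l * b) ^ n) := by
  induction n generalizing s with
  | zero => simp
  | succ n ih =>
    rw [lintegral_pi_fin_succ]
    swap
    · have : Measurable fun ω : Fin (n + 1) → Ω => s + ∑ i, Z (ω i) :=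
        measurable_const.add (Finset.measurable_sum _ fun i _ => hZ.comp (measurable_pi_apply i))
      exact (Real.measurable_cosh.comp (this.norm.const_mul l)).ennreal_ofReal
    have hint : Integrable Z ν :=
      Integrable.of_bound hZ.aestronglyMeasurable b (Filter.Eventually.of_forall hZb)
    calc _ ≤ ∫⁻ x, ENNReal.ofReal (Real.cosh (l * ‖s + Z x‖) * Real.cosh (l * b) ^ n) ∂ν := by
          refine lintegral_mono fun x => ?_
          simpa [Fin.sum_univ_succ, add_assoc] using ih (s + Z x)
      _ ≤ ∫⁻ x, ENNReal.ofReal ((Real.cosh (l * ‖s‖) * Real.cosh (l * b) +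
            Real.sinh (l * ‖s‖) * Real.sinh (l * b) / (‖s‖ * b) * inner ℝ s (Z x)) *
            Real.cosh (l * b) ^ n) ∂ν := by
          refine lintegral_mono fun x => ?_
          gcongr
          exact cosh_norm_add_le s (Z x) hb (hZb x) hl
      _ = ENNReal.ofReal (Real.cosh (l * ‖s‖) * Real.cosh (l * b) ^ (n + 1)) := by
          rw [← ofReal_integral_eq_lintegral_ofReal]
          · congr 1
            have h1 : Integrable (fun x => (inner ℝ s (Z x) : ℝ)) ν := hint.const_inner s
            have h2 : ∫ x, (inner ℝ s (Z x) : ℝ) ∂ν = 0 := by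
              rw [integral_inner hint, hZ0, inner_zero_right]
            rw [integral_mul_const, integral_add (integrable_const _) (h1.const_mul _),
              integral_const_mul (Real.sinh (l * ‖s‖) * Real.sinh (l * b) / (‖s‖ * b)), h2]
            simp
            ring
          · exact ((integrable_const _).add ((hint.const_inner s).const_mul _)).mul_const _
          · refine Filter.Eventually.of_forall fun x => ?_
            refine mul_nonneg ?_ (by positivity)
            exact (Real.cosh_pos _).le.trans (cosh_norm_add_le s (Z x) hb (hZb x) hl)

/-- Hoeffding's inequality for bounded vectors in Hilbert space. -/
theorem measure_norm_mean_sub_ge_le {Z : Ω → E} (hZ : Measurable Z) {b ε : ℝ} (hb : 0 < b)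
    (hZb : ∀ ω, ‖Z ω‖ ≤ b) (hε : 0 < ε) {n : ℕ} (hn : 0 < n) :
    (Measure.pi fun _ : Fin n => ν) {ω | ε ≤ ‖(n : ℝ)⁻¹ • ∑ i, Z (ω i) - ∫ ω, Z ω ∂ν‖} ≤
      ENNReal.ofReal (2 * Real.exp (-(n * ε ^ 2 / (8 * b ^ 2)))) := by
  have hint : Integrable Z ν :=
    Integrable.of_bound hZ.aestronglyMeasurable b (Filter.Eventually.of_forall hZb)
  set m := ∫ ω, Z ω ∂ν
  have hm : ‖m‖ ≤ b := by
    simpa using norm_integral_le_of_norm_le_const (μ := ν) (Filter.Eventually.of_forall hZb)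
  have hn' : (0 : ℝ) < n := by exact_mod_cast hn
  -- This minimizes the final exponent `n ((2 b l)² / 2 - l ε)`; the centred vectors are bounded by
  -- `2 b`.
  set l : ℝ := ε / (4 * b ^ 2)
  have hl : 0 < l := by positivity
  have key := lintegral_cosh_norm_add_sum_le (ν := ν) (Z := fun ω => Z ω - m)
    (hZ.sub measurable_const) (b := 2 * b) (l := l) (by positivity)
    (fun ω => (norm_sub_le _ _).trans (by linarith [hZb ω]))
    (by rw [integral_sub hint (integrable_const _)]; simp [m]) hl.le n 0
  have hmeas : Measurable fun ω : Fin n → Ω =>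
      ENNReal.ofReal (Real.cosh (l * ‖(0 : E) + ∑ i, (Z (ω i) - m)‖)) := by
    have : Measurable fun ω : Fin n → Ω => (0 : E) + ∑ i, (Z (ω i) - m) :=
      measurable_const.add (Finset.measurable_sum _ fun i _ =>
        (hZ.comp (measurable_pi_apply i)).sub measurable_const)
    exact (Real.measurable_cosh.comp (this.norm.const_mul l)).ennreal_ofReal
  have hc0 : 0 < Real.cosh (l * (n * ε)) := Real.cosh_pos _
  have hsub : {ω : Fin n → Ω | ε ≤ ‖(n : ℝ)⁻¹ • ∑ i, Z (ω i) - m‖} ⊆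
      {ω | ENNReal.ofReal (Real.cosh (l * (n * ε))) ≤
        ENNReal.ofReal (Real.cosh (l * ‖(0 : E) + ∑ i, (Z (ω i) - m)‖))} := by
    intro ω hω
    simp only [Set.mem_ofPred_eq] at hω ⊢
    refine ENNReal.ofReal_le_ofReal ?_
    rw [Real.cosh_le_cosh, abs_of_nonneg (by positivity), abs_of_nonneg (by positivity)]
    gcongr
    have e : (0 : E) + ∑ i, (Z (ω i) - m) = (n : ℝ) • ((n : ℝ)⁻¹ • ∑ i, Z (ω i) - m) := by
      rw [smul_sub, smul_inv_smul₀ hn'.ne', Finset.sum_sub_distrib]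
      simp [Nat.cast_smul_eq_nsmul]
    rw [e, norm_smul, Real.norm_of_nonneg hn'.le]
    gcongr
  have h1 := mul_meas_ge_le_lintegral₀ (μ := Measure.pi fun _ : Fin n => ν) hmeas.aemeasurable
    (ENNReal.ofReal (Real.cosh (l * (n * ε))))
  have h2 : ENNReal.ofReal (Real.cosh (l * (n * ε))) *
      (Measure.pi fun _ : Fin n => ν) {ω | ε ≤ ‖(n : ℝ)⁻¹ • ∑ i, Z (ω i) - m‖} ≤
      ENNReal.ofReal (Real.cosh (l * (2 * b)) ^ n) := by
    refine (mul_le_mul_right (measure_mono hsub) _).trans (h1.trans (key.trans ?_))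
    simp
  have h3 : (Measure.pi fun _ : Fin n => ν) {ω | ε ≤ ‖(n : ℝ)⁻¹ • ∑ i, Z (ω i) - m‖} ≤
      ENNReal.ofReal (Real.cosh (l * (2 * b)) ^ n / Real.cosh (l * (n * ε))) := by
    rw [ENNReal.ofReal_div_of_pos hc0, ENNReal.le_div_iff_mul_le (by simp [hc0]) (by simp)]
    rwa [mul_comm]
  refine h3.trans (ENNReal.ofReal_le_ofReal ?_)
  have hA : Real.cosh (l * (2 * b)) ^ n ≤ Real.exp (n * ((l * (2 * b)) ^ 2 / 2)) := by
    rw [Real.exp_nat_mul]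
    exact pow_le_pow_left₀ (Real.cosh_pos _).le (Real.cosh_le_exp_half_sq _) n
  have hB : Real.exp (l * (n * ε)) / 2 ≤ Real.cosh (l * (n * ε)) := by
    rw [Real.cosh_eq]
    have := Real.exp_pos (-(l * (n * ε)))
    linarith
  calc _ ≤ Real.exp (n * ((l * (2 * b)) ^ 2 / 2)) / (Real.exp (l * (n * ε)) / 2) := by
        gcongr
    _ = 2 * Real.exp (n * ((l * (2 * b)) ^ 2 / 2) - l * (n * ε)) := by
        rw [Real.exp_sub]; field_simp
    _ = _ := by
        congr 2
        simp only [l]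
        field_simp
        ring

end Hoeffding

/-! ### A bounded rational vector field -/

section Field

variable {E : Type*} [NormedAddCommGroup E] [InnerProductSpace ℝ E]

/-- `x / (1 + y² ‖x‖²)`. -/
def invField (y : ℝ) (x : E) : E := (1 + y ^ 2 * ‖x‖ ^ 2)⁻¹ • x

theorem invField_scale {y : ℝ} (hy : y ≠ 0) (x : E) :
    invField y x = y⁻¹ • invField 1 (y • x) := by
  simp only [invField, norm_smul, mul_pow, Real.norm_eq_abs, sq_abs, one_pow, one_mul, smul_smul]
  congr 1
  field_simp

theorem norm_invField_le {y : ℝ} (hy : 0 < y) (x : E) : ‖invField y x‖ ≤ 1 / (2 * y) := by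
  have h0 : 0 < 1 + y ^ 2 * ‖x‖ ^ 2 := by positivity
  rw [invField, norm_smul, Real.norm_of_nonneg (by positivity), inv_mul_eq_div, div_le_div_iff₀ h0
    (by positivity)]
  nlinarith [sq_nonneg (1 - y * ‖x‖)]

theorem norm_invField_one_sub_le (p x : E) : ‖invField 1 p - invField 1 x‖ ≤ 3 * ‖p - x‖ := by
  set q := 1 + ‖x‖ ^ 2
  set Q := 1 + ‖p‖ ^ 2
  have hq : 0 < q := by positivity
  have hQ : 0 < Q := by positivity
  have hq1 : 1 ≤ q := by simp only [q]; nlinarith [sq_nonneg ‖x‖]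
  have e : invField 1 p - invField 1 x = q⁻¹ • (p - x) + ((q - Q) / (q * Q)) • p := by
    simp only [invField, one_pow, one_mul]
    have h1 : (q - Q) / (q * Q) = Q⁻¹ - q⁻¹ := by field_simp
    rw [h1]
    module
  have hx : |q - Q| ≤ ‖p - x‖ * (‖x‖ + ‖p‖) := by
    have : q - Q = (‖x‖ - ‖p‖) * (‖x‖ + ‖p‖) := by simp only [q, Q]; ring
    rw [this, abs_mul, abs_of_nonneg (by positivity : 0 ≤ ‖x‖ + ‖p‖)]
    gcongr
    rw [← abs_neg, neg_sub]
    exact abs_norm_sub_norm_le p x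
  have h2 : (‖x‖ + ‖p‖) * ‖p‖ ≤ 2 * (q * Q) := by
    simp only [q, Q]
    nlinarith [sq_nonneg (‖x‖ - ‖p‖), sq_nonneg (‖x‖ * ‖p‖), sq_nonneg ‖x‖, sq_nonneg ‖p‖]
  rw [e]
  refine (norm_add_le _ _).trans ?_
  rw [norm_smul, norm_smul, Real.norm_eq_abs, Real.norm_eq_abs, abs_div,
    abs_of_pos (by positivity : 0 < q⁻¹), abs_of_pos (by positivity : 0 < q * Q)]
  have h3 : q⁻¹ * ‖p - x‖ ≤ ‖p - x‖ :=
    mul_le_of_le_one_left (norm_nonneg _) (inv_le_one_of_one_le₀ hq1)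
  have h4 : |q - Q| / (q * Q) * ‖p‖ ≤ 2 * ‖p - x‖ := by
    rw [div_mul_eq_mul_div, div_le_iff₀ (by positivity)]
    calc |q - Q| * ‖p‖ ≤ ‖p - x‖ * (‖x‖ + ‖p‖) * ‖p‖ := by gcongr
      _ = ‖p - x‖ * ((‖x‖ + ‖p‖) * ‖p‖) := by ring
      _ ≤ ‖p - x‖ * (2 * (q * Q)) := by gcongr
      _ = _ := by ring
  linarith

theorem norm_invField_sub_le {y : ℝ} (hy : 0 < y) (p x : E) :
    ‖invField y p - invField y x‖ ≤ 3 * ‖p - x‖ := by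
  rw [invField_scale hy.ne', invField_scale hy.ne', ← smul_sub, norm_smul, norm_inv,
    Real.norm_of_nonneg hy.le, inv_mul_le_iff₀ hy]
  refine (norm_invField_one_sub_le _ _).trans ?_
  rw [← smul_sub, norm_smul, Real.norm_of_nonneg hy.le]
  linarith

/-- The map is the normalization of `(x, 1)` in `E × ℝ`, with the last coordinate dropped.
Normalization is 1-Lipschitz on vectors of norm at least one; `A` and `B` are the norms of the two
lifted vectors. -/
theorem norm_sqrt_smul_sub_le (p x : E) :
    ‖(√(1 + ‖p‖ ^ 2))⁻¹ • p - (√(1 + ‖x‖ ^ 2))⁻¹ • x‖ ≤ ‖p - x‖ := by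
  have hQ : 0 < 1 + ‖p‖ ^ 2 := by positivity
  have hq : 0 < 1 + ‖x‖ ^ 2 := by positivity
  set A := √(1 + ‖p‖ ^ 2)
  set B := √(1 + ‖x‖ ^ 2)
  have hA : 0 < A := Real.sqrt_pos.2 hQ
  have hB : 0 < B := Real.sqrt_pos.2 hq
  have hA2 : A ^ 2 = 1 + ‖p‖ ^ 2 := Real.sq_sqrt hQ.le
  have hB2 : B ^ 2 = 1 + ‖x‖ ^ 2 := Real.sq_sqrt hq.le
  have hA1 : 1 ≤ A := by nlinarith [sq_nonneg ‖p‖]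
  have hB1 : 1 ≤ B := by nlinarith [sq_nonneg ‖x‖]
  have hAB : 1 ≤ A * B := by nlinarith
  rw [← pow_le_pow_iff_left₀ (norm_nonneg _) (norm_nonneg _) two_ne_zero, norm_sub_sq_real,
    norm_sub_sq_real, norm_smul, norm_smul, inner_smul_left, inner_smul_right]
  simp only [norm_inv, Real.norm_of_nonneg hA.le, Real.norm_of_nonneg hB.le, conj_trivial]
  set c := (inner ℝ p x : ℝ)
  have e1 : (A⁻¹ * ‖p‖) ^ 2 = 1 - (A ^ 2)⁻¹ := by
    have : ‖p‖ ^ 2 = A ^ 2 - 1 := by linarith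
    rw [mul_pow, this]; field_simp
  have e2 : (B⁻¹ * ‖x‖) ^ 2 = 1 - (B ^ 2)⁻¹ := by
    have : ‖x‖ ^ 2 = B ^ 2 - 1 := by linarith
    rw [mul_pow, this]; field_simp
  have e3 : ‖p‖ ^ 2 - 2 * c + ‖x‖ ^ 2 = A ^ 2 + B ^ 2 - 2 - 2 * c := by linarith
  have h0 : 0 ≤ A ^ 2 + B ^ 2 - 2 - 2 * c := by
    rw [← e3, ← norm_sub_sq_real]; positivity
  have e4 : 2 * (A * B)⁻¹ ≤ (A ^ 2)⁻¹ + (B ^ 2)⁻¹ := by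
    have := sq_nonneg (A⁻¹ - B⁻¹)
    rw [mul_inv, ← inv_pow, ← inv_pow]
    nlinarith
  have h5 : A ^ 2 + B ^ 2 - 2 - 2 * c ≥ (2 * (A * B) - 2 - 2 * c) * (A * B)⁻¹ := by
    have h6 : 2 * (A * B) - 2 - 2 * c ≤ A ^ 2 + B ^ 2 - 2 - 2 * c := by
      nlinarith [sq_nonneg (A - B)]
    have h7 : (A * B)⁻¹ ≤ 1 := inv_le_one_of_one_le₀ hAB
    have h8 : 0 < (A * B)⁻¹ := by positivity
    nlinarith
  have h9 : (2 * (A * B) - 2 - 2 * c) * (A * B)⁻¹ =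
      2 - 2 * (A * B)⁻¹ - 2 * (A⁻¹ * (B⁻¹ * c)) := by
    field_simp
  rw [e1, e2, e3]
  linarith

/-- With `k x = x / √(1 + ‖x‖²)` the expression is the difference of `⟪k p, z⟫ k p` and `⟪k x, z⟫ k
x`. Since `k` is 1-Lipschitz and bounded by one, each factor contributes once. -/
theorem norm_rankOne_sub_le (p x z : E) :
    ‖(inner ℝ p z / (1 + ‖p‖ ^ 2)) • p - (inner ℝ x z / (1 + ‖x‖ ^ 2)) • x‖ ≤
      2 * ‖z‖ * ‖p - x‖ := by
  set A := √(1 + ‖p‖ ^ 2)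
  set B := √(1 + ‖x‖ ^ 2)
  have hQ : 0 < 1 + ‖p‖ ^ 2 := by positivity
  have hq : 0 < 1 + ‖x‖ ^ 2 := by positivity
  have hA : 0 < A := Real.sqrt_pos.2 hQ
  have hB : 0 < B := Real.sqrt_pos.2 hq
  have hA2 : A ^ 2 = 1 + ‖p‖ ^ 2 := Real.sq_sqrt hQ.le
  have hB2 : B ^ 2 = 1 + ‖x‖ ^ 2 := Real.sq_sqrt hq.le
  have hk := norm_sqrt_smul_sub_le p x
  have hkp : ‖A⁻¹ • p‖ ≤ 1 := by
    rw [norm_smul, norm_inv, Real.norm_of_nonneg hA.le, inv_mul_le_iff₀ hA, mul_one]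
    exact Real.le_sqrt_of_sq_le (by linarith)
  have hkx : ‖B⁻¹ • x‖ ≤ 1 := by
    rw [norm_smul, norm_inv, Real.norm_of_nonneg hB.le, inv_mul_le_iff₀ hB, mul_one]
    exact Real.le_sqrt_of_sq_le (by linarith)
  have e : (inner ℝ p z / (1 + ‖p‖ ^ 2)) • p - (inner ℝ x z / (1 + ‖x‖ ^ 2)) • x =
      (inner ℝ (A⁻¹ • p) z : ℝ) • (A⁻¹ • p - B⁻¹ • x) +
        (inner ℝ (A⁻¹ • p - B⁻¹ • x) z : ℝ) • (B⁻¹ • x) := by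
    rw [← hA2, ← hB2]
    simp only [inner_sub_left, inner_smul_left, conj_trivial]
    have h1 : (inner ℝ p z / A ^ 2 : ℝ) = A⁻¹ * inner ℝ p z * A⁻¹ := by field_simp
    have h2 : (inner ℝ x z / B ^ 2 : ℝ) = B⁻¹ * inner ℝ x z * B⁻¹ := by field_simp
    rw [h1, h2]
    module
  rw [e]
  refine (norm_add_le _ _).trans ?_
  rw [norm_smul, norm_smul]
  have h1 := norm_inner_le_norm (𝕜 := ℝ) (A⁻¹ • p) z
  have h2 := norm_inner_le_norm (𝕜 := ℝ) (A⁻¹ • p - B⁻¹ • x) z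
  have h3 : ‖(inner ℝ (A⁻¹ • p) z : ℝ)‖ * ‖A⁻¹ • p - B⁻¹ • x‖ ≤ 1 * ‖z‖ * ‖p - x‖ := by
    gcongr
    exact h1.trans (by gcongr)
  have h4 : ‖(inner ℝ (A⁻¹ • p - B⁻¹ • x) z : ℝ)‖ * ‖B⁻¹ • x‖ ≤ ‖p - x‖ * ‖z‖ * 1 := by
    gcongr
    exact h2.trans (by gcongr)
  linarith

/-- The linear map is the derivative at `x`. What matters is the decay `1 / (1 + ‖x‖²)` of the
remainder for every `z`, large or small; it comes from an exact formula for the remainder, not from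
a bound on second derivatives. -/
theorem exists_linear_approx_invField_one (x : E) : ∃ A : E →L[ℝ] E, ∀ z,
    ‖invField 1 (x + z) - invField 1 x - A z‖ ≤ 5 * ‖z‖ ^ 2 / (1 + ‖x‖ ^ 2) := by
  set q := 1 + ‖x‖ ^ 2 with hqd
  have hq : 0 < q := by positivity
  refine ⟨q⁻¹ • ContinuousLinearMap.id ℝ E - (2 / q ^ 2) • (innerSL ℝ x).smulRight x,
    fun z => ?_⟩
  set p := x + z with hp
  set Q := 1 + ‖p‖ ^ 2 with hQd
  have hQ : 0 < Q := by positivity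
  have hpz : inner ℝ p z = (inner ℝ x z : ℝ) + ‖z‖ ^ 2 := by
    rw [hp, inner_add_left, real_inner_self_eq_norm_sq]
  have hQq : Q = q + 2 * inner ℝ x z + ‖z‖ ^ 2 := by
    rw [hQd, hp, norm_add_sq_real, hqd]; ring
  -- The factor `q⁻¹` is already outside. The bracket is `O(‖z‖²)` because the rank-one fields at
  -- `p` and `x` differ by `O(‖z‖ ‖p - x‖)` and `p - x = z`.
  have e : invField 1 p - invField 1 x -
      (q⁻¹ • ContinuousLinearMap.id ℝ E - (2 / q ^ 2) • (innerSL ℝ x).smulRight x) z =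
      q⁻¹ • ((‖z‖ ^ 2 / Q) • p -
        (2 : ℝ) • ((inner ℝ p z / Q) • p - (inner ℝ x z / q) • x)) := by
    have h1 : invField 1 p - invField 1 x -
        (q⁻¹ • ContinuousLinearMap.id ℝ E - (2 / q ^ 2) • (innerSL ℝ x).smulRight x) z =
        (Q⁻¹ - q⁻¹ + 2 * inner ℝ x z / q ^ 2) • x + (Q⁻¹ - q⁻¹) • z := by
      simp only [invField, one_pow, one_mul, ← hqd, ← hQd]
      simp only [hp, sub_apply, smul_apply,
        ContinuousLinearMap.id_apply, ContinuousLinearMap.smulRight_apply, innerSL_apply_apply,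
        smul_smul]
      rw [show 2 * (inner ℝ x z : ℝ) / q ^ 2 = 2 / q ^ 2 * inner ℝ x z by ring]
      module
    have h2 : q⁻¹ • ((‖z‖ ^ 2 / Q) • p -
        (2 : ℝ) • ((inner ℝ p z / Q) • p - (inner ℝ x z / q) • x)) =
        (q⁻¹ * (‖z‖ ^ 2 / Q - 2 * (inner ℝ p z / Q) + 2 * (inner ℝ x z / q))) • x +
          (q⁻¹ * (‖z‖ ^ 2 / Q - 2 * (inner ℝ p z / Q))) • z := by
      rw [hp]; module
    rw [h1, h2, hpz]
    have hz : ‖z‖ ^ 2 = Q - q - 2 * inner ℝ x z := by linarith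
    rw [hz]
    congr 2 <;> (field_simp; ring)
  rw [e, norm_smul, norm_inv, Real.norm_of_nonneg hq.le, inv_mul_eq_div]
  gcongr
  refine (norm_sub_le _ _).trans ?_
  have h1 : ‖(‖z‖ ^ 2 / Q) • p‖ ≤ ‖z‖ ^ 2 := by
    rw [norm_smul, Real.norm_of_nonneg (by positivity), div_mul_eq_mul_div,
      div_le_iff₀ hQ]
    gcongr
    nlinarith [sq_nonneg (‖p‖ - 1)]
  have h2 : ‖(2 : ℝ) • ((inner ℝ p z / Q) • p - (inner ℝ x z / q) • x)‖ ≤ 4 * ‖z‖ ^ 2 := by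
    rw [norm_smul, Real.norm_of_nonneg (by norm_num)]
    have := norm_rankOne_sub_le p x z
    rw [show p - x = z by rw [hp]; abel] at this
    calc _ ≤ 2 * (2 * ‖z‖ * ‖z‖) := by gcongr
      _ = _ := by ring
  linarith

theorem exists_linear_approx_invField {y : ℝ} (hy : 0 < y) (x : E) :
    ∃ A : E →L[ℝ] E, ∀ z, ‖invField y (x + z) - invField y x - A z‖ ≤
      5 * y * ‖z‖ ^ 2 / (1 + y ^ 2 * ‖x‖ ^ 2) := by
  obtain ⟨A, hA⟩ := exists_linear_approx_invField_one (y • x)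
  refine ⟨A, fun z => ?_⟩
  have h := hA (y • z)
  rw [← smul_add] at h
  have e : invField y (x + z) - invField y x - A z =
      y⁻¹ • (invField 1 (y • (x + z)) - invField 1 (y • x) - A (y • z)) := by
    rw [invField_scale hy.ne', invField_scale hy.ne' x, map_smul, smul_sub, smul_sub,
      inv_smul_smul₀ hy.ne']
  rw [e, norm_smul, norm_inv, Real.norm_of_nonneg hy.le, inv_mul_le_iff₀ hy]
  refine h.trans (le_of_eq ?_)
  rw [norm_smul, norm_smul, Real.norm_of_nonneg hy.le]
  ring

/-- Directional derivative of `invField y`, tested against its direction. -/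
theorem hasDerivAt_inner_invField (y : ℝ) (p v : E) (t : ℝ) :
    HasDerivAt (fun t : ℝ => (inner ℝ (invField y (p + t • v)) v : ℝ))
      (‖v‖ ^ 2 / (1 + y ^ 2 * ‖p + t • v‖ ^ 2) -
        2 * y ^ 2 * (inner ℝ (p + t • v) v) ^ 2 / (1 + y ^ 2 * ‖p + t • v‖ ^ 2) ^ 2) t := by
  have h0 : HasDerivAt (fun t : ℝ => p + t • v) v t := by
    simpa using ((hasDerivAt_id t).smul_const v).const_add p
  have hq : (1 + y ^ 2 * ‖p + t • v‖ ^ 2) ≠ 0 := by positivity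
  have h1 : HasDerivAt (fun t : ℝ => (1 + y ^ 2 * ‖p + t • v‖ ^ 2)⁻¹)
      (-(y ^ 2 * (2 * inner ℝ (p + t • v) v)) / (1 + y ^ 2 * ‖p + t • v‖ ^ 2) ^ 2) t :=
    ((h0.norm_sq.const_mul (y ^ 2)).const_add 1).inv hq
  have h2 : HasDerivAt (fun t : ℝ => (inner ℝ (p + t • v) v : ℝ)) (‖v‖ ^ 2) t := by
    simpa using h0.inner ℝ (hasDerivAt_const t v)
  have h3 := h1.mul h2
  have e : (fun t : ℝ => (inner ℝ (invField y (p + t • v)) v : ℝ)) =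
      fun t : ℝ => (1 + y ^ 2 * ‖p + t • v‖ ^ 2)⁻¹ * inner ℝ (p + t • v) v := by
    funext t
    rw [invField, inner_smul_left]; simp
  rw [e]
  refine h3.congr_deriv ?_
  field_simp
  ring

/-- The nodes `1/M, 2/M, …, 1`. -/
def node (M : ℕ) (j : Fin M) : ℝ := ((j : ℝ) + 1) / M

theorem node_pos {M : ℕ} (j : Fin M) : 0 < node M j := by
  have : 0 < M := j.pos
  unfold node
  positivity

theorem node_le_one {M : ℕ} (j : Fin M) : node M j ≤ 1 := by
  have h : 0 < M := j.pos
  have h2 : ((j : ℝ) + 1) ≤ M := by exact_mod_cast j.2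
  rw [node, div_le_one (by exact_mod_cast h)]
  exact h2

/-- The average of `invField y` over the nodes `y`. It is a rational approximation of
`x ↦ arctan ‖x‖ • x / ‖x‖`. -/
def avgField (M : ℕ) (x : E) : E := (M : ℝ)⁻¹ • ∑ j : Fin M, invField (node M j) x

/-- `1 + 1/2 + … + 1/M`. -/
def harmonicSum (M : ℕ) : ℝ := ∑ j : Fin M, 1 / ((j : ℝ) + 1)

theorem norm_avgField_le (M : ℕ) (x : E) : ‖avgField M x‖ ≤ harmonicSum M := by
  rw [avgField, norm_smul, norm_inv, Real.norm_natCast, harmonicSum]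
  calc _ ≤ (M : ℝ)⁻¹ * ∑ j : Fin M, ‖invField (node M j) x‖ := by gcongr; exact norm_sum_le _ _
    _ = ∑ j : Fin M, (M : ℝ)⁻¹ * ‖invField (node M j) x‖ := by rw [Finset.mul_sum]
    _ ≤ _ := by
      refine Finset.sum_le_sum fun j _ => ?_
      have hM : (0 : ℝ) < M := by exact_mod_cast j.pos
      refine (mul_le_mul_of_nonneg_left (norm_invField_le (node_pos j) x)
        (by positivity)).trans ?_
      unfold node
      have : (0 : ℝ) < (j : ℝ) + 1 := by positivity
      rw [show (M : ℝ)⁻¹ * (1 / (2 * (((j : ℝ) + 1) / M))) = 1 / (2 * ((j : ℝ) + 1)) by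
        field_simp]
      apply one_div_le_one_div_of_le this
      linarith

theorem norm_avgField_sub_le (M : ℕ) (p x : E) :
    ‖avgField M p - avgField M x‖ ≤ 3 * ‖p - x‖ := by
  rcases Nat.eq_zero_or_pos M with rfl | hM
  · simp [avgField]
  have hM' : (0 : ℝ) < M := by exact_mod_cast hM
  rw [avgField, avgField, ← smul_sub, ← Finset.sum_sub_distrib, norm_smul, norm_inv,
    Real.norm_natCast, inv_mul_le_iff₀ hM']
  refine (norm_sum_le _ _).trans ((Finset.sum_le_sum fun j _ =>
    norm_invField_sub_le (node_pos j) p x).trans ?_)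
  simp

/-- For nodes `y ≤ 1`, `y / (1 + y² ‖x‖²) ≤ y⁻¹ / (1 + ‖x‖²)`, and the average of `y⁻¹` over the
nodes is the harmonic sum. All nodes thus share one weight, the one that also governs the
monotonicity. -/
theorem exists_linear_approx_avgField (M : ℕ) (x : E) : ∃ A : E →L[ℝ] E, ∀ z,
    ‖avgField M (x + z) - avgField M x - A z‖ ≤
      5 * harmonicSum M * ‖z‖ ^ 2 / (1 + ‖x‖ ^ 2) := by
  choose A hA using fun j : Fin M => exists_linear_approx_invField (node_pos j) x
  refine ⟨(M : ℝ)⁻¹ • ∑ j, A j, fun z => ?_⟩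
  have e : avgField M (x + z) - avgField M x - ((M : ℝ)⁻¹ • ∑ j, A j) z =
      (M : ℝ)⁻¹ • ∑ j, (invField (node M j) (x + z) - invField (node M j) x - A j z) := by
    simp only [avgField, smul_apply, sum_apply,
      Finset.sum_sub_distrib, smul_sub]
  rw [e, norm_smul, norm_inv, Real.norm_natCast]
  calc _ ≤ (M : ℝ)⁻¹ * ∑ j, 5 * node M j * ‖z‖ ^ 2 / (1 + node M j ^ 2 * ‖x‖ ^ 2) := by
        gcongr
        exact (norm_sum_le _ _).trans (Finset.sum_le_sum fun j _ => hA j z)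
    _ = ∑ j, (M : ℝ)⁻¹ * (5 * node M j * ‖z‖ ^ 2 / (1 + node M j ^ 2 * ‖x‖ ^ 2)) := by
        rw [Finset.mul_sum]
    _ ≤ ∑ j : Fin M, 1 / ((j : ℝ) + 1) * (5 * ‖z‖ ^ 2 / (1 + ‖x‖ ^ 2)) := by
        refine Finset.sum_le_sum fun j _ => ?_
        have hM : (0 : ℝ) < M := by exact_mod_cast j.pos
        have h0 := node_pos j
        have h1 := node_le_one j
        have e1 : 1 / ((j : ℝ) + 1) = (M : ℝ)⁻¹ * (node M j)⁻¹ := by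
          unfold node; field_simp
        rw [e1, mul_assoc (M : ℝ)⁻¹ (node M j)⁻¹]
        refine mul_le_mul_of_nonneg_left ?_ (inv_nonneg.2 hM.le)
        rw [inv_mul_eq_div, div_div, div_le_div_iff₀ (by positivity) (by positivity)]
        have h2 : node M j ^ 2 ≤ 1 := by nlinarith
        have h3 : (1 + ‖x‖ ^ 2) * node M j ^ 2 ≤ 1 + node M j ^ 2 * ‖x‖ ^ 2 := by nlinarith
        have h4 := mul_le_mul_of_nonneg_left h3 (by positivity : 0 ≤ 5 * ‖z‖ ^ 2)
        linarith
    _ = _ := by rw [← Finset.sum_mul, harmonicSum]; ring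

/-- The right side is the derivative of `s / (1 + s²)` at `s`; the first term on the left is its
divided difference between `s'` and `s`. The correction is a decrement of a monotone function, so
both parts telescope when summed over nodes. -/
theorem radial_slope_ge {s s' : ℝ} (h0 : 0 ≤ s') (h : s' ≤ s) :
    (1 - s * s') / ((1 + s ^ 2) * (1 + s' ^ 2)) - 3 * (1 / (1 + s' ^ 2) - 1 / (1 + s ^ 2)) ≤
      (1 - s ^ 2) / (1 + s ^ 2) ^ 2 := by
  have hs : 0 ≤ s := h0.trans h
  have e : (1 - s ^ 2) / (1 + s ^ 2) ^ 2 - ((1 - s * s') / ((1 + s ^ 2) * (1 + s' ^ 2)) -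
      3 * (1 / (1 + s' ^ 2) - 1 / (1 + s ^ 2))) =
      (s - s') * (s ^ 2 * s' - s' - 2 * s + 3 * (s + s') * (1 + s ^ 2)) /
        ((1 + s ^ 2) ^ 2 * (1 + s' ^ 2)) := by
    field_simp
    ring
  have h1 : 0 ≤ s ^ 2 * s' - s' - 2 * s + 3 * (s + s') * (1 + s ^ 2) := by
    have h2 : 0 ≤ s ^ 2 * s' := by positivity
    have h3 : 0 ≤ (s + s') * s ^ 2 := by positivity
    nlinarith
  have h4 : 0 ≤ s - s' := sub_nonneg.2 h
  rw [← sub_nonneg, e]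
  positivity

/-- A single `invField y` is not monotone: its radial slope is negative where `y r > 1`. The average
over `y` is a Riemann sum of `∫₀¹ d/dy (y / (1 + y² r²)) dy = 1 / (1 + r²)`. The sums of `T` and `U`
telescope to the main term and to an error of at most `3 / M`, uniformly in `r`. -/
theorem avg_radial_slope_ge {M : ℕ} (hM : 0 < M) {r : ℝ} (hr : 0 ≤ r) :
    1 / (1 + r ^ 2) - 3 / M ≤
      (M : ℝ)⁻¹ * ∑ j : Fin M, (1 - node M j ^ 2 * r ^ 2) / (1 + node M j ^ 2 * r ^ 2) ^ 2 := by
  have hM' : (0 : ℝ) < M := by exact_mod_cast hM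
  set T : ℕ → ℝ := fun j => (j / M : ℝ) / (1 + (j / M * r : ℝ) ^ 2) with hT
  set U : ℕ → ℝ := fun j => 1 / (1 + (j / M * r : ℝ) ^ 2) with hU
  have hstep : ∀ j : Fin M, (T ((j : ℕ) + 1) - T j) - 3 / M * (U j - U ((j : ℕ) + 1)) ≤
      (M : ℝ)⁻¹ * ((1 - node M j ^ 2 * r ^ 2) / (1 + node M j ^ 2 * r ^ 2) ^ 2) := by
    intro j
    have h := radial_slope_ge (s := node M j * r) (s' := (j : ℕ) / M * r) (by positivity) (by
      unfold node; gcongr; linarith)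
    rw [← mul_pow]
    have h2 := mul_le_mul_of_nonneg_left h (by positivity : 0 ≤ (M : ℝ)⁻¹)
    refine le_trans (le_of_eq ?_) h2
    have hj : (((j : ℕ) + 1 : ℕ) : ℝ) / M = node M j := by unfold node; push_cast; rfl
    have hj' : ((j : ℕ) : ℝ) / M = node M j - (M : ℝ)⁻¹ := by unfold node; field_simp; ring
    simp only [hT, hU, hj]
    rw [hj']
    have h5 : (1 + ((node M j - (M : ℝ)⁻¹) * r) ^ 2) ≠ 0 := by positivity
    have h6 : (1 + (node M j * r) ^ 2) ≠ 0 := by positivity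
    have h7 : node M j / (1 + (node M j * r) ^ 2) -
        (node M j - (M : ℝ)⁻¹) / (1 + ((node M j - (M : ℝ)⁻¹) * r) ^ 2) =
        (M : ℝ)⁻¹ * ((1 - node M j * r * ((node M j - (M : ℝ)⁻¹) * r)) /
          ((1 + (node M j * r) ^ 2) * (1 + ((node M j - (M : ℝ)⁻¹) * r) ^ 2))) := by
      rw [div_sub_div _ _ h6 h5, ← mul_div_assoc]
      congr 1
      ring
    rw [h7]
    ring
  have hsum := Finset.sum_le_sum fun j (_ : j ∈ (Finset.univ : Finset (Fin M))) => hstep j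
  rw [Finset.mul_sum]
  refine le_trans ?_ hsum
  rw [Finset.sum_sub_distrib, ← Finset.mul_sum,
    Fin.sum_univ_eq_sum_range (fun j => T (j + 1) - T j) M,
    Fin.sum_univ_eq_sum_range (fun j => U j - U (j + 1)) M, Finset.sum_range_sub,
    Finset.sum_range_sub']
  have hT0 : T 0 = 0 := by simp [hT]
  have hTM : T M = 1 / (1 + r ^ 2) := by simp [hT, div_self hM'.ne']
  have hU0 : U 0 = 1 := by simp [hU]
  have hUM : 0 ≤ U M := by simp only [hU]; positivity
  rw [hT0, hTM, hU0]
  have : 3 / (M : ℝ) * (1 - U M) ≤ 3 / M * 1 := by gcongr; linarith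
  linarith

/-- Strong monotonicity of `avgField`, up to an error of order `1/M`. -/
theorem inner_avgField_sub_ge {M : ℕ} (hM : 0 < M) (p v : E) {W : ℝ}
    (hW : ∀ t ∈ Set.Icc (0 : ℝ) 1, 1 + ‖p + t • v‖ ^ 2 ≤ W) :
    (1 / W - 3 / M) * ‖v‖ ^ 2 ≤ inner ℝ (avgField M (p + v) - avgField M p) v := by
  have hM' : (0 : ℝ) < M := by exact_mod_cast hM
  set g : ℝ → ℝ := fun t => inner ℝ (avgField M (p + t • v)) v with hg
  have hder : ∀ t, HasDerivAt g ((M : ℝ)⁻¹ * ∑ j : Fin M,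
      (‖v‖ ^ 2 / (1 + node M j ^ 2 * ‖p + t • v‖ ^ 2) -
        2 * node M j ^ 2 * (inner ℝ (p + t • v) v) ^ 2 /
          (1 + node M j ^ 2 * ‖p + t • v‖ ^ 2) ^ 2)) t := by
    intro t
    have h := (HasDerivAt.fun_sum fun j (_ : j ∈ (Finset.univ : Finset (Fin M))) =>
      hasDerivAt_inner_invField (node M j) p v t).const_mul ((M : ℝ)⁻¹)
    refine h.congr_of_eventuallyEq (Filter.Eventually.of_forall fun t => ?_)
    simp only [hg, avgField, inner_smul_left, sum_inner, conj_trivial]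
  have hlow : ∀ t ∈ Set.Icc (0 : ℝ) 1, (1 / W - 3 / M) * ‖v‖ ^ 2 ≤ deriv g t := by
    intro t ht
    rw [(hder t).deriv]
    set x := p + t • v
    have hx := hW t ht
    have h1 : 1 / W - 3 / M ≤ 1 / (1 + ‖x‖ ^ 2) - 3 / M := by
      gcongr
    have h2 := avg_radial_slope_ge hM (norm_nonneg x)
    calc _ ≤ ((M : ℝ)⁻¹ * ∑ j : Fin M, (1 - node M j ^ 2 * ‖x‖ ^ 2) /
          (1 + node M j ^ 2 * ‖x‖ ^ 2) ^ 2) * ‖v‖ ^ 2 := by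
          gcongr
          exact h1.trans h2
      _ = (M : ℝ)⁻¹ * ∑ j : Fin M, (1 - node M j ^ 2 * ‖x‖ ^ 2) /
          (1 + node M j ^ 2 * ‖x‖ ^ 2) ^ 2 * ‖v‖ ^ 2 := by
          rw [mul_assoc, Finset.sum_mul]
      _ ≤ _ := by
          refine mul_le_mul_of_nonneg_left (Finset.sum_le_sum fun j _ => ?_) (by positivity)
          have hq : 0 < 1 + node M j ^ 2 * ‖x‖ ^ 2 := by positivity
          have hcs : (inner ℝ x v : ℝ) ^ 2 ≤ ‖x‖ ^ 2 * ‖v‖ ^ 2 := by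
            rw [← mul_pow]
            exact sq_le_sq' (neg_le_of_abs_le (abs_real_inner_le_norm x v))
              (real_inner_le_norm x v)
          rw [← sub_nonneg]
          -- The excess over the radial slope is a multiple of the Cauchy–Schwarz defect, so the
          -- radial direction is the worst one.
          have e : ‖v‖ ^ 2 / (1 + node M j ^ 2 * ‖x‖ ^ 2) -
              2 * node M j ^ 2 * (inner ℝ x v) ^ 2 / (1 + node M j ^ 2 * ‖x‖ ^ 2) ^ 2 -
              (1 - node M j ^ 2 * ‖x‖ ^ 2) / (1 + node M j ^ 2 * ‖x‖ ^ 2) ^ 2 * ‖v‖ ^ 2 =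
              2 * node M j ^ 2 * (‖x‖ ^ 2 * ‖v‖ ^ 2 - (inner ℝ x v) ^ 2) /
                (1 + node M j ^ 2 * ‖x‖ ^ 2) ^ 2 := by
            field_simp
            ring
          rw [e]
          have := sub_nonneg.2 hcs
          positivity
  have hmv := (convex_Icc (0 : ℝ) 1).mul_sub_le_image_sub_of_le_deriv (f := g)
    (fun t _ => (hder t).continuousAt.continuousWithinAt)
    (fun t _ => (hder t).differentiableAt.differentiableWithinAt)
    (fun t ht => hlow t (interior_subset ht)) 0 (by simp) 1 (by simp) zero_le_one
  simpa [hg, inner_sub_left] using hmv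

end Field

/-! ### Gradient descent on an approximately monotone field -/

section Descent

variable {E : Type*} [NormedAddCommGroup E] [InnerProductSpace ℝ E]

/-- Only the part of the segment within distance one of `z` is credited with the modulus, because
there the weight is comparable to that at `z`. The remaining part loses at most `3 / M` per unit
length. The bound is thus quadratic for short `e` and linear for long `e`. -/
theorem inner_avgField_gap_ge {M : ℕ} (hM : 0 < M) {D : ℝ} (hD : 1 ≤ D) (z e : E)
    (he : ‖e‖ ≤ D) :
    ‖e‖ * min 1 ‖e‖ * (1 / (1 + ‖z‖ ^ 2) / 4 - 3 * D / M) ≤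
      inner ℝ (avgField M z - avgField M (z - e)) e := by
  have hM' : (0 : ℝ) < M := by exact_mod_cast hM
  have small : ∀ v : E, ‖v‖ ≤ 1 → (1 / (1 + ‖z‖ ^ 2) / 4 - 3 / M) * ‖v‖ ^ 2 ≤
      inner ℝ (avgField M z - avgField M (z - v)) v := by
    intro v hv
    have h := inner_avgField_sub_ge hM (z - v) v (W := (1 + ‖z‖ ^ 2) * 4) (by
      intro t ht
      have h1 : ‖z - v + t • v‖ ≤ ‖z‖ + 1 := by
        have e1 : z - v + t • v = z - (1 - t) • v := by module
        rw [e1]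
        refine (norm_sub_le _ _).trans ?_
        rw [norm_smul, Real.norm_of_nonneg (by linarith [ht.2])]
        have : (1 - t) * ‖v‖ ≤ 1 * 1 := by
          gcongr
          linarith [ht.1]
        linarith
      have h2 : ‖z - v + t • v‖ ^ 2 ≤ (‖z‖ + 1) ^ 2 := by gcongr
      nlinarith [sq_nonneg (‖z‖ - 1), sq_nonneg ‖z‖])
    rw [sub_add_cancel] at h
    rwa [div_div]
  have hMD : 3 / (M : ℝ) ≤ 3 * D / M := by
    gcongr; linarith
  rcases le_or_gt ‖e‖ 1 with h1 | h1
  · rw [min_eq_right h1]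
    refine le_trans ?_ (small e h1)
    rw [← pow_two, mul_comm]
    gcongr
  · rw [min_eq_left h1.le, mul_one]
    set n := ‖e‖ with hn
    have hn0 : 0 < n := by linarith
    set u : E := n⁻¹ • e with hu
    have hun : ‖u‖ = 1 := by
      rw [hu, norm_smul, norm_inv, Real.norm_of_nonneg hn0.le, ← hn, inv_mul_cancel₀ hn0.ne']
    have heu : e = n • u := by rw [hu, smul_inv_smul₀ hn0.ne']
    have hA := small u hun.le
    rw [hun, one_pow, mul_one] at hA
    have hv : ‖(n - 1) • u‖ = n - 1 := by
      rw [norm_smul, hun, mul_one, Real.norm_of_nonneg (by linarith)]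
    -- On this part `W` is irrelevant: only `1 / W ≥ 0` is used.
    have hB := inner_avgField_sub_ge hM (z - e) ((n - 1) • u)
      (W := 1 + (‖z - e‖ + ‖(n - 1) • u‖) ^ 2) (by
        intro t ht
        gcongr
        refine (norm_add_le _ _).trans ?_
        gcongr
        rw [norm_smul, Real.norm_of_nonneg ht.1]
        exact mul_le_of_le_one_left (norm_nonneg _) ht.2)
    rw [show z - e + (n - 1) • u = z - u by rw [heu]; module, inner_smul_right, hv] at hB
    set W := 1 + (‖z - e‖ + (n - 1)) ^ 2
    have hW : 0 ≤ 1 / W := by positivity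
    have hB' : -(3 / M) * (n - 1) ≤ inner ℝ (avgField M (z - u) - avgField M (z - e)) u := by
      have h3 : (n - 1) * (-(3 / M) * (n - 1)) ≤
          (n - 1) * inner ℝ (avgField M (z - u) - avgField M (z - e)) u := by
        refine le_trans ?_ hB
        nlinarith [sq_nonneg (n - 1), mul_nonneg hW (sq_nonneg (n - 1))]
      exact le_of_mul_le_mul_left h3 (by linarith)
    have hsplit : inner ℝ (avgField M z - avgField M (z - e)) e =
        n * ((inner ℝ (avgField M z - avgField M (z - u)) u : ℝ) +
          inner ℝ (avgField M (z - u) - avgField M (z - e)) u) := by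
      rw [← inner_add_left, sub_add_sub_cancel, ← inner_smul_right, ← heu]
    rw [hsplit]
    refine mul_le_mul_of_nonneg_left ?_ hn0.le
    have : 3 / (M : ℝ) * n ≤ 3 * D / M := by
      rw [div_mul_eq_mul_div]; gcongr
    linarith

variable {G : E → E} {α D P r : ℝ}

/-- Outside radius `r` the offset `G 0` uses up at most half of the monotonicity, and `‖G e‖ ≤ 4
‖e‖`. The step size makes the quadratic term half of the linear gain, which leaves the stated
contraction. Inside radius `r` a step may overshoot, but only to `2 * r`. -/
theorem descent_step (hlip : ∀ a b, ‖G a - G b‖ ≤ 3 * ‖a - b‖)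
    (hmono : ∀ e, ‖e‖ ≤ D → ‖e‖ * min 1 ‖e‖ * (P / 8) ≤ inner ℝ (G e - G 0) e)
    (h0 : ‖G 0‖ ≤ r * P / 16) (hr : 0 < r) (hr1 : r ≤ 1) (hD : 1 ≤ D) (hα : 0 < α)
    (hα1 : α ≤ 1) (hP : α / 16 ≤ P) (hP1 : P ≤ 1) (e : E) (he : ‖e‖ ≤ D) :
    (r ≤ ‖e‖ → ‖e - (α / (4096 * D)) • G e‖ ^ 2 ≤
      (1 - α ^ 2 / (2 ^ 20 * D ^ 2)) * ‖e‖ ^ 2) ∧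
    (‖e‖ ≤ r → ‖e - (α / (4096 * D)) • G e‖ ≤ 2 * r) := by
  set s := α / (4096 * D) with hs
  have hs0 : 0 < s := by positivity
  have hs4 : s ≤ 1 / 4 := by
    rw [hs, div_le_div_iff₀ (by positivity) (by positivity)]; nlinarith
  have hG : ‖G e‖ ≤ r + 3 * ‖e‖ := by
    have h1 := norm_le_norm_add_norm_sub' (G e) (G 0)
    have h2 := hlip e 0
    rw [sub_zero] at h2
    nlinarith
  have hP0 : 0 < P := lt_of_lt_of_le (by positivity) hP
  constructor
  · intro hre
    have he0 : 0 < ‖e‖ := hr.trans_le hre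
    have hmin : ‖e‖ / D ≤ min 1 ‖e‖ := by
      refine le_min ?_ ?_
      · rw [div_le_one (by linarith)]; exact he
      · exact div_le_self he0.le hD
    have hmin' : r ≤ min 1 ‖e‖ := le_min hr1 hre
    have hin : ‖e‖ * (‖e‖ / D) * (P / 16) ≤ inner ℝ (G e) e := by
      have h1 := hmono e he
      rw [inner_sub_left] at h1
      have h2 : -(inner ℝ (G 0) e) ≤ r * P / 16 * ‖e‖ := by
        have := abs_real_inner_le_norm (G 0) e
        have h3 : ‖G 0‖ * ‖e‖ ≤ r * P / 16 * ‖e‖ := by gcongr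
        linarith [neg_abs_le (inner ℝ (G 0) e : ℝ)]
      have h3 : r * P / 16 * ‖e‖ ≤ min 1 ‖e‖ * P / 16 * ‖e‖ := by gcongr
      have h4 : ‖e‖ * (‖e‖ / D) * (P / 16) ≤ ‖e‖ * min 1 ‖e‖ * (P / 16) := by gcongr
      linarith
    have hG4 : ‖G e‖ ^ 2 ≤ 16 * ‖e‖ ^ 2 := by
      have : ‖G e‖ ≤ 4 * ‖e‖ := by linarith
      calc ‖G e‖ ^ 2 ≤ (4 * ‖e‖) ^ 2 := by gcongr
        _ = _ := by ring
    rw [norm_sub_sq_real, inner_smul_right, norm_smul, Real.norm_of_nonneg hs0.le,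
      real_inner_comm, mul_pow]
    have h5 : ‖e‖ * (‖e‖ / D) * (α / 16 / 16) ≤ ‖e‖ * (‖e‖ / D) * (P / 16) := by gcongr
    have h6 : s * (‖e‖ * (‖e‖ / D) * (α / 16 / 16)) ≤ s * inner ℝ (G e) e := by
      gcongr; exact h5.trans hin
    have h7 : s ^ 2 * ‖G e‖ ^ 2 ≤ s ^ 2 * (16 * ‖e‖ ^ 2) := by gcongr
    have h8 : s * (‖e‖ * (‖e‖ / D) * (α / 16 / 16)) = α ^ 2 / (2 ^ 20 * D ^ 2) * ‖e‖ ^ 2 := by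
      rw [hs]; field_simp; norm_num
    have h9 : s ^ 2 * (16 * ‖e‖ ^ 2) = α ^ 2 / (2 ^ 20 * D ^ 2) * ‖e‖ ^ 2 := by
      rw [hs]; field_simp; norm_num
    linarith
  · intro hre
    refine (norm_sub_le _ _).trans ?_
    rw [norm_smul, Real.norm_of_nonneg hs0.le]
    have : s * ‖G e‖ ≤ 1 / 4 * (4 * r) := by
      gcongr
      linarith
    linarith

/-- The ball of radius `2 * r` is never left once entered: outside radius `r` the norm does not
grow, and from inside it a step stays below `2 * r`. Before that the squared norm decays
geometrically. Staying within `D` keeps `hmono` applicable. -/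
theorem descent_iterate_norm_le (hlip : ∀ a b, ‖G a - G b‖ ≤ 3 * ‖a - b‖)
    (hmono : ∀ e, ‖e‖ ≤ D → ‖e‖ * min 1 ‖e‖ * (P / 8) ≤ inner ℝ (G e - G 0) e)
    (h0 : ‖G 0‖ ≤ r * P / 16) (hr : 0 < r) (hr1 : 2 * r ≤ 1) (hD : 1 ≤ D) (hα : 0 < α)
    (hα1 : α ≤ 1) (hP : α / 16 ≤ P) (hP1 : P ≤ 1) {e : E} (he : ‖e‖ ≤ D) {t : ℕ}
    (ht : (1 - α ^ 2 / (2 ^ 20 * D ^ 2)) ^ t * D ^ 2 ≤ (2 * r) ^ 2) :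
    ‖(fun e => e - (α / (4096 * D)) • G e)^[t] e‖ ≤ 2 * r := by
  set q := α ^ 2 / (2 ^ 20 * D ^ 2) with hq
  have hq0 : 0 ≤ q := by positivity
  have hq1 : q ≤ 1 := by
    rw [hq, div_le_one (by positivity)]
    nlinarith
  have key : ∀ t : ℕ, ‖(fun e => e - (α / (4096 * D)) • G e)^[t] e‖ ≤ D ∧
      (‖(fun e => e - (α / (4096 * D)) • G e)^[t] e‖ ≤ 2 * r ∨
      ‖(fun e => e - (α / (4096 * D)) • G e)^[t] e‖ ^ 2 ≤ (1 - q) ^ t * D ^ 2) := by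
    intro t
    induction t with
    | zero => exact ⟨he, Or.inr (by simpa using pow_le_pow_left₀ (norm_nonneg _) he 2)⟩
    | succ t ih =>
      rw [Function.iterate_succ_apply']
      set x := (fun e => e - (α / (4096 * D)) • G e)^[t] e
      obtain ⟨hx, hor⟩ := ih
      have hst := descent_step hlip hmono h0 hr (by linarith) hD hα hα1 hP hP1 x hx
      rcases le_total r ‖x‖ with h | h
      · have h1 := hst.1 h
        have h2 : ‖x - (α / (4096 * D)) • G x‖ ≤ ‖x‖ := by
          rw [← pow_le_pow_iff_left₀ (norm_nonneg _) (norm_nonneg _) two_ne_zero]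
          nlinarith [sq_nonneg ‖x‖]
        refine ⟨h2.trans hx, ?_⟩
        rcases hor with h3 | h3
        · exact Or.inl (h2.trans h3)
        · refine Or.inr (h1.trans ?_)
          have h4 : 0 ≤ 1 - q := by linarith
          calc (1 - q) * ‖x‖ ^ 2 ≤ (1 - q) * ((1 - q) ^ t * D ^ 2) := by gcongr
            _ = (1 - q) ^ (t + 1) * D ^ 2 := by ring
      · have h1 := hst.2 h
        exact ⟨h1.trans (by linarith), Or.inl h1⟩
  rcases (key t).2 with h | h
  · exact h
  · exact (pow_le_pow_iff_left₀ (norm_nonneg _) (by linarith) two_ne_zero).1 (h.trans ht)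

end Descent

/-! ### A bounded monotone function on the line -/

/-- `x / (1 + |x|)`. -/
def squash (x : ℝ) : ℝ := x / (1 + |x|)

theorem squash_neg (x : ℝ) : squash (-x) = -squash x := by
  simp [squash, neg_div]

theorem abs_squash_le (x : ℝ) : |squash x| ≤ 1 := by
  have : 0 < 1 + |x| := by positivity
  rw [squash, abs_div, abs_of_pos this, div_le_one this]
  linarith

theorem squash_le_squash {x y : ℝ} (h : x ≤ y) : squash x ≤ squash y := by
  rw [squash, squash, div_le_div_iff₀ (by positivity) (by positivity)]
  rcases abs_cases x with ⟨h1, h1'⟩ | ⟨h1, h1'⟩ <;>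
    rcases abs_cases y with ⟨h2, h2'⟩ | ⟨h2, h2'⟩ <;>
    rw [h1, h2] <;> nlinarith

theorem squash_sub_le {x y : ℝ} (h : x ≤ y) : squash y - squash x ≤ y - x := by
  rw [squash, squash, div_sub_div _ _ (by positivity) (by positivity), div_le_iff₀ (by positivity)]
  have hx := abs_nonneg x
  have hy := abs_nonneg y
  have h3 : (y - x) * 1 ≤ (y - x) * ((1 + |y|) * (1 + |x|) - (|x| * |y|)) := by
    gcongr
    nlinarith
  have h4 : y * |x| - |y| * x ≤ (y - x) * (|x| + |y|) := by
    rcases abs_cases x with ⟨h1, h1'⟩ | ⟨h1, h1'⟩ <;>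
      rcases abs_cases y with ⟨h2, h2'⟩ | ⟨h2, h2'⟩ <;> rw [h1, h2] <;> nlinarith
  have h5 : 0 ≤ (y - x) * (|x| * |y|) := mul_nonneg (by linarith) (by positivity)
  nlinarith

theorem abs_squash_sub_le (x y : ℝ) : |squash x - squash y| ≤ |x - y| := by
  rcases le_total x y with h | h
  · rw [abs_sub_comm, abs_sub_comm x, abs_of_nonneg (sub_nonneg.2 (squash_le_squash h)),
      abs_of_nonneg (sub_nonneg.2 h)]
    exact squash_sub_le h
  · rw [abs_of_nonneg (sub_nonneg.2 (squash_le_squash h)), abs_of_nonneg (sub_nonneg.2 h)]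
    exact squash_sub_le h

theorem continuous_squash : Continuous squash :=
  continuous_id.div (by fun_prop) fun x => by positivity

-- By monotonicity of `squash` every sample moves the mean the same way, so arbitrary outliers
-- cannot cancel the shift produced by the samples near `0`.
open Classical in
theorem lt_one_of_squash_mean_le {N : ℕ} (hN : 0 < N) {z : Fin N → ℝ} {e α : ℝ} (hα : 0 < α)
    (hgood : α / 2 ≤ (N : ℝ)⁻¹ * ∑ i, if |z i| ≤ 1 / 64 then (1 : ℝ) else 0)
    (h : (N : ℝ)⁻¹ * ∑ i, squash (z i) - (N : ℝ)⁻¹ * ∑ i, squash (z i - e) ≤ 9 * α / 64) :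
    e < 1 := by
  by_contra he
  push Not at he
  have hN' : (0 : ℝ) < N := by exact_mod_cast hN
  have h1 : ∀ i, (12 / 25 : ℝ) * (if |z i| ≤ 1 / 64 then (1 : ℝ) else 0) ≤
      squash (z i) - squash (z i - e) := by
    intro i
    split_ifs with hi
    · have := abs_le.1 hi
      have h2 : squash (-(1 / 64)) ≤ squash (z i) := squash_le_squash this.1
      have h3 : squash (z i - e) ≤ squash (-(63 / 64)) := squash_le_squash (by linarith)
      -- For `|z i| ≤ 1/64` and `e ≥ 1` the drop is at least `63/127 - 1/65 > 12/25`.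
      have e2 : squash (-(1 / 64)) = -(1 / 65) := by
        rw [squash_neg, squash, abs_of_nonneg] <;> norm_num
      have e3 : squash (-(63 / 64)) = -(63 / 127) := by
        rw [squash_neg, squash, abs_of_nonneg] <;> norm_num
      rw [e2] at h2
      rw [e3] at h3
      norm_num at *
      linarith
    · have : squash (z i - e) ≤ squash (z i) := squash_le_squash (by linarith)
      linarith
  have h2 : (12 / 25 : ℝ) * ((N : ℝ)⁻¹ * ∑ i, if |z i| ≤ 1 / 64 then (1 : ℝ) else 0) ≤
      (N : ℝ)⁻¹ * ∑ i, squash (z i) - (N : ℝ)⁻¹ * ∑ i, squash (z i - e) := by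
    rw [← mul_sub, ← Finset.sum_sub_distrib, mul_left_comm, Finset.mul_sum]
    gcongr with i _
    exact h1 i
  -- `(12/25) (α/2) = 6α/25` exceeds `9α/64`.
  nlinarith

open Classical in
theorem abs_lt_one_of_squash_mean_le {N : ℕ} (hN : 0 < N) {z : Fin N → ℝ} {e α : ℝ} (hα : 0 < α)
    (hgood : α / 2 ≤ (N : ℝ)⁻¹ * ∑ i, if |z i| ≤ 1 / 64 then (1 : ℝ) else 0)
    (h : |(N : ℝ)⁻¹ * ∑ i, squash (z i) - (N : ℝ)⁻¹ * ∑ i, squash (z i - e)| ≤ 9 * α / 64) :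
    |e| < 1 := by
  obtain ⟨h1, h2⟩ := abs_le.1 h
  refine abs_lt.2 ⟨?_, lt_one_of_squash_mean_le hN hα hgood h2⟩
  have h3 := lt_one_of_squash_mean_le hN (z := fun i => -z i) (e := -e) hα (by simpa using hgood)
    (by
      simp only [sub_neg_eq_add, squash_neg, Finset.sum_neg_distrib]
      have e1 : ∀ i, squash (-z i + e) = -squash (z i - e) := fun i => by
        rw [← squash_neg]; congr 1; ring
      simp only [e1, Finset.sum_neg_distrib]
      linarith)
  linarith

/-! ### The location estimator -/

/-- Parameters of the location estimator: sample size, number of nodes of the field, number of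
descent steps, scales of the fine and the rough field, step size, and the threshold of the rough
test. -/
structure EstParams where
  N : ℕ
  M : ℕ
  steps : ℕ
  fineScale : ℝ
  roughScale : ℝ
  stepSize : ℝ
  thr : ℝ

namespace EstParams

variable (q : EstParams) {d : ℕ}

/-- Difference of the coordinatewise squashed means of the samples `X` around `g` and of the
samples `Y` around `u`. -/
def roughGap (X Y : Fin q.N → Vec d) (g u : Vec d) (k : Fin d) : ℝ :=
  (q.N : ℝ)⁻¹ * ∑ i, squash (q.roughScale * (X i k - g k)) -
    (q.N : ℝ)⁻¹ * ∑ i, squash (q.roughScale * (Y i k - u k))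

open Classical in
/-- The number of coordinates in which `u` fails the rough test. -/
def failCount (X Y : Fin q.N → Vec d) (g u : Vec d) : ℝ :=
  ∑ k, if |q.roughGap X Y g u k| ≤ q.thr then (0 : ℝ) else 1

open Classical in
/-- The last of the samples `Y` that passes the rough test. -/
def startPoint (X Y : Fin q.N → Vec d) (g : Vec d) : Vec d :=
  (List.finRange q.N).foldl (fun u i => if q.failCount X Y g (Y i) ≤ 0 then Y i else u) 0

/-- Difference of the means of `avgField` over the samples `X` around `g` and over the samples
`Y` around `u`. -/
def fineGap (X Y : Fin q.N → Vec d) (g u : Vec d) : Vec d :=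
  (q.N : ℝ)⁻¹ • ∑ i, avgField q.M (q.fineScale • (X i - g)) -
    (q.N : ℝ)⁻¹ • ∑ i, avgField q.M (q.fineScale • (Y i - u))

/-- One step of descent along `fineGap`. -/
def descent (X Y : Fin q.N → Vec d) (g u : Vec d) : Vec d :=
  u - (q.stepSize / q.fineScale) • q.fineGap X Y g u

/-- The estimate of `c` from samples `Y` that are distributed around `c` about as the samples `X`
are around `g`. -/
def estimate (X Y : Fin q.N → Vec d) (g : Vec d) : Vec d :=
  (q.descent X Y g)^[q.steps] (q.startPoint X Y g)

theorem failCount_nonpos_iff (X Y : Fin q.N → Vec d) (g u : Vec d) :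
    q.failCount X Y g u ≤ 0 ↔ ∀ k, |q.roughGap X Y g u k| ≤ q.thr := by
  classical
  have h0 : ∀ k ∈ (Finset.univ : Finset (Fin d)),
      (0 : ℝ) ≤ if |q.roughGap X Y g u k| ≤ q.thr then (0 : ℝ) else 1 := fun k _ => by
    split_ifs <;> norm_num
  constructor
  · intro h k
    by_contra hk
    have h1 := (Finset.sum_eq_zero_iff_of_nonneg h0).1
      (le_antisymm h (Finset.sum_nonneg h0)) k (Finset.mem_univ k)
    simp [hk] at h1
  · intro h
    refine (Finset.sum_nonpos fun k _ => ?_)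
    simp [h k]

/-- The invariant is the disjunction `h`: an element satisfying `P` is still to come, or the current
value already stems from one. -/
theorem foldl_select {β γ : Type*} (P : β → Prop) [DecidablePred P] (y : β → γ) (L : List β)
    (u : γ) (h : (∃ b ∈ L, P b) ∨ ∃ b, P b ∧ u = y b) :
    ∃ b, P b ∧ L.foldl (fun u b => if P b then y b else u) u = y b := by
  induction L generalizing u with
  | nil => simpa using h
  | cons b L ih =>
    rw [List.foldl_cons]
    apply ih
    by_cases hb : P b
    · exact Or.inr ⟨b, hb, by simp [hb]⟩
    · rcases h with ⟨b', hb', hP⟩ | h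
      · rcases List.mem_cons.1 hb' with rfl | hL
        · exact absurd hP hb
        · exact Or.inl ⟨b', hL, hP⟩
      · exact Or.inr (by simpa [hb] using h)

/-- What the accuracy of the estimator needs from its samples. -/
structure GoodSamples (X Y : Fin q.N → Vec d) (g c : Vec d) (α R r : ℝ) : Prop where
  fine : ‖q.fineGap X Y g c‖ ≤
    r * ((q.N : ℝ)⁻¹ * ∑ i, 1 / (1 + ‖q.fineScale • (Y i - c)‖ ^ 2)) / 16
  weight : α / 16 ≤ (q.N : ℝ)⁻¹ * ∑ i, 1 / (1 + ‖q.fineScale • (Y i - c)‖ ^ 2)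
  rough : ∀ k, |q.roughGap X Y g c k| ≤ α / 16
  near : α / 2 ≤ (q.N : ℝ)⁻¹ * ∑ i, (Metric.closedBall c R).indicator (fun _ => (1 : ℝ)) (Y i)

variable {q} {X Y : Fin q.N → Vec d} {g c : Vec d} {α R r D : ℝ}

theorem abs_roughGap_sub_le (hN : 0 < q.N) (hs : 0 < q.roughScale) (u : Vec d) (k : Fin d) :
    |q.roughGap X Y g u k - q.roughGap X Y g c k| ≤ q.roughScale * ‖u - c‖ := by
  have hN' : (0 : ℝ) < q.N := by exact_mod_cast hN
  have e : q.roughGap X Y g u k - q.roughGap X Y g c k =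
      (q.N : ℝ)⁻¹ * ∑ i, (squash (q.roughScale * (Y i k - c k)) -
        squash (q.roughScale * (Y i k - u k))) := by
    rw [roughGap, roughGap, Finset.sum_sub_distrib]; ring
  rw [e, abs_mul, abs_of_pos (by positivity : (0 : ℝ) < (q.N : ℝ)⁻¹), inv_mul_le_iff₀ hN']
  refine (Finset.abs_sum_le_sum_abs _ _).trans ?_
  calc _ ≤ ∑ _i : Fin q.N, q.roughScale * ‖u - c‖ := by
        refine Finset.sum_le_sum fun i _ => (abs_squash_sub_le _ _).trans ?_
        rw [← mul_sub, abs_mul, abs_of_pos hs]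
        gcongr
        have h := PiLp.norm_apply_le (u - c) k
        rw [PiLp.sub_apply, Real.norm_eq_abs] at h
        refine le_trans (le_of_eq ?_) h
        congr 1; ring
    _ = _ := by simp

/-- A sample within `R` of `c` passes the test, its gap being at most `α/16 + α/64`. Conversely, a
passing point differs from `c` in its squashed mean by at most `5α/64 + 4α/64`, so it is within one
scaled unit of `c` in every coordinate. Summation over the coordinates gives `√d`. -/
theorem GoodSamples.norm_startPoint_sub_le (h : q.GoodSamples X Y g c α R r) (hN : 0 < q.N)
    (hα : 0 < α) (hs : 0 < q.roughScale) (hsR : q.roughScale * R ≤ α / 64) (hα1 : α ≤ 1)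
    (hthr : q.thr = 5 * α / 64) :
    q.roughScale * ‖q.startPoint X Y g - c‖ ≤ √d := by
  classical
  have hN' : (0 : ℝ) < q.N := by exact_mod_cast hN
  have hex : ∃ i, Y i ∈ Metric.closedBall c R := by
    by_contra hno
    push Not at hno
    have h1 := h.near
    simp only [Set.indicator_of_notMem (hno _), Finset.sum_const_zero, mul_zero] at h1
    linarith
  obtain ⟨i₀, hi₀⟩ := hex
  have hpass : q.failCount X Y g (Y i₀) ≤ 0 := by
    rw [failCount_nonpos_iff]
    intro k
    have h1 := abs_roughGap_sub_le (X := X) (Y := Y) (g := g) (c := c) hN hs (Y i₀) k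
    have h2 := h.rough k
    have h3 : q.roughScale * ‖Y i₀ - c‖ ≤ α / 64 := by
      refine le_trans ?_ hsR
      gcongr
      exact mem_closedBall_iff_norm.1 hi₀
    rw [hthr]
    have := abs_sub_abs_le_abs_sub (q.roughGap X Y g (Y i₀) k) (q.roughGap X Y g c k)
    linarith
  obtain ⟨b, hb, hst⟩ := foldl_select (fun i => q.failCount X Y g (Y i) ≤ 0) Y
    (List.finRange q.N) 0 (Or.inl ⟨i₀, List.mem_finRange i₀, hpass⟩)
  have hst' : q.startPoint X Y g = Y b := by
    rw [startPoint]; convert hst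
  rw [hst']
  rw [failCount_nonpos_iff] at hb
  have hcoord : ∀ k, |q.roughScale * ((Y b) k - c k)| < 1 := by
    intro k
    refine abs_lt_one_of_squash_mean_le hN (z := fun i => q.roughScale * (Y i k - c k)) hα ?_ ?_
    · refine h.near.trans ?_
      gcongr with i _
      by_cases hi : Y i ∈ Metric.closedBall c R
      · rw [Set.indicator_of_mem hi, if_pos]
        rw [abs_mul, abs_of_pos hs]
        have h1 := PiLp.norm_apply_le (Y i - c) k
        rw [PiLp.sub_apply, Real.norm_eq_abs] at h1
        have h2 := mem_closedBall_iff_norm.1 hi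
        have h3 : q.roughScale * |Y i k - c k| ≤ q.roughScale * R := by
          gcongr; exact h1.trans h2
        linarith
      · rw [Set.indicator_of_notMem hi]
        split_ifs <;> norm_num
    · have h1 := hb k
      have h2 := h.rough k
      rw [hthr] at h1
      have e1 : ∀ i, q.roughScale * (Y i k - c k) - q.roughScale * ((Y b) k - c k) =
          q.roughScale * (Y i k - (Y b) k) := fun i => by ring
      simp only [e1]
      rw [roughGap] at h1 h2
      rw [abs_le] at h1 h2 ⊢
      constructor <;> linarith [h1.1, h1.2, h2.1, h2.2]
  rw [← Real.norm_of_nonneg hs.le, ← norm_smul, EuclideanSpace.norm_eq]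
  apply Real.sqrt_le_sqrt
  calc _ ≤ ∑ _k : Fin d, (1 : ℝ) := by
        refine Finset.sum_le_sum fun k _ => ?_
        have h1 := hcoord k
        rw [PiLp.smul_apply, PiLp.sub_apply, smul_eq_mul, Real.norm_eq_abs]
        nlinarith [abs_nonneg (q.roughScale * ((Y b) k - c k))]
    _ = d := by simp

theorem fineGap_lipschitz (hN : 0 < q.N) (hs : 0 < q.fineScale) (a b : Vec d) :
    ‖q.fineGap X Y g (c + q.fineScale⁻¹ • a) - q.fineGap X Y g (c + q.fineScale⁻¹ • b)‖ ≤
      3 * ‖a - b‖ := by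
  have hN' : (0 : ℝ) < q.N := by exact_mod_cast hN
  rw [fineGap, fineGap, sub_sub_sub_cancel_left, ← smul_sub, ← Finset.sum_sub_distrib, norm_smul,
    norm_inv, Real.norm_natCast, inv_mul_le_iff₀ hN']
  refine (norm_sum_le _ _).trans ?_
  calc _ ≤ ∑ _i : Fin q.N, 3 * ‖a - b‖ := by
        refine Finset.sum_le_sum fun i _ => (norm_avgField_sub_le _ _ _).trans (le_of_eq ?_)
        congr 2
        simp only [smul_sub, smul_add, smul_inv_smul₀ hs.ne']
        abel
    _ = _ := by simp

theorem inner_fineGap_sub_ge (hN : 0 < q.N) (hM : 0 < q.M) (hs : 0 < q.fineScale) (hD : 1 ≤ D)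
    {P : ℝ} (hP : P = (q.N : ℝ)⁻¹ * ∑ i, 1 / (1 + ‖q.fineScale • (Y i - c)‖ ^ 2))
    (hMD : 3 * D / q.M ≤ P / 8) (e : Vec d) (he : ‖e‖ ≤ D) :
    ‖e‖ * min 1 ‖e‖ * (P / 8) ≤
      inner ℝ (q.fineGap X Y g (c + q.fineScale⁻¹ • e) -
        q.fineGap X Y g (c + q.fineScale⁻¹ • (0 : Vec d))) e := by
  have hN' : (0 : ℝ) < q.N := by exact_mod_cast hN
  have e1 : ∀ i, q.fineScale • (Y i - (c + q.fineScale⁻¹ • e)) =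
      q.fineScale • (Y i - c) - e := fun i => by
    simp only [smul_sub, smul_add, smul_inv_smul₀ hs.ne']; abel
  rw [fineGap, fineGap, sub_sub_sub_cancel_left, ← smul_sub, ← Finset.sum_sub_distrib,
    inner_smul_left, sum_inner, smul_zero, add_zero]
  simp only [e1, conj_trivial]
  calc ‖e‖ * min 1 ‖e‖ * (P / 8) ≤ ‖e‖ * min 1 ‖e‖ * (P / 4 - 3 * D / q.M) := by
        gcongr; linarith
    _ = (q.N : ℝ)⁻¹ * ∑ i, ‖e‖ * min 1 ‖e‖ *
        (1 / (1 + ‖q.fineScale • (Y i - c)‖ ^ 2) / 4 - 3 * D / q.M) := by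
        rw [← Finset.mul_sum, Finset.sum_sub_distrib, ← Finset.sum_div, hP]
        simp
        field_simp
    _ ≤ _ := by
        gcongr with i _
        exact inner_avgField_gap_ge hM hD _ e he

/-- In the coordinate `e = fineScale • (u - c)` the iteration is the descent studied above, with
modulus `P` the empirical mean weight. The condition on `M` makes the monotonicity defect `3 D / M`
at most `α/128 ≤ P/8`. -/
theorem GoodSamples.norm_estimate_sub_le (h : q.GoodSamples X Y g c α R r) (hN : 0 < q.N)
    (hM : 0 < q.M) (hα : 0 < α) (hα1 : α ≤ 1) (hs : 0 < q.roughScale)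
    (hsR : q.roughScale * R ≤ α / 64) (hthr : q.thr = 5 * α / 64) (hf : 0 < q.fineScale)
    (hD : 1 ≤ D) (hstart : q.fineScale * √d ≤ D * q.roughScale)
    (hstep : q.stepSize = α / (4096 * D)) (hMD : 384 * D ≤ α * q.M) (hr : 0 < r)
    (hr1 : 2 * r ≤ 1)
    (hsteps : (1 - α ^ 2 / (2 ^ 20 * D ^ 2)) ^ q.steps * D ^ 2 ≤ (2 * r) ^ 2) :
    ‖q.estimate X Y g - c‖ ≤ 2 * r / q.fineScale := by
  have hN' : (0 : ℝ) < q.N := by exact_mod_cast hN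
  have hM' : (0 : ℝ) < q.M := by exact_mod_cast hM
  set P := (q.N : ℝ)⁻¹ * ∑ i, 1 / (1 + ‖q.fineScale • (Y i - c)‖ ^ 2) with hP
  have hP1 : P ≤ 1 := by
    rw [hP, inv_mul_le_iff₀ hN', mul_one]
    calc _ ≤ ∑ _i : Fin q.N, (1 : ℝ) := by
          refine Finset.sum_le_sum fun i _ => ?_
          rw [div_le_one (by positivity)]
          nlinarith [sq_nonneg ‖q.fineScale • (Y i - c)‖]
      _ = _ := by simp
  set G : Vec d → Vec d := fun e => q.fineGap X Y g (c + q.fineScale⁻¹ • e) with hG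
  have hmono : ∀ e, ‖e‖ ≤ D → ‖e‖ * min 1 ‖e‖ * (P / 8) ≤ inner ℝ (G e - G 0) e := fun e he =>
    inner_fineGap_sub_ge hN hM hf hD hP (by
      rw [div_le_iff₀ hM']
      have := h.weight
      nlinarith) e he
  have h0 : ‖G 0‖ ≤ r * P / 16 := by
    simp only [hG, smul_zero, add_zero]
    exact h.fine
  have hsc : Function.Semiconj (fun u : Vec d => q.fineScale • (u - c)) (q.descent X Y g)
      (fun e => e - (α / (4096 * D)) • G e) := by
    intro u
    simp only [hG, descent, inv_smul_smul₀ hf.ne', add_sub_cancel, ← hstep]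
    rw [div_eq_mul_inv, mul_comm, mul_smul, smul_sub, smul_sub, smul_inv_smul₀ hf.ne', smul_sub]
    abel
  have hst : ‖q.fineScale • (q.startPoint X Y g - c)‖ ≤ D := by
    rw [norm_smul, Real.norm_of_nonneg hf.le]
    have h1 := h.norm_startPoint_sub_le hN hα hs hsR hα1 hthr
    refine le_of_mul_le_mul_right ?_ hs
    calc q.fineScale * ‖q.startPoint X Y g - c‖ * q.roughScale =
          q.fineScale * (q.roughScale * ‖q.startPoint X Y g - c‖) := by ring
      _ ≤ q.fineScale * √d := by gcongr
      _ ≤ _ := hstart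
  have key := descent_iterate_norm_le (fun a b => fineGap_lipschitz hN hf a b) hmono h0 hr hr1 hD
    hα hα1 h.weight hP1 hst hsteps
  rw [show (fun e => e - (α / (4096 * D)) • G e)^[q.steps]
      (q.fineScale • (q.startPoint X Y g - c)) = q.fineScale • (q.estimate X Y g - c) from
      ((hsc.iterate_right q.steps) _).symm, norm_smul, Real.norm_of_nonneg hf.le] at key
  rw [le_div_iff₀ hf, mul_comm]
  exact key

end EstParams

/-! ### The estimator is computed by a call-free block -/

section

variable {I : Interface} {ι : Type}

open Classical in
theorem ComputesReal.abs {t : ℕ} {φ : (ι → ℝ) → ℝ} (h : ComputesReal I t φ) :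
    ComputesReal I (3 * t + 6) (fun e => |φ e|) := by
  have h1 := ComputesReal.ite (.const 0) h h ((ComputesReal.const 0).sub h)
  have e : (fun e => |φ e|) = fun e => if (0 : ℝ) ≤ φ e then φ e else 0 - φ e := by
    funext e
    split_ifs with hs
    · exact abs_of_nonneg hs
    · rw [abs_of_neg (not_le.1 hs), zero_sub]
  rw [e]
  exact h1.mono (by omega)

theorem ComputesReal.squash {t : ℕ} {φ : (ι → ℝ) → ℝ} (h : ComputesReal I t φ) :
    ComputesReal I (4 * t + 9) (fun e => squash (φ e)) :=
  (h.div ((ComputesReal.const 1).add h.abs)).mono (by omega)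

theorem invField_apply {d : ℕ} (y : ℝ) (x : Vec d) (k : Fin d) :
    invField y x k = x k / (1 + y * y * ∑ l, x l * x l) := by
  rw [invField, PiLp.smul_apply, smul_eq_mul, EuclideanSpace.norm_eq, Real.sq_sqrt (by positivity),
    inv_mul_eq_div]
  simp [pow_two]

theorem ComputesReal.invField {d t : ℕ} {Φ : (ι → ℝ) → Vec d}
    (h : ∀ k, ComputesReal I t (fun e => Φ e k)) (y : ℝ) (k : Fin d) :
    ComputesReal I (t + (d * (2 * t + 2) + 1) + 8) (fun e => invField y (Φ e) k) := by
  simp only [invField_apply]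
  exact ((h k).div ((ComputesReal.const 1).add (((ComputesReal.const y).mul (.const y)).mul
    (ComputesReal.sum fun l => (h l).mul (h l))))).mono (by
      have : t + t + 1 + 1 = 2 * t + 2 := by ring
      rw [this]; omega)

theorem ComputesReal.avgField {d t : ℕ} {Φ : (ι → ℝ) → Vec d}
    (h : ∀ k, ComputesReal I t (fun e => Φ e k)) (M : ℕ) (k : Fin d) :
    ComputesReal I (M * (t + (d * (2 * t + 2) + 1) + 9) + 3)
      (fun e => avgField M (Φ e) k) := by
  have e : (fun e => _root_.avgField M (Φ e) k) =
      fun e => (M : ℝ)⁻¹ * ∑ j : Fin M, _root_.invField (node M j) (Φ e) k := by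
    funext e
    rw [_root_.avgField, PiLp.smul_apply, smul_eq_mul, WithLp.ofLp_sum, Finset.sum_apply]
  rw [e]
  exact ((ComputesReal.const _).mul (ComputesReal.sum fun j =>
    ComputesReal.invField h (node M j) k)).mono (by
      rw [show t + (d * (2 * t + 2) + 1) + 8 + 1 = t + (d * (2 * t + 2) + 1) + 9 by ring]; omega)

namespace EstParams

variable (q : EstParams) (d : ℕ)

/-- The arguments of the estimator: the samples `X` and `Y`, and the center `g`. -/
abbrev Arg : Type := (Fin q.N × Fin d) ⊕ (Fin q.N × Fin d) ⊕ Fin d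

variable {q d}

/-- The samples `X` in an argument. -/
def argX (e : q.Arg d → ℝ) (i : Fin q.N) : Vec d := WithLp.toLp 2 fun k => e (.inl (i, k))

/-- The samples `Y` in an argument. -/
def argY (e : q.Arg d → ℝ) (i : Fin q.N) : Vec d := WithLp.toLp 2 fun k => e (.inr (.inl (i, k)))

/-- The center `g` in an argument. -/
def argG (e : q.Arg d → ℝ) : Vec d := WithLp.toLp 2 fun k => e (.inr (.inr k))

variable (q d)

/-- Cost of `avgField` at a scaled difference of two points. -/
def fieldCost : ℕ := q.M * (3 + (d * (2 * 3 + 2) + 1) + 9) + 3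

/-- Cost of a coordinate of the rough gap. -/
def roughCost : ℕ := 2 * (q.N * (4 * 3 + 10) + 3) + 1

/-- Cost of a coordinate of one selection step. -/
def selectCost : ℕ := d * (3 * roughCost q + 13) + 5

/-- Cost of a coordinate of one descent step. -/
def descentCost : ℕ := 2 * (q.N * (fieldCost q d + 1) + 3) + 4

/-- Cost of the estimator. -/
def cost : ℕ := d * 1 + q.N * (d * selectCost q d) + q.steps * (d * descentCost q d)

variable {q d} {κ : Type} {s t : ℕ}

theorem computesReal_roughGap {X Y : (κ → ℝ) → Fin q.N → Vec d} {g u : (κ → ℝ) → Vec d}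
    (hX : ∀ i k, ComputesReal I 0 fun e => X e i k) (hY : ∀ i k, ComputesReal I 0 fun e => Y e i k)
    (hg : ∀ k, ComputesReal I 0 fun e => g e k) (hu : ∀ k, ComputesReal I 0 fun e => u e k)
    (k : Fin d) :
    ComputesReal I (roughCost q) fun e => q.roughGap (X e) (Y e) (g e) (u e) k := by
  have h1 := (ComputesReal.const (I := I) (ι := κ) (q.N : ℝ)⁻¹).mul (ComputesReal.sum
    fun i => ((ComputesReal.const q.roughScale).mul ((hX i k).sub (hg k))).squash)
  have h2 := (ComputesReal.const (I := I) (ι := κ) (q.N : ℝ)⁻¹).mul (ComputesReal.sum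
    fun i => ((ComputesReal.const q.roughScale).mul ((hY i k).sub (hu k))).squash)
  exact (h1.sub h2).mono (by unfold roughCost; omega)

open Classical in
theorem computesReal_failCount {X Y : (κ → ℝ) → Fin q.N → Vec d} {g u : (κ → ℝ) → Vec d}
    (hX : ∀ i k, ComputesReal I 0 fun e => X e i k) (hY : ∀ i k, ComputesReal I 0 fun e => Y e i k)
    (hg : ∀ k, ComputesReal I 0 fun e => g e k) (hu : ∀ k, ComputesReal I 0 fun e => u e k) :
    ComputesReal I (d * (3 * roughCost q + 13) + 1)
      fun e => q.failCount (X e) (Y e) (g e) (u e) :=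
  ComputesReal.sum fun k => ((computesReal_roughGap hX hY hg hu k).abs.ite (.const q.thr)
    (.const 0) (.const 1)).mono (by omega)

open Classical in
theorem computesReal_select {X Y : (κ → ℝ) → Fin q.N → Vec d} {g u : (κ → ℝ) → Vec d}
    (hX : ∀ i k, ComputesReal I 0 fun e => X e i k) (hY : ∀ i k, ComputesReal I 0 fun e => Y e i k)
    (hg : ∀ k, ComputesReal I 0 fun e => g e k) (hu : ∀ k, ComputesReal I 0 fun e => u e k)
    (i : Fin q.N) (k : Fin d) :
    ComputesReal I (selectCost q d)
      fun e => if q.failCount (X e) (Y e) (g e) (Y e i) ≤ 0 then Y e i k else u e k :=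
  ((computesReal_failCount hX hY hg (hY i)).ite (.const 0) (hY i k) (hu k)).mono
    (by unfold selectCost; omega)

theorem computesReal_descent {X Y : (κ → ℝ) → Fin q.N → Vec d} {g u : (κ → ℝ) → Vec d}
    (hX : ∀ i k, ComputesReal I 0 fun e => X e i k) (hY : ∀ i k, ComputesReal I 0 fun e => Y e i k)
    (hg : ∀ k, ComputesReal I 0 fun e => g e k) (hu : ∀ k, ComputesReal I 0 fun e => u e k)
    (k : Fin d) :
    ComputesReal I (descentCost q d) fun e => q.descent (X e) (Y e) (g e) (u e) k := by
  have hf : ∀ (a b : (κ → ℝ) → Vec d), (∀ k, ComputesReal I 0 fun e => a e k) →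
      (∀ k, ComputesReal I 0 fun e => b e k) → ComputesReal I (fieldCost q d)
        fun e => _root_.avgField q.M (q.fineScale • (a e - b e)) k := fun a b ha hb =>
    ComputesReal.avgField (Φ := fun e => q.fineScale • (a e - b e))
      (fun k => (ComputesReal.const _).mul ((ha k).sub (hb k))) q.M k
  have h1 := (ComputesReal.const (I := I) (ι := κ) (q.N : ℝ)⁻¹).mul (ComputesReal.sum
    fun i => hf (fun e => X e i) g (hX i) hg)
  have h2 := (ComputesReal.const (I := I) (ι := κ) (q.N : ℝ)⁻¹).mul (ComputesReal.sum
    fun i => hf (fun e => Y e i) u (hY i) hu)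
  have h3 := (hu k).sub ((ComputesReal.const (q.stepSize / q.fineScale)).mul (h1.sub h2))
  have e : (fun e => q.descent (X e) (Y e) (g e) (u e) k) = fun e => u e k -
      q.stepSize / q.fineScale * ((q.N : ℝ)⁻¹ * (∑ i, _root_.avgField q.M
        (q.fineScale • (X e i - g e)) k) - (q.N : ℝ)⁻¹ * ∑ i, _root_.avgField q.M
        (q.fineScale • (Y e i - u e)) k) := by
    funext e
    simp only [descent, fineGap, PiLp.sub_apply, PiLp.smul_apply, smul_eq_mul, WithLp.ofLp_sum,
      Finset.sum_apply]
  rw [e]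
  exact h3.mono (by unfold descentCost; omega)

theorem foldl_ofLp {β : Type*} (f : Vec d → β → Vec d) (L : List β) (u : Vec d) :
    (L.foldl f u).ofLp = L.foldl (fun v b => (f (WithLp.toLp 2 v) b).ofLp) u.ofLp := by
  induction L generalizing u with
  | nil => rfl
  | cons b L ih => rw [List.foldl_cons, List.foldl_cons, ih]

theorem foldl_range_eq_iterate {β : Type*} (f : β → β) (n : ℕ) (u : β) :
    (List.range n).foldl (fun v _ => f v) u = f^[n] u := by
  induction n with
  | zero => rfl
  | succ n ih => rw [List.range_succ, List.foldl_append, ih, Function.iterate_succ_apply']; rfl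

theorem computes_estimate :
    Computes I (cost q d) fun e : q.Arg d → ℝ => (q.estimate (argX e) (argY e) (argG e)).ofLp := by
  classical
  have h0 : Computes I (d * 1) fun _ : q.Arg d → ℝ => (0 : Vec d).ofLp :=
    Computes.of_coords fun k => by simpa using ComputesReal.const 0
  have h1 := h0.foldl (Ψ := fun i e u =>
      (if q.failCount (argX e) (argY e) (argG e) (argY e i) ≤ 0 then argY e i
        else WithLp.toLp 2 u : Vec d).ofLp) (t := selectCost q d) (fun i k => by
    have := computesReal_select (I := I) (q := q) (d := d) (κ := q.Arg d ⊕ Fin d)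
      (X := fun e => argX fun i => e (.inl i)) (Y := fun e => argY fun i => e (.inl i))
      (g := fun e => argG fun i => e (.inl i)) (u := fun e => WithLp.toLp 2 fun k => e (.inr k))
      (fun i k => .arg _) (fun i k => .arg _) (fun k => .arg _) (fun k => .arg _) i k
    refine (congrArg (ComputesReal I (selectCost q d)) ?_).mp this
    funext e
    split_ifs <;> rfl) (List.finRange q.N)
  have h2 := h1.foldl (Ψ := fun (_ : ℕ) e u =>
      (q.descent (argX e) (argY e) (argG e) (WithLp.toLp 2 u)).ofLp) (t := descentCost q d)
    (fun _ k => computesReal_descent (I := I) (q := q) (d := d) (κ := q.Arg d ⊕ Fin d)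
      (X := fun e => argX fun i => e (.inl i)) (Y := fun e => argY fun i => e (.inl i))
      (g := fun e => argG fun i => e (.inl i)) (u := fun e => WithLp.toLp 2 fun k => e (.inr k))
      (fun i k => .arg _) (fun i k => .arg _) (fun k => .arg _) (fun k => .arg _) k)
    (List.range q.steps)
  simp only [List.length_finRange, List.length_range] at h2
  refine (congrArg (Computes I (cost q d)) ?_).mp h2
  funext e
  rw [estimate, startPoint, ← foldl_range_eq_iterate, foldl_ofLp, foldl_ofLp]

end EstParams

end

/-! ### The answers of the oblivious-noise oracle -/

section Noise

theorem continuous_avgField {E : Type*} [NormedAddCommGroup E] [InnerProductSpace ℝ E] (M : ℕ) :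
    Continuous (avgField M : E → E) := by
  refine (LipschitzWith.of_dist_le_mul (K := 3) fun p x => ?_).continuous
  rw [dist_eq_norm, dist_eq_norm]
  exact norm_avgField_sub_le M p x

theorem harmonicSum_nonneg (M : ℕ) : 0 ≤ harmonicSum M :=
  Finset.sum_nonneg fun j _ => by positivity

variable {d : ℕ} {Γ : Type*} [MeasurableSpace Γ] {Q : Measure Γ}
  {Z : Γ → Vec d} {σ : ℝ}

theorem memLp_two_of_lintegral_le (hZ : Measurable Z)
    (hv : ∫⁻ γ, ‖Z γ‖ₑ ^ 2 ∂Q ≤ ENNReal.ofReal (σ ^ 2)) : MemLp Z 2 Q := by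
  refine ⟨hZ.aestronglyMeasurable, ?_⟩
  rw [eLpNorm_lt_top_iff_lintegral_rpow_enorm_lt_top two_ne_zero ENNReal.ofNat_ne_top]
  refine lt_of_le_of_lt (le_trans (le_of_eq ?_) hv) ENNReal.ofReal_lt_top
  simp

theorem integrable_norm_sq (hZ : Measurable Z)
    (hv : ∫⁻ γ, ‖Z γ‖ₑ ^ 2 ∂Q ≤ ENNReal.ofReal (σ ^ 2)) :
    Integrable (fun γ => ‖Z γ‖ ^ 2) Q :=
  (memLp_two_of_lintegral_le hZ hv).integrable_norm_pow two_ne_zero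

theorem integral_norm_sq_le (hZ : Measurable Z)
    (hv : ∫⁻ γ, ‖Z γ‖ₑ ^ 2 ∂Q ≤ ENNReal.ofReal (σ ^ 2)) : ∫ γ, ‖Z γ‖ ^ 2 ∂Q ≤ σ ^ 2 := by
  rw [integral_eq_lintegral_of_nonneg_ae (Filter.Eventually.of_forall fun γ => by positivity)
    (hZ.norm.pow_const 2).aestronglyMeasurable]
  refine ENNReal.toReal_le_of_le_ofReal (by positivity) (le_trans (le_of_eq ?_) hv)
  refine lintegral_congr fun γ => ?_
  rw [ENNReal.ofReal_pow (norm_nonneg _), ofReal_norm]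

variable [IsProbabilityMeasure Q]

theorem integrable_of_lintegral_sq_le (hZ : Measurable Z)
    (hv : ∫⁻ γ, ‖Z γ‖ₑ ^ 2 ∂Q ≤ ENNReal.ofReal (σ ^ 2)) : Integrable Z Q :=
  (memLp_two_of_lintegral_le hZ hv).integrable (by norm_num)

theorem integral_norm_le (hσ : 0 < σ) (hZ : Measurable Z)
    (hv : ∫⁻ γ, ‖Z γ‖ₑ ^ 2 ∂Q ≤ ENNReal.ofReal (σ ^ 2)) : ∫ γ, ‖Z γ‖ ∂Q ≤ σ := by
  have h2 := integrable_norm_sq hZ hv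
  -- The pointwise inequality `‖Z‖ ≤ ‖Z‖² / (2σ) + σ/2`, sharp at `‖Z‖ = σ`.
  have h3 : ∫ γ, ‖Z γ‖ ∂Q ≤ ∫ γ, (‖Z γ‖ ^ 2 / (2 * σ) + σ / 2) ∂Q := by
    refine integral_mono (integrable_of_lintegral_sq_le hZ hv).norm
      ((h2.div_const _).add (integrable_const _)) fun γ => ?_
    have : 0 ≤ (‖Z γ‖ - σ) ^ 2 / (2 * σ) := by positivity
    have e : (‖Z γ‖ - σ) ^ 2 / (2 * σ) = ‖Z γ‖ ^ 2 / (2 * σ) + σ / 2 - ‖Z γ‖ := by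
      field_simp; ring
    simp only
    linarith
  rw [integral_add (h2.div_const _) (integrable_const _), integral_div] at h3
  have h4 : (∫ γ, ‖Z γ‖ ^ 2 ∂Q) / (2 * σ) ≤ σ ^ 2 / (2 * σ) := by
    gcongr; exact integral_norm_sq_le hZ hv
  have e : σ ^ 2 / (2 * σ) = σ / 2 := by field_simp
  simp at h3
  linarith

/-- The linear part integrates to zero because `Z` is centred, so the bias is of second order in `s
σ` and inherits the weight of the remainder. -/
theorem norm_integral_avgField_sub_le (hZ : Measurable Z)
    (hv : ∫⁻ γ, ‖Z γ‖ₑ ^ 2 ∂Q ≤ ENNReal.ofReal (σ ^ 2)) (h0 : ∫ γ, Z γ ∂Q = 0) (M : ℕ) (s : ℝ)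
    (v : Vec d) :
    ‖∫ γ, avgField M (s • (v + Z γ)) ∂Q - avgField M (s • v)‖ ≤
      5 * harmonicSum M * (s * σ) ^ 2 / (1 + ‖s • v‖ ^ 2) := by
  obtain ⟨A, hA⟩ := exists_linear_approx_avgField M (s • v)
  have hi := integrable_of_lintegral_sq_le hZ hv
  have hi0 : Integrable (fun γ => s • Z γ) Q := hi.smul s
  have hi' : Integrable (fun γ => A (s • Z γ)) Q := A.integrable_comp hi0
  have hA0 : ∫ γ, A (s • Z γ) ∂Q = 0 := by
    rw [A.integral_comp_comm hi0, integral_smul, h0, smul_zero, map_zero]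
  have hmeas : Measurable fun γ => avgField M (s • (v + Z γ)) :=
    (continuous_avgField M).measurable.comp ((measurable_const.add hZ).const_smul s)
  have hb : Integrable (fun γ => avgField M (s • (v + Z γ))) Q :=
    Integrable.of_bound hmeas.aestronglyMeasurable (harmonicSum M)
      (Filter.Eventually.of_forall fun γ => norm_avgField_le M _)
  have e : ∫ γ, avgField M (s • (v + Z γ)) ∂Q - avgField M (s • v) =
      ∫ γ, (avgField M (s • v + s • Z γ) - avgField M (s • v) - A (s • Z γ)) ∂Q := by
    simp only [smul_add] at hb ⊢
    have hb' : Integrable (fun γ => avgField M (s • v + s • Z γ) - avgField M (s • v)) Q :=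
      hb.sub (integrable_const _)
    rw [integral_sub hb' hi', integral_sub hb (integrable_const _), hA0]
    simp
  rw [e]
  have hH := harmonicSum_nonneg M
  calc _ ≤ ∫ γ, 5 * harmonicSum M * s ^ 2 / (1 + ‖s • v‖ ^ 2) * ‖Z γ‖ ^ 2 ∂Q := by
        refine norm_integral_le_of_norm_le ((integrable_norm_sq hZ hv).const_mul _)
          (Filter.Eventually.of_forall fun γ => (hA (s • Z γ)).trans (le_of_eq ?_))
        rw [norm_smul, mul_pow, Real.norm_eq_abs, sq_abs]
        ring
    _ ≤ 5 * harmonicSum M * s ^ 2 / (1 + ‖s • v‖ ^ 2) * σ ^ 2 := by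
        rw [integral_const_mul]
        gcongr
        exact integral_norm_sq_le hZ hv
    _ = _ := by ring

/-- Pointwise, the weight at `v + Z` is at least `(w / 2) (1 - s² ‖Z‖²)`, which is affine in `‖Z‖²`
and hence controlled by the variance alone. Averaging over the observation noise costs only a
constant factor. -/
theorem integral_weight_ge (hZ : Measurable Z)
    (hv : ∫⁻ γ, ‖Z γ‖ₑ ^ 2 ∂Q ≤ ENNReal.ofReal (σ ^ 2)) {s : ℝ} (hs : (s * σ) ^ 2 ≤ 1 / 2)
    (v : Vec d) :
    1 / (1 + ‖s • v‖ ^ 2) / 4 ≤ ∫ γ, 1 / (1 + ‖s • (v + Z γ)‖ ^ 2) ∂Q := by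
  have hi2 := integrable_norm_sq hZ hv
  set w := 1 / (1 + ‖s • v‖ ^ 2) with hw
  have hw0 : 0 < w := by positivity
  have hmeas : Measurable fun γ => 1 / (1 + ‖s • (v + Z γ)‖ ^ 2) :=
    ((((measurable_const.add hZ).const_smul s).norm.pow_const 2).const_add 1).const_div 1
  have hb : Integrable (fun γ => 1 / (1 + ‖s • (v + Z γ)‖ ^ 2)) Q :=
    Integrable.of_bound hmeas.aestronglyMeasurable 1 (Filter.Eventually.of_forall fun γ => by
      rw [Real.norm_of_nonneg (by positivity), div_le_one (by positivity)]
      nlinarith [sq_nonneg ‖s • (v + Z γ)‖])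
  calc w / 4 ≤ w / 2 * (1 - s ^ 2 * σ ^ 2) := by
        rw [mul_pow] at hs
        nlinarith
    _ ≤ w / 2 * (1 - s ^ 2 * ∫ γ, ‖Z γ‖ ^ 2 ∂Q) := by
        gcongr; exact integral_norm_sq_le hZ hv
    _ = ∫ γ, w / 2 * (1 - s ^ 2 * ‖Z γ‖ ^ 2) ∂Q := by
        rw [integral_const_mul, integral_sub (integrable_const _) (hi2.const_mul _),
          integral_const_mul]
        simp
    _ ≤ _ := by
        refine integral_mono (((integrable_const _).sub (hi2.const_mul _)).const_mul _) hb
          fun γ => ?_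
        simp only
        rw [le_div_iff₀ (by positivity), hw]
        set a := ‖s • v‖
        set c := s ^ 2 * ‖Z γ‖ ^ 2 with hc
        have hc0 : 0 ≤ c := by positivity
        have h1 : ‖s • (v + Z γ)‖ ^ 2 ≤ 2 * a ^ 2 + 2 * c := by
          have h2 : ‖s • (v + Z γ)‖ ≤ a + ‖s • Z γ‖ := by rw [smul_add]; exact norm_add_le _ _
          have h3 : ‖s • Z γ‖ ^ 2 = c := by rw [norm_smul, mul_pow, Real.norm_eq_abs, sq_abs]
          nlinarith [sq_nonneg (a - ‖s • Z γ‖), norm_nonneg (s • (v + Z γ)), norm_nonneg (s • v),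
            norm_nonneg (s • Z γ)]
        rcases le_total c 1 with h4 | h4
        · calc 1 / (1 + a ^ 2) / 2 * (1 - c) * (1 + ‖s • (v + Z γ)‖ ^ 2) ≤
              1 / (1 + a ^ 2) / 2 * (1 - c) * (2 * ((1 + a ^ 2) * (1 + c))) := by
                have : 0 ≤ 1 - c := by linarith
                gcongr
                nlinarith [mul_nonneg (sq_nonneg a) hc0]
            _ = 1 - c ^ 2 := by field_simp; ring
            _ ≤ 1 := by nlinarith [sq_nonneg c]
        · have h5 : 1 / (1 + a ^ 2) / 2 * (1 - c) * (1 + ‖s • (v + Z γ)‖ ^ 2) ≤ 0 := by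
            refine mul_nonpos_of_nonpos_of_nonneg (mul_nonpos_of_nonneg_of_nonpos ?_ ?_) ?_
            · positivity
            · linarith
            · positivity
          linarith

/-- A bias of first order is enough here, since the rough stage only needs constant accuracy at its
own scale. -/
theorem abs_integral_squash_sub_le (hσ : 0 < σ) (hZ : Measurable Z)
    (hv : ∫⁻ γ, ‖Z γ‖ₑ ^ 2 ∂Q ≤ ENNReal.ofReal (σ ^ 2)) {s : ℝ} (hs : 0 ≤ s) (v : Vec d)
    (k : Fin d) :
    ‖∫ γ, squash (s * (v + Z γ) k) ∂Q - squash (s * v k)‖ ≤ s * σ := by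
  have hmeas : Measurable fun γ => squash (s * (v + Z γ) k) :=
    continuous_squash.measurable.comp
      ((((EuclideanSpace.proj (𝕜 := ℝ) k).continuous.measurable.comp
        (measurable_const.add hZ))).const_mul s)
  have hb : Integrable (fun γ => squash (s * (v + Z γ) k)) Q :=
    Integrable.of_bound hmeas.aestronglyMeasurable 1
      (Filter.Eventually.of_forall fun γ => abs_squash_le _)
  have e : ∫ γ, squash (s * (v + Z γ) k) ∂Q - squash (s * v k) =
      ∫ γ, (squash (s * (v + Z γ) k) - squash (s * v k)) ∂Q := by
    rw [integral_sub hb (integrable_const _)]; simp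
  rw [e]
  calc _ ≤ ∫ γ, s * ‖Z γ‖ ∂Q := by
        refine norm_integral_le_of_norm_le
          ((integrable_of_lintegral_sq_le hZ hv).norm.const_mul _)
          (Filter.Eventually.of_forall fun γ => (abs_squash_sub_le _ _).trans ?_)
        rw [← mul_sub, abs_mul, abs_of_nonneg hs, PiLp.add_apply, add_sub_cancel_left]
        gcongr
        exact PiLp.norm_apply_le (Z γ) k
    _ ≤ s * σ := by
        rw [integral_const_mul]
        gcongr
        exact integral_norm_le hσ hZ hv

/-- Chebyshev at distance `2σ`, in the pointwise form `1 - ‖Z‖² / (4σ²)`. -/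
theorem integral_indicator_closedBall_ge (hσ : 0 < σ) (hZ : Measurable Z)
    (hv : ∫⁻ γ, ‖Z γ‖ₑ ^ 2 ∂Q ≤ ENNReal.ofReal (σ ^ 2)) {v : Vec d} {R : ℝ}
    (hR : ‖v‖ + 2 * σ ≤ R) :
    3 / 4 ≤ ∫ γ, (Metric.closedBall (0 : Vec d) R).indicator (fun _ => (1 : ℝ)) (v + Z γ) ∂Q := by
  have hi2 := integrable_norm_sq hZ hv
  have hmeas : Measurable fun γ =>
      (Metric.closedBall (0 : Vec d) R).indicator (fun _ => (1 : ℝ)) (v + Z γ) :=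
    (measurable_const.indicator Metric.isClosed_closedBall.measurableSet).comp
      (measurable_const.add hZ)
  have hb : Integrable (fun γ =>
      (Metric.closedBall (0 : Vec d) R).indicator (fun _ => (1 : ℝ)) (v + Z γ)) Q :=
    Integrable.of_bound hmeas.aestronglyMeasurable 1 (Filter.Eventually.of_forall fun γ =>
      (norm_indicator_le_norm_self _ _).trans (by simp))
  calc (3 / 4 : ℝ) = 1 - σ ^ 2 / (4 * σ ^ 2) := by field_simp; norm_num
    _ ≤ 1 - (∫ γ, ‖Z γ‖ ^ 2 ∂Q) / (4 * σ ^ 2) := by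
        gcongr; exact integral_norm_sq_le hZ hv
    _ = ∫ γ, (1 - ‖Z γ‖ ^ 2 / (4 * σ ^ 2)) ∂Q := by
        rw [integral_sub (integrable_const _) (hi2.div_const _), integral_div]; simp
    _ ≤ _ := by
        refine integral_mono ((integrable_const _).sub (hi2.div_const _)) hb fun γ => ?_
        by_cases h : v + Z γ ∈ Metric.closedBall (0 : Vec d) R
        · simp only [Set.indicator_of_mem h]
          have : 0 ≤ ‖Z γ‖ ^ 2 / (4 * σ ^ 2) := by positivity
          linarith
        · simp only [Set.indicator_of_notMem h]
          rw [mem_closedBall_zero_iff, not_le] at h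
          have h1 := norm_add_le v (Z γ)
          have h2 : 2 * σ ≤ ‖Z γ‖ := by linarith
          have h3 : 1 ≤ ‖Z γ‖ ^ 2 / (4 * σ ^ 2) := by
            rw [one_le_div (by positivity)]
            nlinarith
          linarith

end Noise

/-! ### Expectations of the test functions under the law of an oracle answer. -/

section Oracle

variable {d : ℕ} {Γ : Type*} [MeasurableSpace Γ] {F : Γ → Vec d → ℝ} {Q : Measure Γ}
  {Dξ : Measure (Vec d)} {f : Vec d → ℝ} {α σ : ℝ}

namespace IsObliviousNoiseOracle

theorem measurable_gradient (h : IsObliviousNoiseOracle F Q Dξ f α σ) (x : Vec d) :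
    Measurable fun γ => gradient (F γ) x :=
  h.measurable.comp measurable_prodMk_right

theorem measurable_error (h : IsObliviousNoiseOracle F Q Dξ f α σ) (x : Vec d) :
    Measurable fun γ => gradient (F γ) x - gradient f x :=
  (h.measurable_gradient x).sub_const _

theorem integrable_gradient (h : IsObliviousNoiseOracle F Q Dξ f α σ) (x : Vec d) :
    Integrable (fun γ => gradient (F γ) x) Q := by
  have := h.prob_Q
  have h1 := integrable_of_lintegral_sq_le (h.measurable_error x) (h.variance x)
  exact (h1.add (integrable_const (gradient f x))).congr
    (Filter.Eventually.of_forall fun γ => by simp)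

theorem integral_error (h : IsObliviousNoiseOracle F Q Dξ f α σ) (x : Vec d) :
    ∫ γ, (gradient (F γ) x - gradient f x) ∂Q = 0 := by
  have := h.prob_Q
  rw [integral_sub (h.integrable_gradient x) (integrable_const _), h.mean]
  simp

theorem measurable_answer (h : IsObliviousNoiseOracle F Q Dξ f α σ) (x : Vec d) :
    Measurable fun p : Γ × Vec d => gradient (F p.1) x + p.2 :=
  ((h.measurable_gradient x).comp measurable_fst).add measurable_snd

theorem isProbabilityMeasure_answerLaw (h : IsObliviousNoiseOracle F Q Dξ f α σ) (x : Vec d) :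
    IsProbabilityMeasure (answerLaw F Q Dξ x) := by
  have := h.prob_Q
  have := h.prob_noise
  exact Measure.isProbabilityMeasure_map (h.measurable_answer x).aemeasurable

variable {G : Type*} [NormedAddCommGroup G] [NormedSpace ℝ G] [MeasurableSpace G] [BorelSpace G]
  [SecondCountableTopology G]

/-- Centred at `∇f(x) - b`, an answer is `ξ + b` plus the observation error at `x`. The part `ξ + b`
does not depend on `x`, and this is what makes answers at `0` and at `x` comparable. -/
theorem integral_answerLaw (h : IsObliviousNoiseOracle F Q Dξ f α σ) (x b : Vec d)
    {φ : Vec d → G} (hφ : Measurable φ) {B : ℝ} (hB : ∀ y, ‖φ y‖ ≤ B) :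
    Integrable (fun ξ => ∫ γ, φ (ξ + b + (gradient (F γ) x - gradient f x)) ∂Q) Dξ ∧
    ∫ y, φ (y - (gradient f x - b)) ∂(answerLaw F Q Dξ x) =
      ∫ ξ, ∫ γ, φ (ξ + b + (gradient (F γ) x - gradient f x)) ∂Q ∂Dξ := by
  have := h.prob_Q
  have := h.prob_noise
  have hm : Measurable fun p : Γ × Vec d =>
      φ (p.2 + b + (gradient (F p.1) x - gradient f x)) :=
    hφ.comp ((measurable_snd.add_const b).add ((h.measurable_error x).comp measurable_fst))
  have hi : Integrable (fun p : Γ × Vec d =>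
      φ (p.2 + b + (gradient (F p.1) x - gradient f x))) (Q.prod Dξ) :=
    Integrable.of_bound hm.aestronglyMeasurable B (Filter.Eventually.of_forall fun p => hB _)
  refine ⟨hi.integral_prod_right, ?_⟩
  have hφ' : Measurable fun y : Vec d => φ (y - (gradient f x - b)) :=
    hφ.comp (measurable_id.sub_const _)
  rw [answerLaw, integral_map (h.measurable_answer x).aemeasurable hφ'.aestronglyMeasurable,
    ← integral_prod_symm _ hi]
  refine integral_congr_ae (Filter.Eventually.of_forall fun p => ?_)
  simp only
  congr 1
  abel

/-- Mean weight of the oblivious noise, shifted by `b` and scaled by `s`. -/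
def noiseWeight (Dξ : Measure (Vec d)) (b : Vec d) (s : ℝ) : ℝ :=
  ∫ ξ, 1 / (1 + ‖s • (ξ + b)‖ ^ 2) ∂Dξ

theorem measurable_weight (s : ℝ) : Measurable fun y : Vec d => 1 / (1 + ‖s • y‖ ^ 2) :=
  (((measurable_id.const_smul s).norm.pow_const 2).const_add 1).const_div 1

theorem norm_weight_le (s : ℝ) (y : Vec d) : ‖1 / (1 + ‖s • y‖ ^ 2)‖ ≤ 1 := by
  rw [Real.norm_of_nonneg (by positivity), div_le_one (by positivity)]
  nlinarith [sq_nonneg ‖s • y‖]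

theorem integrable_weight (h : IsObliviousNoiseOracle F Q Dξ f α σ) (b : Vec d) (s : ℝ) :
    Integrable (fun ξ => 1 / (1 + ‖s • (ξ + b)‖ ^ 2)) Dξ := by
  have := h.prob_noise
  exact Integrable.of_bound
    ((measurable_weight s).comp (measurable_id.add_const b)).aestronglyMeasurable 1
    (Filter.Eventually.of_forall fun ξ => norm_weight_le s _)

theorem integral_indicator_zero_ge (h : IsObliviousNoiseOracle F Q Dξ f α σ) {a : ℝ}
    (ha : 0 ≤ a) : Integrable (({0} : Set (Vec d)).indicator fun _ => a) Dξ ∧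
      α * a ≤ ∫ ξ, ({0} : Set (Vec d)).indicator (fun _ => a) ξ ∂Dξ := by
  have := h.prob_noise
  refine ⟨(integrable_const a).indicator (measurableSet_singleton 0), ?_⟩
  rw [integral_indicator_const _ (measurableSet_singleton 0), smul_eq_mul]
  gcongr
  exact (ENNReal.ofReal_le_iff_le_toReal (measure_ne_top _ _)).1 h.atom

/-- Only the atom at `0` is counted; there the weight is at least `1/2`. -/
theorem noiseWeight_ge (h : IsObliviousNoiseOracle F Q Dξ f α σ) {b : Vec d} {s : ℝ}
    (hs : ‖s • b‖ ≤ 1) : α / 2 ≤ noiseWeight Dξ b s := by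
  obtain ⟨hi, hα⟩ := h.integral_indicator_zero_ge (a := 1 / 2) (by norm_num)
  rw [div_eq_mul_one_div]
  refine hα.trans (integral_mono hi (h.integrable_weight b s) fun ξ => ?_)
  by_cases h0 : ξ ∈ ({0} : Set (Vec d))
  · rw [Set.indicator_of_mem h0]
    rw [Set.mem_singleton_iff.1 h0, zero_add]
    simp only
    apply one_div_le_one_div_of_le (by positivity)
    nlinarith [norm_nonneg (s • b)]
  · rw [Set.indicator_of_notMem h0]
    positivity

/-- The reference value depends on `Dξ` and `b` alone, so using the bound at `0` and at `x` compares
the two laws. The bias is proportional to `noiseWeight`, so it shrinks together with the modulus of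
monotonicity. -/
theorem norm_integral_avgField_answerLaw_sub_le (h : IsObliviousNoiseOracle F Q Dξ f α σ)
    (x b : Vec d) (M : ℕ) (s : ℝ) :
    ‖∫ y, avgField M (s • (y - (gradient f x - b))) ∂(answerLaw F Q Dξ x) -
        ∫ ξ, avgField M (s • (ξ + b)) ∂Dξ‖ ≤
      5 * harmonicSum M * (s * σ) ^ 2 * noiseWeight Dξ b s := by
  have := h.prob_Q
  have := h.prob_noise
  have hφ : Measurable fun y : Vec d => avgField M (s • y) :=
    (continuous_avgField M).measurable.comp (measurable_id.const_smul s)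
  obtain ⟨hi, he⟩ := h.integral_answerLaw x b hφ (B := harmonicSum M)
    fun y => norm_avgField_le M _
  have hi2 : Integrable (fun ξ => avgField M (s • (ξ + b))) Dξ :=
    Integrable.of_bound (hφ.comp (measurable_id.add_const b)).aestronglyMeasurable (harmonicSum M)
      (Filter.Eventually.of_forall fun ξ => norm_avgField_le M _)
  rw [he, ← integral_sub hi hi2, noiseWeight, ← integral_const_mul]
  refine norm_integral_le_of_norm_le ((h.integrable_weight b s).const_mul _)
    (Filter.Eventually.of_forall fun ξ => ?_)
  refine (norm_integral_avgField_sub_le (h.measurable_error x) (h.variance x) (h.integral_error x)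
    M s (ξ + b)).trans (le_of_eq ?_)
  ring

theorem integral_weight_answerLaw_ge (h : IsObliviousNoiseOracle F Q Dξ f α σ)
    (x b : Vec d) {s : ℝ} (hs : (s * σ) ^ 2 ≤ 1 / 2) :
    noiseWeight Dξ b s / 4 ≤
      ∫ y, 1 / (1 + ‖s • (y - (gradient f x - b))‖ ^ 2) ∂(answerLaw F Q Dξ x) := by
  have := h.prob_Q
  obtain ⟨hi, he⟩ := h.integral_answerLaw x b (measurable_weight s) (norm_weight_le s)
  rw [he, noiseWeight, ← integral_div]
  exact integral_mono ((h.integrable_weight b s).div_const _) hi fun ξ =>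
    integral_weight_ge (h.measurable_error x) (h.variance x) hs (ξ + b)

theorem abs_integral_squash_answerLaw_sub_le (h : IsObliviousNoiseOracle F Q Dξ f α σ)
    (hσ : 0 < σ) (x b : Vec d) {s : ℝ} (hs : 0 ≤ s) (k : Fin d) :
    |∫ y, squash (s * (y - (gradient f x - b)) k) ∂(answerLaw F Q Dξ x) -
        ∫ ξ, squash (s * (ξ + b) k) ∂Dξ| ≤ s * σ := by
  have := h.prob_Q
  have := h.prob_noise
  have hφ : Measurable fun y : Vec d => squash (s * y k) :=
    continuous_squash.measurable.comp
      ((EuclideanSpace.proj (𝕜 := ℝ) k).continuous.measurable.const_mul s)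
  obtain ⟨hi, he⟩ := h.integral_answerLaw x b hφ (B := 1) fun y => abs_squash_le _
  have hi2 : Integrable (fun ξ => squash (s * (ξ + b) k)) Dξ :=
    Integrable.of_bound (hφ.comp (measurable_id.add_const b)).aestronglyMeasurable 1
      (Filter.Eventually.of_forall fun ξ => abs_squash_le _)
  rw [he, ← integral_sub hi hi2, ← Real.norm_eq_abs]
  refine (norm_integral_le_of_norm_le_const (C := s * σ)
    (Filter.Eventually.of_forall fun ξ => abs_integral_squash_sub_le hσ (h.measurable_error x)
      (h.variance x) hs (ξ + b) k)).trans ?_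
  simp

theorem integral_indicator_answerLaw_ge (h : IsObliviousNoiseOracle F Q Dξ f α σ) (hσ : 0 < σ)
    (x : Vec d) {b : Vec d} {R : ℝ} (hR : ‖b‖ + 2 * σ ≤ R) :
    3 * α / 4 ≤ ∫ y, (Metric.closedBall (gradient f x - b) R).indicator (fun _ => (1 : ℝ)) y
      ∂(answerLaw F Q Dξ x) := by
  have := h.prob_Q
  have hφ : Measurable fun y : Vec d =>
      (Metric.closedBall (0 : Vec d) R).indicator (fun _ => (1 : ℝ)) y :=
    measurable_const.indicator Metric.isClosed_closedBall.measurableSet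
  obtain ⟨hi, he⟩ := h.integral_answerLaw x b hφ (B := 1) fun y =>
    (norm_indicator_le_norm_self _ _).trans (by simp)
  have e : ∀ y, (Metric.closedBall (gradient f x - b) R).indicator (fun _ => (1 : ℝ)) y =
      (Metric.closedBall (0 : Vec d) R).indicator (fun _ => (1 : ℝ))
        (y - (gradient f x - b)) := fun y => by
    simp only [Set.indicator, Metric.mem_closedBall, dist_eq_norm, sub_zero]
  simp only [e]
  rw [he]
  obtain ⟨hi0, hα⟩ := h.integral_indicator_zero_ge (a := 3 / 4) (by norm_num)
  refine le_trans (by linarith) (hα.trans (integral_mono hi0 hi fun ξ => ?_))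
  by_cases h0 : ξ ∈ ({0} : Set (Vec d))
  · rw [Set.indicator_of_mem h0]
    rw [Set.mem_singleton_iff.1 h0, zero_add]
    exact integral_indicator_closedBall_ge hσ (h.measurable_error x) (h.variance x) hR
  · rw [Set.indicator_of_notMem h0]
    exact integral_nonneg fun γ => Set.indicator_nonneg (fun _ _ => zero_le_one) _

end IsObliviousNoiseOracle

end Oracle

/-! ### The samples are good with high probability -/

section GoodEvents

variable {E : Type*} [NormedAddCommGroup E] [InnerProductSpace ℝ E] [MeasurableSpace E]
  [BorelSpace E] [SecondCountableTopology E] {Ω : Type*} [MeasurableSpace Ω]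
  {ν : Measure Ω}

/-- The samples whose mean of `Z` deviates by at least `ε` from its expectation. -/
def devSet (ν : Measure Ω) (Z : Ω → E) (n : ℕ) (ε : ℝ) : Set (Fin n → Ω) :=
  {ω | ε ≤ ‖(n : ℝ)⁻¹ • ∑ i, Z (ω i) - ∫ ω, Z ω ∂ν‖}

theorem measurableSet_devSet {Z : Ω → E} (hZ : Measurable Z) (n : ℕ) (ε : ℝ) :
    MeasurableSet (devSet ν Z n ε) := by
  refine measurableSet_le measurable_const (Measurable.norm ?_)
  exact ((Finset.measurable_sum _ fun i _ => hZ.comp (measurable_pi_apply i)).const_smul _).sub_const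
    _

theorem one_sub_le_measure_compl_iUnion [IsProbabilityMeasure ν] {κ : Type*} [Fintype κ]
    {A : κ → Set Ω} (hA : ∀ k, MeasurableSet (A k)) {a δ : ℝ}
    (h : ∀ k, ν (A k) ≤ ENNReal.ofReal a) (hδ : Fintype.card κ * a ≤ δ) :
    1 - ENNReal.ofReal δ ≤ ν (⋃ k, A k)ᶜ := by
  rw [prob_compl_eq_one_sub (MeasurableSet.iUnion hA)]
  refine tsub_le_tsub_left ?_ 1
  calc ν (⋃ k, A k) ≤ ∑ k, ν (A k) := measure_iUnion_fintype_le ν A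
    _ ≤ ∑ _k : κ, ENNReal.ofReal a := Finset.sum_le_sum fun k _ => h k
    _ = ENNReal.ofReal (Fintype.card κ * a) := by
        rw [Finset.sum_const, Finset.card_univ, nsmul_eq_mul,
          ENNReal.ofReal_mul (by positivity), ENNReal.ofReal_natCast]
    _ ≤ _ := ENNReal.ofReal_le_ofReal hδ

end GoodEvents

theorem one_le_harmonicSum {M : ℕ} (hM : 0 < M) : 1 ≤ harmonicSum M := by
  have h := Finset.single_le_sum (f := fun j : Fin M => 1 / ((j : ℝ) + 1))
    (fun j _ => by positivity) (Finset.mem_univ ⟨0, hM⟩)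
  simpa [harmonicSum] using h

namespace IsObliviousNoiseOracle

variable {d : ℕ} {Γ : Type*} [MeasurableSpace Γ] {F : Γ → Vec d → ℝ} {Q : Measure Γ}
  {Dξ : Measure (Vec d)} {f : Vec d → ℝ} {α σ : ℝ}

/-- A union bound over Hoeffding deviations: `d + 1` statistics of `X` and `d + 3` of `Y`. The event
for `X` concerns only samples at `0` and the event for `Y` only samples at `x`, which matches the
order in which they are drawn. -/
theorem exists_good_events (h : IsObliviousNoiseOracle F Q Dξ f α σ) (q : EstParams)
    {β R r ε δ : ℝ} (hσ : 0 < σ) (hN : 0 < q.N) (hM : 0 < q.M)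
    (hf : 0 < q.fineScale) (hs : 0 < q.roughScale) (hβ : q.fineScale * β ≤ 1)
    (hfσ : (q.fineScale * σ) ^ 2 ≤ 1 / 2) (hsσ : q.roughScale * σ ≤ α / 64) (hε : 0 < ε)
    (hεα : ε ≤ α / 64) (hr : 0 < r)
    (hbias : 10 * harmonicSum q.M * (q.fineScale * σ) ^ 2 ≤ r / 256) (hεr : 2 * ε ≤ r * α / 512)
    (hR : β + 2 * σ ≤ R)
    (hδ : (d + 3) * (2 * Real.exp (-(q.N * ε ^ 2 / (8 * harmonicSum q.M ^ 2)))) ≤ δ)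
    (x g : Vec d) (hg : ‖gradient f 0 - g‖ ≤ β) :
    ∃ EX EY : Set (Fin q.N → Vec d), MeasurableSet EX ∧ MeasurableSet EY ∧
      1 - ENNReal.ofReal δ ≤ (Measure.pi fun _ => answerLaw F Q Dξ 0) EX ∧
      1 - ENNReal.ofReal δ ≤ (Measure.pi fun _ => answerLaw F Q Dξ x) EY ∧
      ∀ X ∈ EX, ∀ Y ∈ EY,
        q.GoodSamples X Y g (gradient f x - (gradient f 0 - g)) α R r := by
  have hP0 := h.isProbabilityMeasure_answerLaw 0
  have hPx := h.isProbabilityMeasure_answerLaw x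
  set b := gradient f 0 - g with hb
  set c := gradient f x - b with hc
  have hc0 : gradient f 0 - b = g := by rw [hb]; abel
  set H := harmonicSum q.M with hH
  have hH1 : 1 ≤ H := one_le_harmonicSum hM
  have hH0 : 0 < H := by linarith
  set a : ℝ := 2 * Real.exp (-(q.N * ε ^ 2 / (8 * H ^ 2))) with ha
  have ha0 : 0 < a := by positivity
  -- the statistics
  have mA : ∀ m : Vec d, Measurable fun y : Vec d => avgField q.M (q.fineScale • (y - m)) :=
    fun m => ((continuous_avgField q.M).comp
      (by fun_prop : Continuous fun y : Vec d => q.fineScale • (y - m))).measurable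
  have mS : ∀ (m : Vec d) (k : Fin d), Measurable fun y : Vec d =>
      squash (q.roughScale * (y - m) k) := fun m k => (continuous_squash.comp
    (by fun_prop : Continuous fun y : Vec d => q.roughScale * (y - m) k)).measurable
  have mW : Measurable fun y : Vec d => 1 / (1 + ‖q.fineScale • (y - c)‖ ^ 2) :=
    (measurable_weight q.fineScale).comp (measurable_id.sub_const c)
  have mI : Measurable ((Metric.closedBall c R).indicator fun _ => (1 : ℝ)) :=
    measurable_const.indicator Metric.isClosed_closedBall.measurableSet
  have bA : ∀ (m y : Vec d), ‖avgField q.M (q.fineScale • (y - m))‖ ≤ H :=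
    fun m y => norm_avgField_le _ _
  have bS : ∀ (m : Vec d) (k : Fin d) (y : Vec d), ‖squash (q.roughScale * (y - m) k)‖ ≤ H :=
    fun m k y => (abs_squash_le _).trans hH1
  have bW : ∀ y : Vec d, ‖1 / (1 + ‖q.fineScale • (y - c)‖ ^ 2)‖ ≤ H :=
    fun y => (norm_weight_le _ _).trans hH1
  have bI : ∀ y : Vec d, ‖(Metric.closedBall c R).indicator (fun _ => (1 : ℝ)) y‖ ≤ H :=
    fun y => (norm_indicator_le_norm_self _ _).trans (by simpa using hH1)
  -- the events
  let AX : Option (Fin d) → Set (Fin q.N → Vec d) := fun o => match o with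
    | none => devSet (answerLaw F Q Dξ 0)
        (fun y => avgField q.M (q.fineScale • (y - g))) q.N ε
    | some k => devSet (answerLaw F Q Dξ 0)
        (fun y => squash (q.roughScale * (y - g) k)) q.N ε
  let AY : Option (Option (Option (Fin d))) → Set (Fin q.N → Vec d) := fun o => match o with
    | none => devSet (answerLaw F Q Dξ x) (fun y => 1 / (1 + ‖q.fineScale • (y - c)‖ ^ 2)) q.N ε
    | some none => devSet (answerLaw F Q Dξ x)
        ((Metric.closedBall c R).indicator fun _ => (1 : ℝ)) q.N ε
    | some (some none) => devSet (answerLaw F Q Dξ x)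
        (fun y => avgField q.M (q.fineScale • (y - c))) q.N ε
    | some (some (some k)) => devSet (answerLaw F Q Dξ x)
        (fun y => squash (q.roughScale * (y - c) k)) q.N ε
  have mAX : ∀ o, MeasurableSet (AX o) := fun o => match o with
    | none => measurableSet_devSet (mA g) _ _
    | some k => measurableSet_devSet (mS g k) _ _
  have mAY : ∀ o, MeasurableSet (AY o) := fun o => match o with
    | none => measurableSet_devSet mW _ _
    | some none => measurableSet_devSet mI _ _
    | some (some none) => measurableSet_devSet (mA c) _ _
    | some (some (some k)) => measurableSet_devSet (mS c k) _ _
  have pAX : ∀ o, (Measure.pi fun _ => answerLaw F Q Dξ 0) (AX o) ≤ ENNReal.ofReal a :=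
    fun o => match o with
    | none => measure_norm_mean_sub_ge_le (mA g) hH0 (bA g) hε hN
    | some k => measure_norm_mean_sub_ge_le (mS g k) hH0 (bS g k) hε hN
  have pAY : ∀ o, (Measure.pi fun _ => answerLaw F Q Dξ x) (AY o) ≤ ENNReal.ofReal a :=
    fun o => match o with
    | none => measure_norm_mean_sub_ge_le mW hH0 bW hε hN
    | some none => measure_norm_mean_sub_ge_le mI hH0 bI hε hN
    | some (some none) => measure_norm_mean_sub_ge_le (mA c) hH0 (bA c) hε hN
    | some (some (some k)) => measure_norm_mean_sub_ge_le (mS c k) hH0 (bS c k) hε hN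
  refine ⟨(⋃ o, AX o)ᶜ, (⋃ o, AY o)ᶜ, (MeasurableSet.iUnion mAX).compl,
    (MeasurableSet.iUnion mAY).compl, one_sub_le_measure_compl_iUnion mAX pAX ?_,
    one_sub_le_measure_compl_iUnion mAY pAY ?_, ?_⟩
  · simp only [Fintype.card_option, Fintype.card_fin]; push_cast; linarith
  · simp only [Fintype.card_option, Fintype.card_fin]; push_cast; linarith
  intro X hX Y hY
  simp only [Set.mem_compl_iff, Set.mem_iUnion, not_exists] at hX hY
  -- the deviations
  have dXA : ‖(q.N : ℝ)⁻¹ • ∑ i, avgField q.M (q.fineScale • (X i - g)) -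
      ∫ y, avgField q.M (q.fineScale • (y - g)) ∂(answerLaw F Q Dξ 0)‖ < ε :=
    not_le.1 fun hh => hX none hh
  have dXS : ∀ k, |(q.N : ℝ)⁻¹ * ∑ i, squash (q.roughScale * (X i - g) k) -
      ∫ y, squash (q.roughScale * (y - g) k) ∂(answerLaw F Q Dξ 0)| < ε :=
    fun k => not_le.1 fun hh => hX (some k) hh
  have dYW : |(q.N : ℝ)⁻¹ * ∑ i, 1 / (1 + ‖q.fineScale • (Y i - c)‖ ^ 2) -
      ∫ y, 1 / (1 + ‖q.fineScale • (y - c)‖ ^ 2) ∂(answerLaw F Q Dξ x)| < ε :=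
    not_le.1 fun hh => hY none hh
  have dYI : |(q.N : ℝ)⁻¹ * ∑ i, (Metric.closedBall c R).indicator (fun _ => (1 : ℝ)) (Y i) -
      ∫ y, (Metric.closedBall c R).indicator (fun _ => (1 : ℝ)) y ∂(answerLaw F Q Dξ x)| < ε :=
    not_le.1 fun hh => hY (some none) hh
  have dYA : ‖(q.N : ℝ)⁻¹ • ∑ i, avgField q.M (q.fineScale • (Y i - c)) -
      ∫ y, avgField q.M (q.fineScale • (y - c)) ∂(answerLaw F Q Dξ x)‖ < ε :=
    not_le.1 fun hh => hY (some (some none)) hh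
  have dYS : ∀ k, |(q.N : ℝ)⁻¹ * ∑ i, squash (q.roughScale * (Y i - c) k) -
      ∫ y, squash (q.roughScale * (y - c) k) ∂(answerLaw F Q Dξ x)| < ε :=
    fun k => not_le.1 fun hh => hY (some (some (some k))) hh
  have hbβ : ‖q.fineScale • b‖ ≤ 1 := by
    rw [norm_smul, Real.norm_of_nonneg hf.le]
    exact le_trans (by gcongr) hβ
  -- expectations
  have eXA := h.norm_integral_avgField_answerLaw_sub_le 0 b q.M q.fineScale
  have eYA := h.norm_integral_avgField_answerLaw_sub_le x b q.M q.fineScale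
  have eXS := h.abs_integral_squash_answerLaw_sub_le hσ 0 b hs.le
  have eYS := h.abs_integral_squash_answerLaw_sub_le hσ x b hs.le
  have eW := h.integral_weight_answerLaw_ge x b hfσ
  have eI := h.integral_indicator_answerLaw_ge hσ x (b := b) (R := R) (by linarith)
  have hp := h.noiseWeight_ge hbβ
  rw [hc0] at eXA
  simp only [hc0] at eXS
  rw [← hc] at eYA eW eI
  simp only [← hc] at eYS
  set p := noiseWeight Dξ b q.fineScale
  -- The expectation is at least `p/4`, and `ε ≤ α/64 ≤ p/32`.
  have hw : p / 8 ≤ (q.N : ℝ)⁻¹ * ∑ i, 1 / (1 + ‖q.fineScale • (Y i - c)‖ ^ 2) := by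
    have := (abs_lt.1 dYW).1
    linarith
  refine ⟨?_, by linarith, fun k => ?_, ?_⟩
  · set mX := (q.N : ℝ)⁻¹ • ∑ i, avgField q.M (q.fineScale • (X i - g)) with hmX
    set mY := (q.N : ℝ)⁻¹ • ∑ i, avgField q.M (q.fineScale • (Y i - c)) with hmY
    set iX := ∫ y, avgField q.M (q.fineScale • (y - g)) ∂(answerLaw F Q Dξ 0)
    set iY := ∫ y, avgField q.M (q.fineScale • (y - c)) ∂(answerLaw F Q Dξ x)
    set i₀ := ∫ ξ, avgField q.M (q.fineScale • (ξ + b)) ∂Dξ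
    have e1 : q.fineGap X Y g c = (mX - iX) + (iX - i₀) - ((mY - iY) + (iY - i₀)) := by
      rw [EstParams.fineGap]; abel
    have h1 : ‖q.fineGap X Y g c‖ ≤ 2 * ε + 2 * (5 * H * (q.fineScale * σ) ^ 2 * p) := by
      rw [e1]
      refine (norm_sub_le _ _).trans ?_
      have h2 := norm_add_le (mX - iX) (iX - i₀)
      have h3 := norm_add_le (mY - iY) (iY - i₀)
      linarith
    have h2 : 10 * H * (q.fineScale * σ) ^ 2 * p ≤ r / 256 * p := by
      have : 0 ≤ p := by linarith
      gcongr
    -- Uses `α/2 ≤ p`. Sampling error and bias together are then at most `r p / 128`, and `hw` turns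
    -- this into the required `1/16` of `r` times the empirical weight.
    have h3 : r * α / 512 ≤ r / 256 * p := by nlinarith
    have h4 : r * (p / 8) ≤ r * ((q.N : ℝ)⁻¹ * ∑ i, 1 / (1 + ‖q.fineScale • (Y i - c)‖ ^ 2)) := by
      gcongr
    linarith
  · have h1 := abs_lt.1 (dXS k)
    have h2 := abs_lt.1 (dYS k)
    have h3 := abs_le.1 (eXS k)
    have h4 := abs_le.1 (eYS k)
    simp only [PiLp.sub_apply, PiLp.add_apply] at h1 h2 h3 h4
    rw [EstParams.roughGap, abs_le]
    constructor <;> linarith [h1.1, h1.2, h2.1, h2.2, h3.1, h3.2, h4.1, h4.2]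
  · have := (abs_lt.1 dYI).1
    linarith

end IsObliviousNoiseOracle

/-! ### Sampling the noisy oracle -/

/-- The block of registers `b, …, b + d - 1`. -/
def blockEmb (d b : ℕ) : Fin d ↪ ℕ :=
  ⟨fun k => b + k, fun _ _ h => Fin.ext (Nat.add_left_cancel h)⟩

theorem extend_blockEmb_apply {d b : ℕ} (y : Fin d → ℝ) (μ : Mem) (k : Fin d) :
    Function.extend (blockEmb d b) y μ (b + k) = y k :=
  (blockEmb d b).injective.extend_apply y μ k

theorem extend_blockEmb_of_lt {d b : ℕ} (y : Fin d → ℝ) (μ : Mem) {r : ℕ} (hr : r < b) :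
    Function.extend (blockEmb d b) y μ r = μ r :=
  Function.extend_apply' _ _ _ fun ⟨k, hk⟩ => by
    change b + (k : ℕ) = r at hk; omega

namespace Prog

section Sample

variable {d m s : ℕ}

/-- Query the noisy oracle `n` times at the point in the registers `z`, store the answers from
register `b` on, and continue with `rest`. -/
def sample (z : Fin d → ℕ) : ℕ → ℕ → Prog (optAccess d m s) → Prog (optAccess d m s)
  | 0, _, rest => rest
  | n + 1, b, rest => .call .oracle z (blockEmb d b) (sample z n (b + d) rest)

theorem time_sample (z : Fin d → ℕ) (n b : ℕ) (rest : Prog (optAccess d m s)) :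
    (sample z n b rest).time = n + rest.time := by
  induction n generalizing b with
  | zero => simp [sample]
  | succ n ih => simp only [sample, time, ih]; omega

theorem calls_oracle_sample (z : Fin d → ℕ) (n b : ℕ) (rest : Prog (optAccess d m s)) :
    (sample z n b rest).calls OptOp.oracle = n + rest.calls OptOp.oracle := by
  induction n generalizing b with
  | zero => simp [sample]
  | succ n ih => simp only [sample, calls, ih, if_true]; omega

theorem calls_meanEstimator_sample (z : Fin d → ℕ) (n b : ℕ) (rest : Prog (optAccess d m s)) :
    (sample z n b rest).calls OptOp.meanEstimator = rest.calls OptOp.meanEstimator := by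
  induction n generalizing b with
  | zero => simp [sample]
  | succ n ih => simp [sample, calls, ih]

variable {κ : ∀ o : (optAccess d m s).Op,
  ((optAccess d m s).In o → ℝ) → Measure ((optAccess d m s).Out o → ℝ)}

/-- The probability of `rest` need not be measurable in the memory. It is therefore bounded below by
a measurable `g` of the samples, to which the product formula applies. -/
theorem lintegral_le_prob_sample {S : Set Mem} {z : Fin d → ℕ} {n b : ℕ}
    {rest : Prog (optAccess d m s)} {μ : Mem} (ν : Measure (Fin d → ℝ)) [IsProbabilityMeasure ν]
    (hν : κ OptOp.oracle (fun k => μ (z k)) = ν) (hz : ∀ k, z k < b)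
    {g : (Fin n → Fin d → ℝ) → ℝ≥0∞} (hg : Measurable g)
    (h : ∀ y μ', (∀ (i : Fin n) (k : Fin d), μ' (b + i * d + k) = y i k) → (∀ r < b, μ' r = μ r) →
      g y ≤ rest.prob κ S μ') :
    ∫⁻ y, g y ∂(Measure.pi fun _ => ν) ≤ (sample z n b rest).prob κ S μ := by
  induction n generalizing b μ with
  | zero =>
    have e : ∀ y : Fin 0 → Fin d → ℝ, g y = g 0 := fun y => congrArg g (Subsingleton.elim _ _)
    simp only [e, lintegral_const, measure_univ, mul_one]
    exact h 0 μ (fun i _ => i.elim0) fun _ _ => rfl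
  | succ n ih =>
    rw [lintegral_pi_fin_succ ν n hg]
    simp only [sample, prob]
    rw [hν]
    refine lintegral_mono fun x => ?_
    refine ih (b := b + d) ?_ (fun k => (hz k).trans_le (by omega))
      (hg.comp (by fun_prop)) fun y μ' h1 h2 => ?_
    · rw [← hν]
      congr 1
      funext k
      exact extend_blockEmb_of_lt x μ (hz k)
    · refine h _ _ (fun i k => ?_) fun r hr => ?_
      · refine Fin.cases ?_ (fun i => ?_) i
        · simp only [Fin.val_zero, zero_mul, add_zero, Fin.cons_zero]
          rw [h2 _ (by omega)]
          exact extend_blockEmb_apply x μ k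
        · simp only [Fin.val_succ, Fin.cons_succ]
          rw [← h1 i k]
          congr 1
          ring
      · rw [h2 r (by omega)]
        exact extend_blockEmb_of_lt x μ hr

theorem mul_le_prob_sample {S : Set Mem} {z : Fin d → ℕ} {n b : ℕ}
    {rest : Prog (optAccess d m s)} {μ : Mem} (ν : Measure (Fin d → ℝ)) [IsProbabilityMeasure ν]
    (hν : κ OptOp.oracle (fun k => μ (z k)) = ν) (hz : ∀ k, z k < b)
    {E : Set (Fin n → Fin d → ℝ)} (hE : MeasurableSet E) {c a : ℝ≥0∞}
    (hc : c ≤ (Measure.pi fun _ => ν) E)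
    (h : ∀ y ∈ E, ∀ μ' : Mem, (∀ (i : Fin n) (k : Fin d), μ' (b + i * d + k) = y i k) →
      (∀ r < b, μ' r = μ r) → a ≤ rest.prob κ S μ') :
    c * a ≤ (sample z n b rest).prob κ S μ := by
  refine le_trans ?_ (lintegral_le_prob_sample ν hν hz (g := E.indicator fun _ => a)
    (measurable_const.indicator hE) fun y μ' h1 h2 => ?_)
  · rw [lintegral_indicator_const hE, mul_comm]
    gcongr
  · by_cases hy : y ∈ E
    · rw [Set.indicator_of_mem hy]; exact h y hy μ' h1 h2
    · rw [Set.indicator_of_notMem hy]; exact zero_le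

end Sample

/-! ### Answering one query of the inexact learner -/

section Query

variable {I : Interface}

/-- The time bound and the absence of calls hold for all arguments, with a trivial block where the
registers do not fit. Costs can then be bounded without tracking register invariants. -/
theorem exists_estimateBlock (q : EstParams) {d : ℕ} (lo n : ℕ) (ρ : q.Arg d → ℕ) :
    ∃ b : Prog I × (Fin d → ℕ) × ℕ, b.1.time ≤ q.cost d ∧ b.1.LocalAbove 0 ∧
      (lo ≤ n → (∀ i, ρ i ∈ Set.Ico lo n) →
        n ≤ b.2.2 ∧ (∀ k, b.2.1 k ∈ Set.Ico lo b.2.2) ∧ b.1.LocalAbove n ∧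
        ∀ μ k, b.1.exec μ (b.2.1 k) = q.estimate (EstParams.argX fun i => μ (ρ i))
          (EstParams.argY fun i => μ (ρ i)) (EstParams.argG fun i => μ (ρ i)) k) := by
  by_cases h : lo ≤ n ∧ ∀ i, ρ i ∈ Set.Ico lo n
  · obtain ⟨p, out, n', h1, h2, h3, h4, h5⟩ :=
      EstParams.computes_estimate (I := I) (q := q) (d := d) ρ lo n h.1 h.2
    exact ⟨(p, out, n'), h4, h3.mono (Nat.zero_le _), fun _ _ => ⟨h1, h2, h3, h5⟩⟩
  · exact ⟨(.halt, fun _ => 0, 0), Nat.zero_le _, trivial, fun h1 h2 => (h ⟨h1, h2⟩).elim⟩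

/-- A block computing the estimate from the registers `ρ`, its output registers, and the first
register that is free afterwards. -/
def estimateBlock (I : Interface) (q : EstParams) {d : ℕ} (lo n : ℕ) (ρ : q.Arg d → ℕ) :
    Prog I × (Fin d → ℕ) × ℕ :=
  (exists_estimateBlock q lo n ρ).choose

/-- The registers of the estimator's arguments: samples from `n` on, and the center in `g`. -/
def argRegs (q : EstParams) {d : ℕ} (g : Fin d → ℕ) (n : ℕ) : q.Arg d → ℕ :=
  Sum.elim (fun p => n + p.1 * d + p.2)
    (Sum.elim (fun p => n + q.N * d + p.1 * d + p.2) g)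

theorem mul_add_lt_mul {N d : ℕ} (i : Fin N) (k : Fin d) : (i : ℕ) * d + k < N * d := by
  have h1 : ((i : ℕ) + 1) * d ≤ N * d := Nat.mul_le_mul_right d i.2
  have h2 : ((i : ℕ) + 1) * d = i * d + d := by ring
  omega

theorem argRegs_mem (q : EstParams) {d lo n : ℕ} {g : Fin d → ℕ} (hlo : lo ≤ n)
    (hg : ∀ k, g k ∈ Set.Ico lo n) (i : q.Arg d) :
    argRegs q g n i ∈ Set.Ico lo (n + q.N * d + q.N * d) := by
  rcases i with p | p | k
  · have := mul_add_lt_mul p.1 p.2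
    simp only [argRegs, Sum.elim_inl, Set.mem_Ico]; omega
  · have := mul_add_lt_mul p.1 p.2
    simp only [argRegs, Sum.elim_inl, Sum.elim_inr, Set.mem_Ico]; omega
  · have := hg k
    simp only [argRegs, Sum.elim_inr, Set.mem_Ico] at this ⊢; omega

variable {d m s : ℕ}

/-- Estimate the gradient at the point in the registers `x`, given an estimate of the gradient at
the origin in the registers `g`. -/
def query (q : EstParams) (lo zr : ℕ) (x g : Fin d → ℕ) (n : ℕ)
    (rest : (Fin d → ℕ) → ℕ → Prog (optAccess d m s)) : Prog (optAccess d m s) :=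
  let b := estimateBlock (optAccess d m s) q lo (n + q.N * d + q.N * d) (argRegs q g n)
  sample (fun _ => zr) q.N n (sample x q.N (n + q.N * d) (b.1.seq (rest b.2.1 b.2.2)))

variable {q : EstParams} {lo zr n : ℕ} {x g : Fin d → ℕ}
  {rest : (Fin d → ℕ) → ℕ → Prog (optAccess d m s)}

theorem time_query_le {t : ℕ} (h : ∀ out n', (rest out n').time ≤ t) :
    (query q lo zr x g n rest).time ≤ 2 * q.N + q.cost d + t := by
  rw [query, time_sample, time_sample]
  have h1 := (exists_estimateBlock (I := optAccess d m s) q lo (n + q.N * d + q.N * d)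
    (argRegs q g n)).choose_spec.1
  have h2 := time_seq_le
    (estimateBlock (optAccess d m s) q lo (n + q.N * d + q.N * d) (argRegs q g n)).1
    (rest (estimateBlock (optAccess d m s) q lo (n + q.N * d + q.N * d) (argRegs q g n)).2.1
    (estimateBlock (optAccess d m s) q lo (n + q.N * d + q.N * d) (argRegs q g n)).2.2)
  have h3 := h
    (estimateBlock (optAccess d m s) q lo (n + q.N * d + q.N * d) (argRegs q g n)).2.1
    (estimateBlock (optAccess d m s) q lo (n + q.N * d + q.N * d) (argRegs q g n)).2.2
  change (estimateBlock (optAccess d m s) q lo (n + q.N * d + q.N * d) (argRegs q g n)).1.time ≤ _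
    at h1
  omega

theorem localAbove_estimateBlock (q : EstParams) (lo n : ℕ) (ρ : q.Arg d → ℕ) :
    (estimateBlock I q lo n ρ).1.LocalAbove 0 :=
  (exists_estimateBlock q lo n ρ).choose_spec.2.1

theorem calls_oracle_query_le {t : ℕ} (h : ∀ out n', (rest out n').calls OptOp.oracle ≤ t) :
    (query q lo zr x g n rest).calls OptOp.oracle ≤ 2 * q.N + t := by
  rw [query, calls_oracle_sample, calls_oracle_sample, (localAbove_estimateBlock q _ _ _).calls_seq]
  have := h
    (estimateBlock (optAccess d m s) q lo (n + q.N * d + q.N * d) (argRegs q g n)).2.1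
    (estimateBlock (optAccess d m s) q lo (n + q.N * d + q.N * d) (argRegs q g n)).2.2
  omega

theorem calls_meanEstimator_query_le {t : ℕ}
    (h : ∀ out n', (rest out n').calls OptOp.meanEstimator ≤ t) :
    (query q lo zr x g n rest).calls OptOp.meanEstimator ≤ t := by
  rw [query, calls_meanEstimator_sample, calls_meanEstimator_sample,
    (localAbove_estimateBlock q _ _ _).calls_seq]
  exact h _ _

/-- With probability at least `c` each, the samples at `0` and those at any point `x` are such that
the estimate from them is an answer to the query `x` that satisfies `R`. -/
def Reliable (q : EstParams) (ν : (Fin d → ℝ) → Measure (Fin d → ℝ))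
    (R : (Fin d → ℝ) → (Fin d → ℝ) → Prop) (c : ℝ≥0∞) (g : Vec d) : Prop :=
  ∀ x, ∃ EX EY : Set (Fin q.N → Fin d → ℝ), MeasurableSet EX ∧ MeasurableSet EY ∧
    c ≤ (Measure.pi fun _ => ν 0) EX ∧ c ≤ (Measure.pi fun _ => ν x) EY ∧
    ∀ X ∈ EX, ∀ Y ∈ EY,
      R x (q.estimate (fun i => WithLp.toLp 2 (X i)) (fun i => WithLp.toLp 2 (Y i)) g).ofLp

variable {κ : ∀ o : (optAccess d m s).Op,
  ((optAccess d m s).In o → ℝ) → Measure ((optAccess d m s).Out o → ℝ)}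

/-- When the query is made, `x` is already fixed in memory and all samples are fresh, so the events
for `X` and `Y` each contribute an independent factor `c`. The origin is queried by passing the zero
register for every coordinate. -/
theorem mul_le_prob_query [hκ : ∀ x, IsProbabilityMeasure (κ OptOp.oracle x)] {S : Set Mem}
    {R : (Fin d → ℝ) → (Fin d → ℝ) → Prop} {c a : ℝ≥0∞} {μ : Mem}
    (hR : Reliable q (κ OptOp.oracle) R c (WithLp.toLp 2 fun k => μ (g k)))
    (hlo : lo ≤ n) (hzero : zr < n) (hμ : μ zr = 0) (hx : ∀ k, x k < n)
    (hg : ∀ k, g k ∈ Set.Ico lo n)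
    (h : ∀ out n' μ', n ≤ n' → (∀ k, out k ∈ Set.Ico lo n') → (∀ r < n, μ' r = μ r) →
      R (fun k => μ (x k)) (fun k => μ' (out k)) → a ≤ (rest out n').prob κ S μ') :
    c * c * a ≤ (query q lo zr x g n rest).prob κ S μ := by
  obtain ⟨EX, EY, mX, mY, hX, hY, hE⟩ := hR fun k => μ (x k)
  rw [mul_assoc, query]
  refine mul_le_prob_sample (κ OptOp.oracle 0) (by simp only [hμ]; rfl) (fun _ => hzero) mX hX
    fun X hXE μ₁ h1 h2 => ?_
  refine mul_le_prob_sample (κ OptOp.oracle fun k => μ (x k)) ?_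
    (fun k => (hx k).trans_le (by omega)) mY hY fun Y hYE μ₂ h3 h4 => ?_
  · congr 1
    funext k
    exact h2 _ (hx k)
  obtain ⟨hn, hout, hloc, hval⟩ := (exists_estimateBlock (I := optAccess d m s) q lo
    (n + q.N * d + q.N * d) (argRegs q g n)).choose_spec.2.2 (by omega) (argRegs_mem q hlo hg)
  change _ ≤ (estimateBlock (optAccess d m s) q lo _ _).2.2 at hn
  change ∀ k, (estimateBlock (optAccess d m s) q lo _ _).2.1 k ∈ _ at hout
  change (estimateBlock (optAccess d m s) q lo _ _).1.LocalAbove _ at hloc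
  change ∀ μ k, (estimateBlock (optAccess d m s) q lo _ _).1.exec μ
    ((estimateBlock (optAccess d m s) q lo _ _).2.1 k) = _ at hval
  rw [hloc.prob_seq]
  refine h _ _ _ (by omega) hout (fun r hr => ?_) ?_
  · rw [hloc.exec_eq _ (by omega), h4 r (by omega), h2 r hr]
  · simp only [hval]
    convert hE X hXE Y hYE using 2
    refine congr (congr (congrArg _ ?_) ?_) ?_
    · funext i
      refine congrArg (WithLp.toLp 2) (funext fun k => ?_)
      have := mul_add_lt_mul i k
      simp only [argRegs, Sum.elim_inl]
      rw [h4 _ (by omega), h1]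
    · funext i
      refine congrArg (WithLp.toLp 2) (funext fun k => ?_)
      simp only [argRegs, Sum.elim_inl, Sum.elim_inr]
      rw [h3]
    · refine congrArg (WithLp.toLp 2) (funext fun k => ?_)
      simp only [argRegs, Sum.elim_inr]
      rw [h4 _ ((hg k).2.trans_le (by omega)), h2 _ (hg k).2]

end Query

/-! ### Simulating the inexact learner -/

section Simulate

variable {d m s : ℕ}

/-- Run `A` with its register `r` kept in register `ρ r`, every instruction writing to fresh
registers from `n` on and every gradient query answered by `query`; then continue with `K`. -/
def simulate (q : EstParams) (lo zr : ℕ) (g : Fin d → ℕ)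
    (K : (ℕ → ℕ) → ℕ → Prog (optAccess d m s)) :
    Prog (gradientAccess d) → (ℕ → ℕ) → ℕ → Prog (optAccess d m s)
  | .halt, ρ, n => K ρ n
  | .const r c p, ρ, n => .const n c (simulate q lo zr g K p (Function.update ρ r n) (n + 1))
  | .arith o r a b p, ρ, n =>
      .arith o n (ρ a) (ρ b) (simulate q lo zr g K p (Function.update ρ r n) (n + 1))
  | .branch a b p p', ρ, n =>
      .branch (ρ a) (ρ b) (simulate q lo zr g K p ρ n) (simulate q lo zr g K p' ρ n)
  | .call _ src dst p, ρ, n => query q lo zr (fun k => ρ (src k)) g n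
      fun out n' => simulate q lo zr g K p (Function.extend dst out ρ) n'

variable {q : EstParams} {lo zr : ℕ} {g : Fin d → ℕ}
  {K : (ℕ → ℕ) → ℕ → Prog (optAccess d m s)}

theorem time_simulate_le {t : ℕ} (h : ∀ ρ n, (K ρ n).time ≤ t) (A : Prog (gradientAccess d))
    (ρ : ℕ → ℕ) (n : ℕ) :
    (simulate q lo zr g K A ρ n).time ≤ A.time * (2 * q.N + q.cost d + 1) + t := by
  induction A generalizing ρ n with
  | halt => simpa [simulate, time] using h ρ n
  | const r c p ih =>
    have := ih (Function.update ρ r n) (n + 1)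
    simp only [simulate, time, add_mul]; omega
  | arith o r a b p ih =>
    have := ih (Function.update ρ r n) (n + 1)
    simp only [simulate, time, add_mul]; omega
  | branch a b p p' ih ih' =>
    have h1 := ih ρ n
    have h2 := ih' ρ n
    have h3 := Nat.mul_le_mul_right (2 * q.N + q.cost d + 1) (le_max_left p.time p'.time)
    have h4 := Nat.mul_le_mul_right (2 * q.N + q.cost d + 1) (le_max_right p.time p'.time)
    simp only [simulate, time, add_mul (max _ _)]; omega
  | call o src dst p ih =>
    have := time_query_le (q := q) (lo := lo) (zr := zr) (x := fun k => ρ (src k)) (g := g)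
      (n := n) (rest := fun out n' => simulate q lo zr g K p (Function.extend dst out ρ) n')
      fun out n' => ih _ n'
    simp only [simulate, time, add_mul p.time]; omega

theorem calls_oracle_simulate_le {t : ℕ} (h : ∀ ρ n, (K ρ n).calls OptOp.oracle ≤ t)
    (A : Prog (gradientAccess d)) (ρ : ℕ → ℕ) (n : ℕ) :
    (simulate q lo zr g K A ρ n).calls OptOp.oracle ≤ A.time * (2 * q.N) + t := by
  induction A generalizing ρ n with
  | halt => simpa [simulate, time] using h ρ n
  | const r c p ih =>
    have := ih (Function.update ρ r n) (n + 1)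
    simp only [simulate, calls, time, add_mul]; omega
  | arith o r a b p ih =>
    have := ih (Function.update ρ r n) (n + 1)
    simp only [simulate, calls, time, add_mul]; omega
  | branch a b p p' ih ih' =>
    have h1 := ih ρ n
    have h2 := ih' ρ n
    have h3 := Nat.mul_le_mul_right (2 * q.N) (le_max_left p.time p'.time)
    have h4 := Nat.mul_le_mul_right (2 * q.N) (le_max_right p.time p'.time)
    simp only [simulate, calls, time, add_mul (max _ _)]; omega
  | call o src dst p ih =>
    have := calls_oracle_query_le (q := q) (lo := lo) (zr := zr) (x := fun k => ρ (src k))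
      (g := g) (n := n)
      (rest := fun out n' => simulate q lo zr g K p (Function.extend dst out ρ) n')
      fun out n' => ih _ n'
    simp only [simulate, time, add_mul p.time]; omega

theorem calls_meanEstimator_simulate_le {t : ℕ}
    (h : ∀ ρ n, (K ρ n).calls OptOp.meanEstimator ≤ t)
    (A : Prog (gradientAccess d)) (ρ : ℕ → ℕ) (n : ℕ) :
    (simulate q lo zr g K A ρ n).calls OptOp.meanEstimator ≤ t := by
  induction A generalizing ρ n with
  | halt => exact h ρ n
  | const r c p ih => exact ih _ _
  | arith o r a b p ih => exact ih _ _
  | branch a b p p' ih ih' => exact max_le (ih ρ n) (ih' ρ n)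
  | call o src dst p ih => exact calls_meanEstimator_query_le fun out n' => ih _ n'

variable {κ : ∀ o : (optAccess d m s).Op,
  ((optAccess d m s).In o → ℝ) → Measure ((optAccess d m s).Out o → ℝ)}

/-- Along every path on which all estimates succeed, the answers satisfy `R`, so `Surely` places the
simulated memory in `S'`. Each instruction is charged a factor `c * c`, although only calls need it;
this lets the exponent be `A.time`. Fresh writes preserve every register below `n`, in particular
`zr`, the center `g` and the remaining list. -/
theorem pow_mul_le_prob_simulate [hκ : ∀ x, IsProbabilityMeasure (κ OptOp.oracle x)]
    {S S' : Set Mem} {R : (Fin d → ℝ) → (Fin d → ℝ) → Prop} {c a : ℝ≥0∞} (hc : c ≤ 1)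
    {v : Vec d} (hR : Reliable q (κ OptOp.oracle) R c v) {A : Prog (gradientAccess d)} {ν μ : Mem}
    (hA : A.Surely (fun _ => R) S' ν) {ρ : ℕ → ℕ} {n : ℕ} (hρ : ∀ r, ρ r ∈ Set.Ico lo n)
    (hμν : ∀ r, μ (ρ r) = ν r) (hlo : lo ≤ n) (hzero : zr < n) (hμ : μ zr = 0)
    (hg : ∀ k, g k ∈ Set.Ico lo n) (hv : v = WithLp.toLp 2 fun k => μ (g k))
    (h : ∀ ρ' n' μ' ν', n ≤ n' → (∀ r, ρ' r ∈ Set.Ico lo n') → (∀ r < n, μ' r = μ r) →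
      (∀ r, μ' (ρ' r) = ν' r) → ν' ∈ S' → a ≤ (K ρ' n').prob κ S μ') :
    (c * c) ^ A.time * a ≤ (simulate q lo zr g K A ρ n).prob κ S μ := by
  have hcc : c * c ≤ 1 := mul_le_one' hc hc
  have step : ∀ {t : ℕ} {P : ℝ≥0∞}, (c * c) ^ t * a ≤ P → (c * c) ^ (t + 1) * a ≤ P :=
    fun {t P} hP => le_trans (by
      gcongr ?_ * a
      exact pow_le_pow_right_of_le_one' hcc (Nat.le_succ t)) hP
  have write : ∀ {ν μ : Mem} {ρ : ℕ → ℕ} {n : ℕ}, (∀ r, ρ r ∈ Set.Ico lo n) →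
      (∀ r, μ (ρ r) = ν r) → lo ≤ n → ∀ (r : ℕ) (w : ℝ),
      (∀ r', Function.update ρ r n r' ∈ Set.Ico lo (n + 1)) ∧
      ∀ r', Function.update μ n w (Function.update ρ r n r') = Function.update ν r w r' := by
    intro ν μ ρ n hρ hμν hlo r w
    refine ⟨fun r' => ?_, fun r' => ?_⟩
    · rcases eq_or_ne r' r with rfl | hr
      · rw [Function.update_self]; exact ⟨hlo, n.lt_succ_self⟩
      · rw [Function.update_of_ne hr]; exact Set.Ico_subset_Ico_right (Nat.le_succ n) (hρ r')
    · rcases eq_or_ne r' r with rfl | hr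
      · rw [Function.update_self, Function.update_self, Function.update_self]
      · rw [Function.update_of_ne hr, Function.update_of_ne hr,
          Function.update_of_ne (hρ r').2.ne, hμν]
  induction A generalizing ν μ ρ n with
  | halt =>
    simpa [simulate, time] using h ρ n μ ν le_rfl hρ (fun _ _ => rfl) hμν hA
  | const r w p ih =>
    obtain ⟨h1, h2⟩ := write hρ hμν hlo r w
    refine step (ih (ν := Function.update ν r w) (μ := Function.update μ n w) hA h1 h2
      (by omega) (by omega) ?_ (fun k => Set.Ico_subset_Ico_right (Nat.le_succ n) (hg k)) ?_ ?_)
    · rw [Function.update_of_ne hzero.ne, hμ]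
    · rw [hv]
      exact congrArg _ (funext fun k => (Function.update_of_ne (hg k).2.ne _ _).symm)
    · intro ρ' n' μ' ν' hn hρ' hμ'
      refine h ρ' n' μ' ν' (by omega) hρ' fun r hr => ?_
      rw [hμ' r (by omega), Function.update_of_ne hr.ne]
  | arith o r a' b' p ih =>
    obtain ⟨h1, h2⟩ := write hρ hμν hlo r (o.eval (ν a') (ν b'))
    have e : (simulate q lo zr g K (.arith o r a' b' p) ρ n).prob κ S μ =
        (simulate q lo zr g K p (Function.update ρ r n) (n + 1)).prob κ S
          (Function.update μ n (o.eval (ν a') (ν b'))) := by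
      simp only [simulate, prob, hμν]
    rw [e]
    refine step (ih (ν := Function.update ν r _) (μ := Function.update μ n _) hA h1 h2
      (by omega) (by omega) ?_ (fun k => Set.Ico_subset_Ico_right (Nat.le_succ n) (hg k)) ?_ ?_)
    · rw [Function.update_of_ne hzero.ne, hμ]
    · rw [hv]
      exact congrArg _ (funext fun k => (Function.update_of_ne (hg k).2.ne _ _).symm)
    · intro ρ' n' μ' ν' hn hρ' hμ'
      refine h ρ' n' μ' ν' (by omega) hρ' fun r hr => ?_
      rw [hμ' r (by omega), Function.update_of_ne hr.ne]
  | branch a' b' p p' ih ih' =>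
    simp only [simulate, prob, hμν, time]
    split_ifs with hab
    · refine step (le_trans ?_ (ih (hA.1 hab) hρ hμν hlo hzero hμ hg hv h))
      gcongr ?_ * a
      exact pow_le_pow_right_of_le_one' hcc (le_max_left _ _)
    · refine step (le_trans ?_ (ih' (hA.2 hab) hρ hμν hlo hzero hμ hg hv h))
      gcongr ?_ * a
      exact pow_le_pow_right_of_le_one' hcc (le_max_right _ _)
  | call o src dst p ih =>
    simp only [simulate, time]
    rw [pow_succ', mul_assoc]
    refine mul_le_prob_query (hv ▸ hR) hlo hzero hμ (fun k => (hρ _).2) hg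
      fun out n' μ' hn hout hμ' hRo => ?_
    have hRo' : R (fun k => ν (src k)) fun k => μ' (out k) := by simpa only [hμν] using hRo
    refine ih (ν := Function.extend dst (fun k => μ' (out k)) ν) (μ := μ') (hA _ hRo')
      (fun r => ?_) (fun r => ?_) (by omega) (by omega) ((hμ' _ hzero).trans hμ)
      (fun k => Set.Ico_subset_Ico_right hn (hg k)) ?_ ?_
    · by_cases hr : ∃ k, dst k = r
      · obtain ⟨k, rfl⟩ := hr
        rw [dst.injective.extend_apply]; exact hout k
      · rw [Function.extend_apply' _ _ _ hr]; exact Set.Ico_subset_Ico_right hn (hρ r)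
    · by_cases hr : ∃ k, dst k = r
      · obtain ⟨k, rfl⟩ := hr
        rw [dst.injective.extend_apply, dst.injective.extend_apply]
      · rw [Function.extend_apply' _ _ _ hr, Function.extend_apply' _ _ _ hr, hμ' _ (hρ r).2, hμν]
    · rw [hv]
      exact congrArg _ (funext fun k => (hμ' _ (hg k).2).symm)
    · intro ρ' n'' μ'' ν' hn' hρ' hμ''
      refine h ρ' n'' μ'' ν' (by omega) hρ' fun r hr => ?_
      rw [hμ'' r (by omega), hμ' r hr]

theorem surely_univ {I : Interface} (A : Prog I) (ν : Mem) :
    A.Surely (fun _ _ _ => True) Set.univ ν := by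
  induction A generalizing ν with
  | halt => trivial
  | const r w p ih => exact ih _
  | arith o r a b p ih => exact ih _
  | branch a b p p' ih ih' => exact ⟨fun _ => ih _, fun _ => ih' _⟩
  | call o src dst p ih => exact fun _ _ => ih _

/-- A run with a useless candidate costs no probability and preserves the old registers. This is the
previous bound with the trivial answer relation and `c = 1`. -/
theorem le_prob_simulate [hκ : ∀ x, IsProbabilityMeasure (κ OptOp.oracle x)]
    {S : Set Mem} {a : ℝ≥0∞} (A : Prog (gradientAccess d)) {μ : Mem} {ρ : ℕ → ℕ} {n : ℕ}
    (hρ : ∀ r, ρ r ∈ Set.Ico lo n) (hlo : lo ≤ n) (hzero : zr < n) (hμ : μ zr = 0)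
    (hg : ∀ k, g k ∈ Set.Ico lo n)
    (h : ∀ ρ' n' μ', n ≤ n' → (∀ r, ρ' r ∈ Set.Ico lo n') → (∀ r < n, μ' r = μ r) →
      a ≤ (K ρ' n').prob κ S μ') :
    a ≤ (simulate q lo zr g K A ρ n).prob κ S μ := by
  have := pow_mul_le_prob_simulate (q := q) (K := K) (κ := κ) (S := S) (c := 1) (a := a)
    (R := fun _ _ => True) le_rfl (v := WithLp.toLp 2 fun k => μ (g k))
    (fun x => ⟨Set.univ, Set.univ, .univ, .univ, by simp, by simp, fun _ _ _ _ => trivial⟩)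
    (surely_univ A fun r => μ (ρ r)) hρ (fun _ => rfl) hlo hzero hμ hg rfl
    fun ρ' n' μ' _ h1 h2 h3 _ _ => h ρ' n' μ' h1 h2 h3
  simpa using this

end Simulate

end Prog

namespace Prog

/-! ### Running the inexact learner once for each point of the list -/

section Copy

variable {I : Interface}

/-- Copy the registers `ρ 0, …, ρ (n - 1)` to `b, …, b + n - 1`, given a register `zr` that
holds `0`, and continue with `rest`. -/
def copy (ρ : ℕ → ℕ) (zr b : ℕ) : ℕ → Prog I → Prog I
  | 0, rest => rest
  | n + 1, rest => .arith .add (b + n) (ρ n) zr (copy ρ zr b n rest)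

theorem time_copy (ρ : ℕ → ℕ) (zr b n : ℕ) (rest : Prog I) :
    (copy ρ zr b n rest).time = n + rest.time := by
  induction n with
  | zero => simp [copy]
  | succ n ih => simp only [copy, time, ih]; omega

theorem calls_copy [DecidableEq I.Op] (o : I.Op) (ρ : ℕ → ℕ) (zr b n : ℕ) (rest : Prog I) :
    (copy ρ zr b n rest).calls o = rest.calls o := by
  induction n with
  | zero => rfl
  | succ n ih => simp only [copy, calls, ih]

/-- All sources and `zr` lie at or above `b + N`, beyond the targets, so no copied value is
overwritten before it is read. -/
theorem exists_prob_copy_eq (κ : ∀ o : I.Op, (I.In o → ℝ) → Measure (I.Out o → ℝ)) (S : Set Mem)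
    {ρ : ℕ → ℕ} {zr b N n : ℕ} (hn : n ≤ N) (hρ : ∀ k, b + N ≤ ρ k) (hzr : b + N ≤ zr)
    (rest : Prog I) {μ : Mem} (hμ : μ zr = 0) :
    ∃ μ' : Mem, (copy ρ zr b n rest).prob κ S μ = rest.prob κ S μ' ∧
      (∀ k < n, μ' (b + k) = μ (ρ k)) ∧ ∀ r, (r < b ∨ b + n ≤ r) → μ' r = μ r := by
  induction n generalizing μ with
  | zero => exact ⟨μ, rfl, fun k hk => absurd hk (Nat.not_lt_zero k), fun _ _ => rfl⟩
  | succ n ih =>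
    obtain ⟨μ', h1, h2, h3⟩ := ih (by omega) (μ := Function.update μ (b + n) (μ (ρ n)))
      (by rw [Function.update_of_ne (by omega), hμ])
    refine ⟨μ', ?_, fun k hk => ?_, fun r hr => ?_⟩
    · rw [← h1]
      simp only [copy, prob, Arith.eval, hμ, add_zero]
    · rcases Nat.lt_succ_iff_lt_or_eq.1 hk with hk | rfl
      · rw [h2 k hk, Function.update_of_ne]
        have := hρ k; omega
      · rw [h3 _ (Or.inr le_rfl), Function.update_self]
    · rw [h3 r (by omega), Function.update_of_ne (by omega)]

end Copy

section Loop

variable {d m s : ℕ}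

/-- Run `A` with each of the points number `j - 1, …, 0` of the list stored from register `b` on as
the estimate of the gradient at the origin, and store the results as output points. -/
def loop (q : EstParams) (A : Prog (gradientAccess d)) (lo zr b : ℕ) :
    ℕ → ℕ → Prog (optAccess d m s)
  | 0, _ => .halt
  -- Every register of `A` is initially mapped to `zr`, so the simulated memory starts as zero.
  | j + 1, n => simulate q lo zr (fun k => b + j * d + k)
      (fun ρ n' => copy ρ zr (j * d) d (loop q A lo zr b j n')) A (fun _ => zr) n

variable (q : EstParams) (A : Prog (gradientAccess d)) (lo zr b : ℕ)

theorem time_loop_le (j n : ℕ) : (loop (m := m) (s := s) q A lo zr b j n).time ≤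
    j * (A.time * (2 * q.N + q.cost d + 1) + d) := by
  induction j generalizing n with
  | zero => simp [loop, time]
  | succ j ih =>
    rw [add_mul, loop]
    refine (time_simulate_le (t := d + j * (A.time * (2 * q.N + q.cost d + 1) + d))
      (fun ρ n => ?_) A _ n).trans (by omega)
    rw [time_copy]
    have := ih n
    omega

theorem calls_oracle_loop_le (j n : ℕ) :
    (loop (m := m) (s := s) q A lo zr b j n).calls OptOp.oracle ≤ j * (A.time * (2 * q.N)) := by
  induction j generalizing n with
  | zero => simp [loop, calls]
  | succ j ih =>
    rw [add_mul, loop]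
    refine (calls_oracle_simulate_le (t := j * (A.time * (2 * q.N)))
      (fun ρ n => ?_) A _ n).trans (by omega)
    rw [calls_copy]
    exact ih n

theorem calls_meanEstimator_loop_le (j n : ℕ) :
    (loop (m := m) (s := s) q A lo zr b j n).calls OptOp.meanEstimator ≤ 0 := by
  induction j generalizing n with
  | zero => simp [loop, calls]
  | succ j ih =>
    refine calls_meanEstimator_simulate_le (fun ρ n => ?_) A _ n
    rw [calls_copy]
    exact ih n

variable {κ : ∀ o : (optAccess d m s).Op,
  ((optAccess d m s).In o → ℝ) → Measure ((optAccess d m s).Out o → ℝ)} {q A lo zr b}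

/-- The remaining rounds write output points with numbers below `j₀` and registers from `n` on, so a
good output point is kept. -/
theorem one_le_prob_loop_of_mem [hκ : ∀ x, IsProbabilityMeasure (κ OptOp.oracle x)]
    {U : Set (Vec d)} {j j₀ n : ℕ} {μ : Mem} (hj : j ≤ j₀) (hj₀ : (j₀ + 1) * d ≤ lo)
    (hlo : lo ≤ n) (hzr : zr ∈ Set.Ico lo n) (hμ : μ zr = 0) (hb : lo ≤ b)
    (hbn : b + (j₀ + 1) * d ≤ n) (hU : outputPoint d μ j₀ ∈ U) :
    1 ≤ (loop q A lo zr b j n).prob κ {μ | outputPoint d μ j₀ ∈ U} μ := by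
  induction j generalizing n μ with
  | zero =>
    simp only [loop, prob]
    rw [if_pos (by exact hU)]
  | succ j ih =>
    have hjd : (j + 1) * d ≤ j₀ * d := Nat.mul_le_mul_right d hj
    rw [add_mul, one_mul] at hjd hj₀ hbn
    refine le_prob_simulate A (fun _ => hzr) hlo hzr.2 hμ (fun k => ?_) fun ρ n' μ₁ hn hρ h1 => ?_
    · have := k.2
      exact ⟨by omega, by omega⟩
    obtain ⟨μ₂, h2, -, h3⟩ := exists_prob_copy_eq κ {μ | outputPoint d μ j₀ ∈ U} (b := j * d)
      (le_refl d) (fun k => le_trans (by omega) (hρ k).1) (le_trans (by omega) hzr.1)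
      (loop q A lo zr b j n') ((h1 zr hzr.2).trans hμ)
    rw [h2]
    have hz := hzr.1
    refine ih (by omega) (by omega) ⟨hz, hzr.2.trans_le hn⟩ ?_ (by rw [add_mul]; omega) ?_
    · rw [h3 _ (by omega), h1 _ hzr.2, hμ]
    · convert hU using 1
      refine congrArg (WithLp.toLp 2) (funext fun k => ?_)
      have := k.2
      rw [h3 _ (by omega), h1 _ (by omega)]

/-- Rounds before `j₀` are harmless, round `j₀` succeeds with the stated probability, and later
rounds keep its result. Only the round of the accurate candidate is charged. -/
theorem pow_le_prob_loop [hκ : ∀ x, IsProbabilityMeasure (κ OptOp.oracle x)]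
    {S' : Set Mem} {U : Set (Vec d)} (hS : ∀ ν ∈ S', outputPoint d ν 0 ∈ U)
    {R : (Fin d → ℝ) → (Fin d → ℝ) → Prop} {c : ℝ≥0∞} (hc : c ≤ 1)
    {v : Vec d} (hR : Reliable q (κ OptOp.oracle) R c v)
    (hA : A.Surely (fun _ => R) S' fun _ => 0) {j j₀ n : ℕ} {μ : Mem} (hj : j₀ < j)
    (hjs : j * d ≤ lo) (hlo : lo ≤ n) (hzr : zr ∈ Set.Ico lo n) (hμ : μ zr = 0) (hb : lo ≤ b)
    (hbn : b + j * d ≤ n) (hv : v = WithLp.toLp 2 fun k : Fin d => μ (b + j₀ * d + k)) :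
    (c * c) ^ A.time ≤ (loop q A lo zr b j n).prob κ {μ | outputPoint d μ j₀ ∈ U} μ := by
  induction j generalizing n μ with
  | zero => omega
  | succ j ih =>
    have hz := hzr.1
    have hg : ∀ k : Fin d, b + j * d + k ∈ Set.Ico lo n := fun k => by
      have := k.2
      rw [add_mul] at hbn
      exact ⟨by omega, by omega⟩
    rcases Nat.lt_succ_iff_lt_or_eq.1 hj with hj | rfl
    · have hjd : (j₀ + 1) * d ≤ j * d := Nat.mul_le_mul_right d hj
      rw [add_mul, one_mul] at hjd hjs hbn
      refine le_prob_simulate A (fun _ => hzr) hlo hzr.2 hμ hg fun ρ n' μ₁ hn hρ h1 => ?_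
      obtain ⟨μ₂, h2, -, h3⟩ := exists_prob_copy_eq κ {μ | outputPoint d μ j₀ ∈ U} (b := j * d)
        (le_refl d) (fun k => le_trans (by omega) (hρ k).1) (le_trans (by omega) hzr.1)
        (loop q A lo zr b j n') ((h1 zr hzr.2).trans hμ)
      rw [h2]
      refine ih hj (by omega) (by omega) ⟨hz, hzr.2.trans_le hn⟩ ?_ (by omega) ?_
      · rw [h3 _ (by omega), h1 _ hzr.2, hμ]
      · rw [hv]
        refine congrArg (WithLp.toLp 2) (funext fun k => ?_)
        have := k.2
        rw [h3 _ (by omega), h1 _ (by omega)]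
    · rw [← mul_one ((c * c) ^ A.time)]
      refine pow_mul_le_prob_simulate hc hR hA (fun _ => hzr) (fun _ => hμ) hlo hzr.2 hμ hg hv
        fun ρ n' μ₁ ν hn hρ h1 hν hνS => ?_
      rw [add_mul, one_mul] at hjs hbn
      obtain ⟨μ₂, h2, h4, h3⟩ := exists_prob_copy_eq κ {μ | outputPoint d μ j₀ ∈ U} (b := j₀ * d)
        (le_refl d) (fun k => le_trans (by omega) (hρ k).1) (le_trans (by omega) hzr.1)
        (loop q A lo zr b j₀ n') ((h1 zr hzr.2).trans hμ)
      rw [h2]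
      refine one_le_prob_loop_of_mem le_rfl (by rw [add_mul]; omega) (hlo.trans hn)
        ⟨hz, hzr.2.trans_le hn⟩ ?_ hb (by rw [add_mul]; omega) ?_
      · rw [h3 _ (by omega), h1 _ hzr.2, hμ]
      · convert hS ν hνS using 1
        refine congrArg (WithLp.toLp 2) (funext fun k => ?_)
        rw [h4 k k.2, hν, zero_mul, zero_add]

end Loop

/-! ### The optimization algorithm -/

section Optimize

theorem prob_mono {I : Interface} (κ : ∀ o : I.Op, (I.In o → ℝ) → Measure (I.Out o → ℝ))
    {S S' : Set Mem} (h : S ⊆ S') (p : Prog I) (μ : Mem) : p.prob κ S μ ≤ p.prob κ S' μ := by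
  induction p generalizing μ with
  | halt =>
    simp only [prob]
    split_ifs with h1 h2
    · exact le_rfl
    · exact (h2 (h h1)).elim
    · exact zero_le
    · exact le_rfl
  | const r c p ih => exact ih _
  | arith o r a b p ih => exact ih _
  | branch a b p p' ih ih' =>
    simp only [prob]
    split_ifs
    · exact ih _
    · exact ih' _
  | call o src dst p ih => exact lintegral_mono fun y => ih _

variable {d m s : ℕ}

/-- The registers of a list of `s` points stored from register `b` on. -/
def listEmb (d s b : ℕ) : Fin s × Fin d ↪ ℕ :=
  ⟨fun p => b + finProdFinEquiv p, fun _ _ h =>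
    finProdFinEquiv.injective (Fin.ext (Nat.add_left_cancel h))⟩

theorem listEmb_apply (d s b : ℕ) (p : Fin s × Fin d) : listEmb d s b p = b + p.1 * d + p.2 := by
  change b + (finProdFinEquiv p : ℕ) = _
  rw [finProdFinEquiv_apply_val]
  ring

/-- Sample the oracle `m` times at the origin, pass the samples to the mean estimator, and run `A`
for each of the `s` points that it returns. -/
def optimize (q : EstParams) (A : Prog (gradientAccess d)) (m s : ℕ) : Prog (optAccess d m s) :=
  -- Registers below `s * d` are reserved for the output. Register `s * d` is never written and
  -- supplies the constant `0`; samples, list and workspace follow it.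
  sample (fun _ => s * d) m (s * d + 1)
    (.call .meanEstimator (fun p : Fin m × Fin d => s * d + 1 + p.1 * d + p.2)
      (listEmb d s (s * d + 1 + m * d))
      (loop q A (s * d) (s * d) (s * d + 1 + m * d) s (s * d + 1 + m * d + s * d)))

variable (q : EstParams) (A : Prog (gradientAccess d)) (m s : ℕ)

theorem time_optimize_le : (optimize q A m s).time ≤
    m + (1 + s * (A.time * (2 * q.N + q.cost d + 1) + d)) := by
  have := time_loop_le (m := m) (s := s) q A (s * d) (s * d) (s * d + 1 + m * d) s
    (s * d + 1 + m * d + s * d)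
  rw [optimize, time_sample, time]
  omega

theorem calls_oracle_optimize_le : (optimize q A m s).calls OptOp.oracle ≤
    m + s * (A.time * (2 * q.N)) := by
  have := calls_oracle_loop_le (m := m) (s := s) q A (s * d) (s * d) (s * d + 1 + m * d) s
    (s * d + 1 + m * d + s * d)
  rw [optimize, calls_oracle_sample, calls]
  simpa using this

theorem calls_meanEstimator_optimize_le :
    (optimize q A m s).calls OptOp.meanEstimator ≤ 1 := by
  have := calls_meanEstimator_loop_le (m := m) (s := s) q A (s * d) (s * d) (s * d + 1 + m * d) s
    (s * d + 1 + m * d + s * d)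
  rw [optimize, calls_meanEstimator_sample, calls]
  simp only [if_true]
  omega

variable {κ : ∀ o : (optAccess d m s).Op,
  ((optAccess d m s).In o → ℝ) → Measure ((optAccess d m s).Out o → ℝ)} {q A}

/-- Once the returned list contains a point of `V`, the round of that point alone yields the success
factor, so no union bound over the list is needed. -/
theorem mul_le_prob_optimize [hκ : ∀ x, IsProbabilityMeasure (κ OptOp.oracle x)]
    {S' : Set Mem} {U : Set (Vec d)} (hS : ∀ ν ∈ S', outputPoint d ν 0 ∈ U)
    {R : (Fin d → ℝ) → (Fin d → ℝ) → Prop} {c : ℝ≥0∞} (hc : c ≤ 1) {V : Set (Vec d)}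
    (hV : MeasurableSet V) (hR : ∀ v ∈ V, Reliable q (κ OptOp.oracle) R c v)
    (hA : A.Surely (fun _ => R) S' fun _ => 0)
    (hκm : Measurable fun y : Fin m → Fin d → ℝ =>
      κ OptOp.meanEstimator (fun p : Fin m × Fin d => y p.1 p.2)
        {l : Fin s × Fin d → ℝ | ∃ j, (WithLp.toLp 2 fun k => l (j, k) : Vec d) ∈ V}) :
    (c * c) ^ A.time * ∫⁻ y : Fin m → Fin d → ℝ,
      κ OptOp.meanEstimator (fun p : Fin m × Fin d => y p.1 p.2)
        {l : Fin s × Fin d → ℝ | ∃ j, (WithLp.toLp 2 fun k => l (j, k) : Vec d) ∈ V}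
          ∂(Measure.pi fun _ => κ OptOp.oracle 0) ≤
      (optimize q A m s).prob κ {μ | ∃ j : Fin s, outputPoint d μ j ∈ U} fun _ => 0 := by
  rw [← lintegral_const_mul _ hκm, optimize]
  refine lintegral_le_prob_sample (κ OptOp.oracle 0) rfl (fun _ => by omega) (hκm.const_mul _)
    fun y μ h1 h2 => ?_
  have e : (fun p : Fin m × Fin d => μ (s * d + 1 + p.1 * d + p.2)) = fun p => y p.1 p.2 :=
    funext fun p => h1 p.1 p.2
  simp only [prob]
  rw [e]
  have mE : MeasurableSet
      {l : Fin s × Fin d → ℝ | ∃ j, (WithLp.toLp 2 fun k => l (j, k) : Vec d) ∈ V} := by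
    rw [Set.ofPred_exists]
    refine MeasurableSet.iUnion fun j => measurableSet_preimage ?_ hV
    exact (PiLp.continuous_toLp 2 _).measurable.comp
      (measurable_pi_lambda _ fun k => measurable_pi_apply _)
  refine le_trans (le_of_eq (lintegral_indicator_const mE _).symm) (lintegral_mono fun l => ?_)
  by_cases hl : l ∈
      {l : Fin s × Fin d → ℝ | ∃ j, (WithLp.toLp 2 fun k => l (j, k) : Vec d) ∈ V}
  · rw [Set.indicator_of_mem hl]
    obtain ⟨j, hj⟩ := hl
    have hjd : ((j : ℕ) + 1) * d ≤ s * d := Nat.mul_le_mul_right d j.2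
    refine (pow_le_prob_loop (κ := κ) hS hc (hR _ hj) hA j.2 le_rfl (by omega) ⟨le_rfl, by omega⟩
      ?_ (by omega) le_rfl ?_).trans (prob_mono κ (fun μ hμ =>
        show ∃ j : Fin s, outputPoint d μ j ∈ U from ⟨j, hμ⟩) _ _)
    · rw [Function.extend_apply', h2 _ (by omega)]
      rintro ⟨p, hp⟩
      rw [listEmb_apply] at hp
      omega
    · refine congrArg (WithLp.toLp 2) (funext fun k => ?_)
      rw [← listEmb_apply d s _ (j, k), (listEmb d s _).injective.extend_apply]
  · rw [Set.indicator_of_notMem hl]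
    exact zero_le

end Optimize

end Prog

/-! ### Success probability of the optimization algorithm -/

section Success

theorem one_sub_ofReal_eq {t : ℝ} (ht : 0 ≤ t) : 1 - ENNReal.ofReal t = ENNReal.ofReal (1 - t) := by
  rw [ENNReal.ofReal_sub _ ht, ENNReal.ofReal_one]

theorem one_sub_ofReal_add_le_mul {a b : ℝ} (ha : 0 ≤ a) (hb : 0 ≤ b) :
    1 - ENNReal.ofReal (a + b) ≤ (1 - ENNReal.ofReal a) * (1 - ENNReal.ofReal b) := by
  rw [one_sub_ofReal_eq ha, one_sub_ofReal_eq hb, one_sub_ofReal_eq (by positivity)]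
  rcases le_total (a + b) 1 with h | h
  · rw [← ENNReal.ofReal_mul (by linarith)]
    exact ENNReal.ofReal_le_ofReal (by nlinarith [mul_nonneg ha hb])
  · rw [ENNReal.ofReal_of_nonpos (by linarith)]
    exact zero_le

theorem one_sub_ofReal_mul_le_pow {a : ℝ} (ha : 0 ≤ a) (n : ℕ) :
    1 - ENNReal.ofReal (n * a) ≤ (1 - ENNReal.ofReal a) ^ n := by
  induction n with
  | zero => simp
  | succ n ih =>
    rw [Nat.cast_succ, add_mul, one_mul, pow_succ]
    exact (one_sub_ofReal_add_le_mul (by positivity) ha).trans (by gcongr)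

variable {d m s : ℕ} {Γ : Type*} [MeasurableSpace Γ] {F : Γ → Vec d → ℝ} {Q : Measure Γ}
  {Dξ : Measure (Vec d)} {f : Vec d → ℝ} {α σ : ℝ}

/-- The law of the oracle's answer at `x`, as a tuple of reals. -/
def rawAnswerLaw (F : Γ → Vec d → ℝ) (Q : Measure Γ) (Dξ : Measure (Vec d)) (x : Fin d → ℝ) :
    Measure (Fin d → ℝ) :=
  (answerLaw F Q Dξ (WithLp.toLp 2 x)).map fun (g : Vec d) (i : Fin d) => g i

namespace IsObliviousNoiseOracle

theorem measurable_coords : Measurable fun (g : Vec d) (i : Fin d) => g i :=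
  (PiLp.continuous_ofLp 2 _).measurable

theorem measurable_toLp : Measurable fun g : Fin d → ℝ => (WithLp.toLp 2 g : Vec d) :=
  (PiLp.continuous_toLp 2 _).measurable

theorem isProbabilityMeasure_rawAnswerLaw (h : IsObliviousNoiseOracle F Q Dξ f α σ)
    (x : Fin d → ℝ) : IsProbabilityMeasure (rawAnswerLaw F Q Dξ x) := by
  have := h.isProbabilityMeasure_answerLaw (WithLp.toLp 2 x)
  exact Measure.isProbabilityMeasure_map measurable_coords.aemeasurable

theorem measurePreserving_pi_toLp (h : IsObliviousNoiseOracle F Q Dξ f α σ) (x : Fin d → ℝ)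
    (n : ℕ) : MeasurePreserving (fun (X : Fin n → Fin d → ℝ) i => (WithLp.toLp 2 (X i) : Vec d))
      (Measure.pi fun _ => rawAnswerLaw F Q Dξ x)
      (Measure.pi fun _ => answerLaw F Q Dξ (WithLp.toLp 2 x)) := by
  have := h.isProbabilityMeasure_rawAnswerLaw x
  have := h.isProbabilityMeasure_answerLaw (WithLp.toLp 2 x)
  refine measurePreserving_pi _ _ fun _ => ⟨measurable_toLp, ?_⟩
  rw [rawAnswerLaw, Measure.map_map measurable_toLp measurable_coords]
  exact Measure.map_id

/-- The estimator finds `∇f(x) - b` rather than `∇f(x)`; the triangle inequality adds `‖b‖ ≤ β`. -/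
theorem reliable (h : IsObliviousNoiseOracle F Q Dξ f α σ) (q : EstParams)
    {β R r ε δ D : ℝ} (hα : 0 < α) (hα1 : α ≤ 1) (hσ : 0 < σ) (hN : 0 < q.N) (hM : 0 < q.M)
    (hf : 0 < q.fineScale) (hs : 0 < q.roughScale) (hβ : q.fineScale * β ≤ 1)
    (hfσ : (q.fineScale * σ) ^ 2 ≤ 1 / 2) (hsσ : q.roughScale * σ ≤ α / 64) (hε : 0 < ε)
    (hεα : ε ≤ α / 64) (hr : 0 < r)
    (hbias : 10 * harmonicSum q.M * (q.fineScale * σ) ^ 2 ≤ r / 256) (hεr : 2 * ε ≤ r * α / 512)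
    (hR : β + 2 * σ ≤ R)
    (hδ : (d + 3) * (2 * Real.exp (-(q.N * ε ^ 2 / (8 * harmonicSum q.M ^ 2)))) ≤ δ)
    (hsR : q.roughScale * R ≤ α / 64) (hthr : q.thr = 5 * α / 64) (hD : 1 ≤ D)
    (hstart : q.fineScale * √d ≤ D * q.roughScale) (hstep : q.stepSize = α / (4096 * D))
    (hMD : 384 * D ≤ α * q.M) (hr1 : 2 * r ≤ 1)
    (hsteps : (1 - α ^ 2 / (2 ^ 20 * D ^ 2)) ^ q.steps * D ^ 2 ≤ (2 * r) ^ 2)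
    {β' : ℝ} (hβ' : β + 2 * r / q.fineScale ≤ β') (v : Vec d) (hv : ‖gradient f 0 - v‖ ≤ β) :
    Prog.Reliable q (rawAnswerLaw F Q Dξ)
      (fun x g => ‖(WithLp.toLp 2 g : Vec d) - gradient f (WithLp.toLp 2 x)‖ ≤ β')
      (1 - ENNReal.ofReal δ) v := by
  intro x
  obtain ⟨EX, EY, mX, mY, hX, hY, hE⟩ := h.exists_good_events q hσ hN hM hf hs hβ hfσ hsσ hε hεα hr
    hbias hεr hR hδ (WithLp.toLp 2 x) v hv
  have p0 := h.measurePreserving_pi_toLp 0 q.N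
  have px := h.measurePreserving_pi_toLp x q.N
  refine ⟨_, _, p0.measurable mX, px.measurable mY, ?_, ?_, fun X hXE Y hYE => ?_⟩
  · rw [p0.measure_preimage mX.nullMeasurableSet]; exact hX
  · rw [px.measure_preimage mY.nullMeasurableSet]; exact hY
  · have h1 := (hE _ hXE _ hYE).norm_estimate_sub_le hN hM hα hα1 hs hsR hthr hf hD hstart hstep hMD
      hr hr1 hsteps
    refine le_trans ?_ hβ'
    have h2 := norm_sub_le (q.estimate (fun i => WithLp.toLp 2 (X i))
      (fun i => WithLp.toLp 2 (Y i)) v - (gradient f (WithLp.toLp 2 x) - (gradient f 0 - v)))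
      (gradient f 0 - v)
    rw [sub_sub, sub_add_cancel] at h2
    exact h2.trans (by linarith)

theorem map_gradient_mem (h : IsObliviousNoiseOracle F Q Dξ f α σ) :
    Q.map (fun γ => gradient (F γ) 0) ∈ boundedVarianceClass d σ ∧
      ∫ y, y ∂(Q.map fun γ => gradient (F γ) 0) = gradient f 0 := by
  have := h.prob_Q
  have hm := h.measurable_gradient 0
  have e : ∫ y, y ∂(Q.map fun γ => gradient (F γ) 0) = gradient f 0 := by
    rw [integral_map (f := fun y => y) hm.aemeasurable
      measurable_id.aestronglyMeasurable]
    exact h.mean 0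
  refine ⟨⟨Measure.isProbabilityMeasure_map hm.aemeasurable, ?_⟩, e⟩
  rw [e, lintegral_map (by fun_prop) hm]
  exact h.variance 0

theorem conv_map_gradient (h : IsObliviousNoiseOracle F Q Dξ f α σ) :
    Measure.conv (Q.map fun γ => gradient (F γ) 0) Dξ = answerLaw F Q Dξ 0 := by
  have := h.prob_Q
  have := h.prob_noise
  have hm := h.measurable_gradient 0
  have e : (Q.map fun γ => gradient (F γ) 0).prod Dξ =
      (Q.prod Dξ).map (Prod.map (fun γ => gradient (F γ) 0) id) := by
    conv_lhs => rw [← Measure.map_id (μ := Dξ)]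
    exact Measure.map_prod_map _ _ hm measurable_id
  rw [Measure.conv, e, Measure.map_map (by fun_prop) (hm.prodMap measurable_id)]
  rfl

/-- Answers at `0` are samples of the stochastic gradient law convolved with the noise, with mean
`∇f(0)`, so the guarantee of the mean estimator applies. At most `T` queries with two sample sets
each cost `2 T δ₁`. -/
theorem one_sub_le_prob_optimize (h : IsObliviousNoiseOracle F Q Dξ f α σ) {q : EstParams}
    {AG : Prog (gradientAccess d)} {T : ℕ} (hT : AG.time ≤ T)
    {A : Kernel (Fin m → Vec d) (Fin s → Vec d)} [IsMarkovKernel A] {c₀ β β' δME δ δ₁ ε : ℝ}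
    (hA : IsLDME A (boundedVarianceClass d σ) c₀ α β δME) (hδME : 0 ≤ δME) (hδ₁ : 0 ≤ δ₁)
    (hδ : 2 * T * δ₁ ≤ δ) (hAG : IsInexactLearner AG f β' ε)
    (hrel : ∀ v : Vec d, ‖gradient f 0 - v‖ ≤ β → Prog.Reliable q (rawAnswerLaw F Q Dξ)
      (fun x g => ‖(WithLp.toLp 2 g : Vec d) - gradient f (WithLp.toLp 2 x)‖ ≤ β')
      (1 - ENNReal.ofReal δ₁) v) :
    1 - ENNReal.ofReal (δME + δ) ≤ (Prog.optimize q AG m s).prob (optAnswers F Q Dξ A)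
      {μ | ∃ j : Fin s, ‖gradient f (outputPoint d μ j)‖ ≤ β' + ε} fun _ => 0 := by
  have hκ : ∀ x, IsProbabilityMeasure (optAnswers (m := m) (s := s) F Q Dξ A OptOp.oracle x) :=
    h.isProbabilityMeasure_rawAnswerLaw
  set V : Set (Vec d) := {v | ‖gradient f 0 - v‖ ≤ β} with hVdef
  have hV : MeasurableSet V := measurableSet_le (by fun_prop) measurable_const
  set G : Set (Fin s → Vec d) := {l | ∃ j, l j ∈ V} with hG
  have mG : MeasurableSet G := by
    rw [hG, Set.ofPred_exists]
    exact MeasurableSet.iUnion fun j => measurableSet_preimage (measurable_pi_apply j) hV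
  have mraw : MeasurableSet
      {l : Fin s × Fin d → ℝ | ∃ j, (WithLp.toLp 2 fun k => l (j, k) : Vec d) ∈ V} := by
    rw [Set.ofPred_exists]
    refine MeasurableSet.iUnion fun j => measurableSet_preimage ?_ hV
    exact measurable_toLp.comp (measurable_pi_lambda _ fun k => measurable_pi_apply _)
  have hlist : ∀ y : Fin m → Fin d → ℝ,
      optAnswers F Q Dξ A OptOp.meanEstimator (fun p : Fin m × Fin d => y p.1 p.2)
        {l : Fin s × Fin d → ℝ | ∃ j, (WithLp.toLp 2 fun k => l (j, k) : Vec d) ∈ V} =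
      A (fun i => WithLp.toLp 2 (y i)) G := fun y => by
    have hm : Measurable fun (l : Fin s → Vec d) (p : Fin s × Fin d) => l p.1 p.2 :=
      measurable_pi_lambda _ fun p => (measurable_pi_apply p.2).comp
        (measurable_coords.comp (measurable_pi_apply p.1))
    exact Measure.map_apply hm mraw
  have hAm : Measurable fun Z : Fin m → Vec d => A Z G := Kernel.measurable_coe A mG
  have p0 := h.measurePreserving_pi_toLp 0 m
  have key := Prog.mul_le_prob_optimize (κ := optAnswers F Q Dξ A) (m := m) (s := s)
    (S' := {μ | ‖gradient f (outputPoint d μ 0)‖ ≤ β' + ε})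
    (U := {x | ‖gradient f x‖ ≤ β' + ε}) (fun ν hν => hν) (c := 1 - ENNReal.ofReal δ₁)
    tsub_le_self hV hrel hAG (by simp only [hlist]; exact hAm.comp p0.measurable)
  refine le_trans ?_ key
  simp only [hlist]
  rw [mul_comm]
  refine (one_sub_ofReal_add_le_mul hδME (le_trans (by positivity) hδ)).trans (mul_le_mul' ?_ ?_)
  · have e := p0.lintegral_comp hAm
    change _ ≤ ∫⁻ y : Fin m → Fin d → ℝ, A (fun i => WithLp.toLp 2 (y i)) G
      ∂(Measure.pi fun _ => rawAnswerLaw F Q Dξ 0)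
    rw [e]
    have h1 := hA.success _ h.map_gradient_mem.1 Dξ h.prob_noise h.atom
    rw [h.conv_map_gradient, h.map_gradient_mem.2] at h1
    have e2 : {l : Fin s → Vec d | ∃ j, ‖l j - gradient f 0‖ ≤ β} = G := by
      rw [hG, hVdef]
      ext l
      simp only [Set.mem_ofPred_eq, norm_sub_rev]
    rw [e2, Measure.bind_apply mG A.measurable.aemeasurable] at h1
    exact h1
  · rw [← pow_two, ← pow_mul]
    refine le_trans ?_ (one_sub_ofReal_mul_le_pow hδ₁ _)
    refine tsub_le_tsub_left (ENNReal.ofReal_le_ofReal (le_trans ?_ hδ)) 1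
    have : (AG.time : ℝ) ≤ T := by exact_mod_cast hT
    push_cast
    gcongr

end IsObliviousNoiseOracle

/-- An empty list never succeeds, while the class is nonempty: a Dirac mass without noise belongs to
it. -/
theorem IsLDME.one_le_of_isEmpty {A : Kernel (Fin m → Vec d) (Fin s → Vec d)} {σ c₀ β δ : ℝ}
    (hA : IsLDME A (boundedVarianceClass d σ) c₀ α β δ) (hs : s = 0) (hα : α ≤ 1) : 1 ≤ δ := by
  subst hs
  have h := hA.success (Measure.dirac 0) ⟨inferInstance, by simp⟩ (Measure.dirac 0) inferInstance
    (by simpa using hα)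
  simpa [tsub_eq_zero_iff_le] using h

end Success

/-! ### Choice of the parameters -/

section Parameters

theorem harmonicSum_le_one_add_log (M : ℕ) : harmonicSum M ≤ 1 + Real.log M := by
  refine le_trans (le_of_eq ?_) (harmonic_le_one_add_log M)
  rw [harmonicSum, harmonic, Fin.sum_univ_eq_sum_range (fun j => 1 / ((j : ℝ) + 1))]
  push_cast
  simp only [one_div]

namespace EstParams

theorem cost_le {q : EstParams} {d : ℕ} {W : ℝ} (hW : 1 ≤ W) (hd : d ≤ W) (hN : q.N ≤ W)
    (hM : q.M ≤ W) (hs : q.steps ≤ W) : (q.cost d : ℝ) ≤ 232 * W ^ 5 := by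
  have p2 : W ≤ W ^ 2 := by nlinarith
  have p3 : W ^ 2 ≤ W ^ 3 := pow_le_pow_right₀ hW (by norm_num)
  have p4 : W ^ 3 ≤ W ^ 4 := pow_le_pow_right₀ hW (by norm_num)
  have p5 : W ^ 4 ≤ W ^ 5 := pow_le_pow_right₀ hW (by norm_num)
  have h1 : (fieldCost q d : ℝ) ≤ 24 * W ^ 2 := by
    have : (fieldCost q d : ℝ) ≤ W * (3 + (W * (2 * 3 + 2) + 1) + 9) + 3 := by
      rw [fieldCost]; push_cast; gcongr; norm_num
    nlinarith
  have h2 : (roughCost q : ℝ) ≤ 51 * W := by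
    have : (roughCost q : ℝ) ≤ 2 * (W * (4 * 3 + 10) + 3) + 1 := by
      rw [roughCost]; push_cast; gcongr; norm_num
    linarith
  have h3 : (selectCost q d : ℝ) ≤ 171 * W ^ 2 := by
    have : (selectCost q d : ℝ) ≤ W * (3 * (51 * W) + 13) + 5 := by
      rw [selectCost]; push_cast; gcongr
    nlinarith
  have h4 : (descentCost q d : ℝ) ≤ 60 * W ^ 3 := by
    have : (descentCost q d : ℝ) ≤ 2 * (W * (24 * W ^ 2 + 1) + 3) + 4 := by
      rw [descentCost]; push_cast; gcongr
    nlinarith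
  have : (q.cost d : ℝ) ≤ W * 1 + W * (W * (171 * W ^ 2)) + W * (W * (60 * W ^ 3)) := by
    rw [cost]; push_cast; gcongr
  nlinarith

end EstParams

/-- The parameters of the estimator for the target accuracy `(e + c) * (η * σ)`, given an estimate
of the gradient at the origin that is `e * (η * σ)`-accurate; `δ` is the failure probability. -/
structure Tuning where
  e : ℝ
  c : ℝ
  d : ℕ
  α : ℝ
  σ : ℝ
  η : ℝ
  δ : ℝ

namespace Tuning

variable (p : Tuning)

/-- Bound on the scaled distance from the start of the descent to its target. -/
def D : ℝ := 64 * (2 + p.e) * (p.d + 1) / p.α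

/-- The number of nodes of `avgField`. -/
def M : ℕ := ⌈384 * p.D / p.α⌉₊

/-- Bound on `avgField`. -/
def H : ℝ := harmonicSum p.M

/-- The fine scale in units of `η / (σ * H)`. -/
def scale : ℝ := p.c / (5120 * (1 + p.e))

/-- The relative accuracy of the means of `avgField`; the estimate is `2 * r`-accurate in units of
the inverse fine scale. -/
def r : ℝ := p.scale * p.c * p.η ^ 2 / (2 * p.H)

/-- The accuracy of the empirical means. -/
def ε : ℝ := p.r * p.α / 1024

/-- The parameters of the estimator. -/
def estParams : EstParams where
  -- Makes `d + 3` Hoeffding tails `2 exp (-N ε² / (8 H²))` sum to at most `δ`.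
  N := ⌈8 * p.H ^ 2 / p.ε ^ 2 * Real.log (2 * (p.d + 3) / p.δ)⌉₊
  M := p.M
  -- The squared distance contracts by `1 - α² / (2²⁰ D²)` per step and has to fall from `D²` to `(2
  -- r)²`.
  steps := ⌈2 * (2 ^ 20 * p.D ^ 2 / p.α ^ 2) * Real.log (p.D / (2 * p.r))⌉₊
  fineScale := p.scale * p.η / (p.σ * p.H)
  roughScale := p.α / (64 * ((2 + p.e) * p.σ))
  stepSize := p.α / (4096 * p.D)
  -- The gap of the target, at most `α/16`, plus the change `α/64` allowed within radius `R`.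
  thr := 5 * p.α / 64

/-- The ranges of the parameters. -/
structure Valid : Prop where
  e : 0 ≤ p.e
  c : 0 < p.c
  c_le : p.c ≤ 1
  α : 0 < p.α
  α_le : p.α ≤ 1
  σ : 0 < p.σ
  η : 0 < p.η
  η_le : p.η ≤ 1
  δ : 0 < p.δ
  δ_le : p.δ ≤ 1

variable {p}

namespace Valid

theorem one_le_D (h : p.Valid) : 1 ≤ p.D := by
  have := h.e; have := h.α_le
  rw [Tuning.D, one_le_div h.α]
  have : (0 : ℝ) ≤ p.d := by positivity
  nlinarith [mul_nonneg h.e this]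

theorem M_pos (h : p.Valid) : 0 < p.M := by
  have := h.one_le_D; have := h.α
  exact Nat.ceil_pos.2 (by positivity)

theorem one_le_H (h : p.Valid) : 1 ≤ p.H := one_le_harmonicSum h.M_pos

theorem scale_pos (h : p.Valid) : 0 < p.scale := by
  have := h.e; have := h.c
  rw [Tuning.scale]; positivity

theorem scale_mul_le (h : p.Valid) : p.scale * (5120 * (1 + p.e)) = p.c := by
  have := h.e
  rw [Tuning.scale, div_mul_cancel₀]; positivity

theorem scale_le (h : p.Valid) : p.scale ≤ p.c / 5120 := by
  have := h.scale_mul_le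
  nlinarith [mul_nonneg h.scale_pos.le h.e]

theorem scale_mul_e_le (h : p.Valid) : p.scale * p.e ≤ 1 := by
  have := h.scale_mul_le; have := h.scale_pos; have := h.e; have := h.c_le
  nlinarith

theorem r_pos (h : p.Valid) : 0 < p.r := by
  have := h.scale_pos; have := h.c; have := h.η; have := h.one_le_H
  rw [Tuning.r]; positivity

theorem r_le (h : p.Valid) : 2 * p.r ≤ 1 := by
  have h1 := h.scale_pos; have h2 := h.c; have h3 := h.η; have h4 := h.one_le_H
  have h5 : p.scale * p.c * p.η ^ 2 ≤ 1 * 1 * 1 ^ 2 := by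
    gcongr
    · have := h.scale_le; have := h.c_le; linarith
    · exact h.c_le
    · exact h.η_le
  rw [Tuning.r, mul_div_assoc', div_le_one (by positivity)]
  linarith

theorem ε_pos (h : p.Valid) : 0 < p.ε := by
  have := h.r_pos; have := h.α
  rw [Tuning.ε]; positivity

theorem reliable (h : p.Valid) {Γ : Type*} [MeasurableSpace Γ] {F : Γ → Vec p.d → ℝ}
    {Q : Measure Γ} {Dξ : Measure (Vec p.d)} {f : Vec p.d → ℝ}
    (hO : IsObliviousNoiseOracle F Q Dξ f p.α p.σ) (v : Vec p.d)
    (hv : ‖gradient f 0 - v‖ ≤ p.e * (p.η * p.σ)) :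
    Prog.Reliable p.estParams (rawAnswerLaw F Q Dξ)
      (fun x g => ‖(WithLp.toLp 2 g : Vec p.d) - gradient f (WithLp.toLp 2 x)‖ ≤
        (p.e + p.c) * (p.η * p.σ))
      (1 - ENNReal.ofReal p.δ) v := by
  have hα := h.α; have hα1 := h.α_le; have hσ := h.σ; have hη := h.η; have hη1 := h.η_le
  have he := h.e; have hc := h.c; have hc1 := h.c_le
  have hH := h.one_le_H; have hS := h.scale_pos; have hS1 := h.scale_le
  have hSe := h.scale_mul_e_le; have hr := h.r_pos; have hD := h.one_le_D; have hε := h.ε_pos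
  have hδ := h.δ; have hδ1 := h.δ_le
  have hH0 : 0 < p.H := by linarith
  have efσ : p.estParams.fineScale * p.σ = p.scale * p.η / p.H := by
    simp only [estParams]; field_simp
  have hlog : 0 < Real.log (2 * (p.d + 3) / p.δ) := by
    refine Real.log_pos ?_
    rw [one_lt_div hδ]
    have : (0 : ℝ) ≤ p.d := by positivity
    linarith
  have hSη : p.scale * p.η ≤ 1 / 5120 := by nlinarith
  have hfσ : p.scale * p.η / p.H ≤ 1 / 5120 := (div_le_self (by positivity) hH).trans hSη
  refine hO.reliable p.estParams (β := p.e * (p.η * p.σ)) (R := (2 + p.e) * p.σ) (r := p.r)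
    (ε := p.ε) (D := p.D) hα hα1 hσ ?_ h.M_pos ?_ ?_ ?_ ?_ ?_ hε ?_ hr ?_ ?_ ?_ ?_ ?_ rfl hD ?_ rfl
    ?_ h.r_le ?_ ?_ v hv
  · exact Nat.ceil_pos.2 (by positivity)
  · simp only [estParams]; positivity
  · simp only [estParams]; positivity
  · calc p.estParams.fineScale * (p.e * (p.η * p.σ)) =
        (p.estParams.fineScale * p.σ) * p.e * p.η := by ring
      _ = p.scale * p.e * (p.η * p.η) / p.H := by rw [efσ]; ring
      _ ≤ 1 * (1 * 1) / 1 := by gcongr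
      _ = 1 := by norm_num
  · rw [efσ]
    have : 0 ≤ p.scale * p.η / p.H := by positivity
    nlinarith
  · have e : p.estParams.roughScale * p.σ = p.α / 64 / (2 + p.e) := by
      simp only [estParams]; field_simp
    rw [e]
    exact div_le_self (by positivity) (by linarith)
  · have := h.r_le
    rw [Tuning.ε]
    nlinarith
  -- The constant 5120 in `scale` comes from here: the bias condition amounts to `10 * scale ≤ c /
  -- 512`.
  · change 10 * p.H * (p.estParams.fineScale * p.σ) ^ 2 ≤ _
    have e : 10 * p.H * (p.scale * p.η / p.H) ^ 2 = 10 * p.scale * (p.scale * p.η ^ 2 / p.H) := by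
      field_simp
    have e2 : p.r / 256 = p.c / 512 * (p.scale * p.η ^ 2 / p.H) := by
      rw [Tuning.r]; field_simp; ring
    rw [efσ, e, e2]
    gcongr
    linarith
  · rw [Tuning.ε]; apply le_of_eq; ring
  · have : p.e * (p.η * p.σ) ≤ p.e * (1 * p.σ) := by gcongr
    linarith
  · change (p.d + 3) * (2 * Real.exp (-(p.estParams.N * p.ε ^ 2 / (8 * p.H ^ 2)))) ≤ p.δ
    have h1 : Real.log (2 * (p.d + 3) / p.δ) ≤ p.estParams.N * p.ε ^ 2 / (8 * p.H ^ 2) := by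
      have h2 : 8 * p.H ^ 2 / p.ε ^ 2 * Real.log (2 * (p.d + 3) / p.δ) ≤ p.estParams.N :=
        Nat.le_ceil _
      rw [div_mul_eq_mul_div, div_le_iff₀ (by positivity)] at h2
      rw [le_div_iff₀ (by positivity)]
      linarith
    have h3 : Real.exp (-(p.estParams.N * p.ε ^ 2 / (8 * p.H ^ 2))) ≤
        (2 * (p.d + 3) / p.δ)⁻¹ := by
      rw [← Real.exp_log (x := (2 * (p.d + 3) / p.δ)⁻¹) (by positivity), Real.log_inv]
      exact Real.exp_le_exp.2 (neg_le_neg h1)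
    calc _ ≤ (p.d + 3) * (2 * (2 * (p.d + 3) / p.δ)⁻¹) := by gcongr
      _ = p.δ := by field_simp
  · simp only [estParams]; apply le_of_eq; field_simp
  · have e : p.D * p.estParams.roughScale = (p.d + 1) / p.σ := by
      simp only [estParams, Tuning.D]; field_simp
    have e2 : p.estParams.fineScale * √p.d = p.scale * p.η / p.H * √p.d / p.σ := by
      rw [← efσ]; field_simp
    rw [e, e2]
    gcongr
    have : √(p.d : ℝ) ≤ p.d + 1 := Real.sqrt_le_iff.2
      ⟨by positivity, by nlinarith [sq_nonneg (p.d : ℝ)]⟩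
    have h0 := Real.sqrt_nonneg (p.d : ℝ)
    nlinarith
  · have : 384 * p.D / p.α ≤ p.M := Nat.le_ceil _
    rw [div_le_iff₀ hα] at this
    change _ ≤ p.α * (p.M : ℝ)
    linarith
  · have hq : p.α ^ 2 / (2 ^ 20 * p.D ^ 2) ≤ 1 := by
      rw [div_le_one (by positivity)]
      nlinarith
    set t := p.α ^ 2 / (2 ^ 20 * p.D ^ 2) with ht
    have ht0 : 0 < t := by positivity
    have h1 : 2 * Real.log (p.D / (2 * p.r)) ≤ t * p.estParams.steps := by
      have h2 : 2 * (2 ^ 20 * p.D ^ 2 / p.α ^ 2) * Real.log (p.D / (2 * p.r)) ≤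
        p.estParams.steps := Nat.le_ceil _
      have e : 2 ^ 20 * p.D ^ 2 / p.α ^ 2 = t⁻¹ := by rw [ht, inv_div]
      rw [e] at h2
      calc _ = t * (2 * t⁻¹ * Real.log (p.D / (2 * p.r))) := by field_simp
        _ ≤ _ := by gcongr
    have h3 : (1 - t) ^ p.estParams.steps ≤ ((p.D / (2 * p.r)) ^ 2)⁻¹ := by
      calc (1 - t) ^ p.estParams.steps ≤ Real.exp (-t) ^ p.estParams.steps := by
            exact pow_le_pow_left₀ (by linarith) (Real.one_sub_le_exp_neg t) _
        _ = Real.exp (-(t * p.estParams.steps)) := by rw [← Real.exp_nat_mul]; congr 1; ring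
        _ ≤ Real.exp (-(2 * Real.log (p.D / (2 * p.r)))) := by gcongr
        _ = _ := by
            rw [Real.exp_neg, two_mul, Real.exp_add, Real.exp_log (by positivity), pow_two]
    calc _ ≤ ((p.D / (2 * p.r)) ^ 2)⁻¹ * p.D ^ 2 := by gcongr
      _ = _ := by field_simp
  -- The accuracy `r` was defined so that `2 r` in fine units is exactly `c η σ`.
  · have e : 2 * p.r / p.estParams.fineScale = p.c * (p.η * p.σ) := by
      simp only [estParams, Tuning.r]; field_simp
    rw [e]; apply le_of_eq; ring

end Valid

variable (p) in
/-- The logarithmic factor in the number of samples. -/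
def logFactor : ℝ := 1 + Real.log ((p.d + 1) / (p.α * p.η * p.δ))

/-! ### Size of the parameters. -/

namespace Valid

theorem one_le_ratio (h : p.Valid) : 1 ≤ (p.d + 1) / (p.α * p.η * p.δ) := by
  have := h.α; have := h.η; have := h.δ
  rw [one_le_div (by positivity)]
  have h1 : p.α * p.η * p.δ ≤ 1 * 1 * 1 := by
    gcongr
    exacts [h.α_le, h.η_le, h.δ_le]
  have : (0 : ℝ) ≤ p.d := by positivity
  linarith

theorem one_le_logFactor (h : p.Valid) : 1 ≤ p.logFactor := by
  have := Real.log_nonneg h.one_le_ratio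
  rw [logFactor]; linarith

theorem M_le (h : p.Valid) : (p.M : ℝ) ≤ 24577 * (2 + p.e) * ((p.d + 1) / p.α ^ 2) := by
  have hα := h.α; have hD := h.one_le_D; have he := h.e; have hα1 := h.α_le
  have h1 : (p.M : ℝ) ≤ 384 * p.D / p.α + 1 := (Nat.ceil_lt_add_one (by positivity)).le
  have h2 : 1 ≤ (2 + p.e) * ((p.d + 1) / p.α ^ 2) := by
    have h3 : (1 : ℝ) ≤ (p.d + 1) / p.α ^ 2 := by
      rw [one_le_div (by positivity)]
      have : (0 : ℝ) ≤ p.d := by positivity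
      nlinarith
    nlinarith
  have e : 384 * p.D / p.α = 24576 * ((2 + p.e) * ((p.d + 1) / p.α ^ 2)) := by
    rw [Tuning.D]; field_simp; ring
  linarith

/-- `M` is polynomial in the ratio inside `logFactor`, so its harmonic sum is of the order of
`logFactor`. -/
theorem H_le (h : p.Valid) :
    p.H ≤ (3 + Real.log (24577 * (2 + p.e))) * p.logFactor := by
  have hα := h.α; have he := h.e; have hη := h.η; have hδ := h.δ
  have hα1 := h.α_le; have hη1 := h.η_le; have hδ1 := h.δ_le
  set x := (p.d + 1) / (p.α * p.η * p.δ) with hx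
  have hx1 : 1 ≤ x := h.one_le_ratio
  have hL : p.logFactor = 1 + Real.log x := rfl
  have hlx := Real.log_nonneg hx1
  have h1 : (p.d + 1) / p.α ^ 2 ≤ x ^ 2 := by
    have h2 : (p.d + 1) / p.α ≤ x := by
      rw [hx]
      gcongr
      calc p.α * p.η * p.δ ≤ p.α * 1 * 1 := by gcongr
        _ = p.α := by ring
    have h3 : 1 / p.α ≤ (p.d + 1) / p.α := by
      gcongr
      have : (0 : ℝ) ≤ p.d := by positivity
      linarith
    calc (p.d + 1) / p.α ^ 2 = (p.d + 1) / p.α * (1 / p.α) := by field_simp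
      _ ≤ x * x := by gcongr; exact h3.trans h2
      _ = _ := by ring
  have h2 : (p.M : ℝ) ≤ 24577 * (2 + p.e) * x ^ 2 := h.M_le.trans (by gcongr)
  have h3 : Real.log p.M ≤ Real.log (24577 * (2 + p.e)) + 2 * Real.log x := by
    have hM : (0 : ℝ) < p.M := by exact_mod_cast h.M_pos
    refine (Real.log_le_log hM h2).trans (le_of_eq ?_)
    rw [Real.log_mul (by positivity) (by positivity), Real.log_pow]
    norm_num
  have h4 : 0 ≤ Real.log (24577 * (2 + p.e)) := Real.log_nonneg (by linarith)
  have h5 := harmonicSum_le_one_add_log p.M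
  change p.H ≤ _ at h5
  rw [hL]
  nlinarith

/-- As `ε` is of order `α η² / H`, the sample size is of order `H⁴ / (η⁴ α²)` times one more
logarithm: five logarithms in all. -/
theorem N_le (h : p.Valid) : (p.estParams.N : ℝ) ≤
    (1 + 6 * (8 * 2048 ^ 2 / (p.scale * p.c) ^ 2) *
      (3 + Real.log (24577 * (2 + p.e))) ^ 4) * (p.logFactor ^ 5 / (p.η ^ 4 * p.α ^ 2)) := by
  have hα := h.α; have he := h.e; have hη := h.η; have hδ := h.δ; have hc := h.c
  have hα1 := h.α_le; have hη1 := h.η_le; have hδ1 := h.δ_le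
  have hL := h.one_le_logFactor; have hH := h.one_le_H; have hε := h.ε_pos; have hS := h.scale_pos
  have hd : (0 : ℝ) ≤ p.d := by positivity
  set K := 3 + Real.log (24577 * (2 + p.e)) with hK
  have hHL : p.H ≤ K * p.logFactor := h.H_le
  have hlog : Real.log (2 * (p.d + 3) / p.δ) ≤ 6 * p.logFactor := by
    have h1 : 2 * (p.d + 3) / p.δ ≤ 6 * ((p.d + 1) / (p.α * p.η * p.δ)) := by
      rw [mul_div_assoc']
      gcongr ?_ / ?_
      · linarith
      · calc p.α * p.η * p.δ ≤ 1 * 1 * p.δ := by gcongr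
          _ = p.δ := by ring
    refine (Real.log_le_log (by positivity) h1).trans ?_
    rw [Real.log_mul (by norm_num) (by positivity)]
    have h2 := Real.log_le_sub_one_of_pos (show (0 : ℝ) < 6 by norm_num)
    have h3 : p.logFactor = 1 + Real.log ((p.d + 1) / (p.α * p.η * p.δ)) := rfl
    linarith
  have hlog0 : 0 ≤ Real.log (2 * (p.d + 3) / p.δ) := by
    refine Real.log_nonneg ?_
    rw [one_le_div hδ]
    linarith
  have h1 : (p.estParams.N : ℝ) ≤ 8 * p.H ^ 2 / p.ε ^ 2 * Real.log (2 * (p.d + 3) / p.δ) + 1 :=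
    (Nat.ceil_lt_add_one (by positivity)).le
  have e1 : 8 * p.H ^ 2 / p.ε ^ 2 =
      8 * 2048 ^ 2 / (p.scale * p.c) ^ 2 * p.H ^ 4 / (p.η ^ 4 * p.α ^ 2) := by
    rw [Tuning.ε, Tuning.r]; field_simp; ring
  have h2 : 1 ≤ p.logFactor ^ 5 / (p.η ^ 4 * p.α ^ 2) := by
    rw [one_le_div (by positivity)]
    calc p.η ^ 4 * p.α ^ 2 ≤ 1 ^ 4 * 1 ^ 2 := by gcongr
      _ = 1 := by norm_num
      _ ≤ _ := one_le_pow₀ hL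
  have h3 : 8 * p.H ^ 2 / p.ε ^ 2 * Real.log (2 * (p.d + 3) / p.δ) ≤
      8 * 2048 ^ 2 / (p.scale * p.c) ^ 2 * (K * p.logFactor) ^ 4 / (p.η ^ 4 * p.α ^ 2) *
        (6 * p.logFactor) := by
    rw [e1]; gcongr
  have e2 : 8 * 2048 ^ 2 / (p.scale * p.c) ^ 2 * (K * p.logFactor) ^ 4 / (p.η ^ 4 * p.α ^ 2) *
        (6 * p.logFactor) = 6 * (8 * 2048 ^ 2 / (p.scale * p.c) ^ 2) * K ^ 4 *
          (p.logFactor ^ 5 / (p.η ^ 4 * p.α ^ 2)) := by ring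
  rw [add_mul, one_mul]
  linarith

theorem D_le (h : p.Valid) {z : ℝ} (hz : 1 ≤ z) (hd : p.d ≤ z) (hα : 1 / p.α ≤ z) :
    p.D ≤ 128 * (2 + p.e) * z ^ 2 := by
  have he := h.e; have hα0 := h.α
  calc p.D = 64 * (2 + p.e) * (p.d + 1) * (1 / p.α) := by rw [Tuning.D]; ring
    _ ≤ 64 * (2 + p.e) * (z + z) * z := by gcongr
    _ = _ := by ring

theorem M_le_pow (h : p.Valid) {z : ℝ} (hz : 1 ≤ z) (hd : p.d ≤ z) (hα : 1 / p.α ≤ z) :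
    (p.M : ℝ) ≤ 2 * 24577 * (2 + p.e) * z ^ 3 := by
  have he := h.e; have hα0 := h.α
  calc (p.M : ℝ) ≤ 24577 * (2 + p.e) * ((p.d + 1) / p.α ^ 2) := h.M_le
    _ = 24577 * (2 + p.e) * ((p.d + 1) * (1 / p.α) ^ 2) := by field_simp
    _ ≤ 24577 * (2 + p.e) * ((z + z) * z ^ 2) := by gcongr
    _ = _ := by ring

theorem N_le_pow (h : p.Valid) {z : ℝ} (hz : 1 ≤ z) (hα : 1 / p.α ≤ z) (hη : 1 / p.η ≤ z)
    (hL : p.logFactor ≤ 2 * z) : (p.estParams.N : ℝ) ≤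
    (1 + 6 * (8 * 2048 ^ 2 / (p.scale * p.c) ^ 2) *
      (3 + Real.log (24577 * (2 + p.e))) ^ 4) * 32 * z ^ 11 := by
  have he := h.e; have hα0 := h.α; have hη0 := h.η; have hL1 := h.one_le_logFactor
  refine h.N_le.trans ?_
  rw [mul_assoc _ (32 : ℝ)]
  refine mul_le_mul_of_nonneg_left ?_ (add_nonneg zero_le_one
    (mul_nonneg (by positivity) (Even.pow_nonneg (by decide) _)))
  calc p.logFactor ^ 5 / (p.η ^ 4 * p.α ^ 2) =
      p.logFactor ^ 5 * ((1 / p.η) ^ 4 * (1 / p.α) ^ 2) := by field_simp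
    _ ≤ (2 * z) ^ 5 * (z ^ 4 * z ^ 2) := by gcongr
    _ = _ := by ring

theorem steps_le_pow (h : p.Valid) {z : ℝ} (hz : 1 ≤ z) (hd : p.d ≤ z) (hα : 1 / p.α ≤ z)
    (hη : 1 / p.η ≤ z) (hL : p.logFactor ≤ 2 * z) : (p.estParams.steps : ℝ) ≤
    (1 + 2 * (2 ^ 20 * (128 * (2 + p.e)) ^ 2) * (128 * (2 + p.e) *
      ((3 + Real.log (24577 * (2 + p.e))) * 2 / (p.scale * p.c)))) * z ^ 11 := by
  have he := h.e; have hα0 := h.α; have hη0 := h.η; have hL1 := h.one_le_logFactor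
  have hD := h.one_le_D; have hr := h.r_pos; have hr1 := h.r_le; have hS := h.scale_pos
  have hc := h.c
  have hH := h.one_le_H
  set K := 3 + Real.log (24577 * (2 + p.e)) with hK
  have hK0 : 0 ≤ K := by
    have := Real.log_nonneg (show 1 ≤ 24577 * (2 + p.e) by linarith)
    linarith
  have h1 : 1 ≤ p.D / (2 * p.r) := by rw [one_le_div (by positivity)]; linarith
  have h2 := Real.log_nonneg h1
  have h3 : (p.estParams.steps : ℝ) ≤
      2 * (2 ^ 20 * p.D ^ 2 / p.α ^ 2) * Real.log (p.D / (2 * p.r)) + 1 :=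
    (Nat.ceil_lt_add_one (by positivity)).le
  have h4 : Real.log (p.D / (2 * p.r)) ≤ p.D / (2 * p.r) := by
    have := Real.log_le_sub_one_of_pos (show 0 < p.D / (2 * p.r) by linarith)
    linarith
  have hHz : p.H ≤ K * (2 * z) := h.H_le.trans (by gcongr)
  have hDz := h.D_le hz hd hα
  have h5 : p.D / (2 * p.r) ≤ 128 * (2 + p.e) * z ^ 2 * (K * 2 / (p.scale * p.c) * z ^ 3) := by
    calc p.D / (2 * p.r) = p.D * (p.H * (1 / p.η) ^ 2 / (p.scale * p.c)) := by
          rw [Tuning.r]; field_simp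
      _ ≤ 128 * (2 + p.e) * z ^ 2 * (K * (2 * z) * z ^ 2 / (p.scale * p.c)) := by gcongr
      _ = _ := by ring
  have h6 : 1 ≤ z ^ 11 := one_le_pow₀ hz
  calc (p.estParams.steps : ℝ) ≤
        2 * (2 ^ 20 * p.D ^ 2 * (1 / p.α) ^ 2) * (p.D / (2 * p.r)) + 1 := by
        refine h3.trans ?_
        rw [one_div, inv_pow, ← div_eq_mul_inv]
        gcongr
    _ ≤ 2 * (2 ^ 20 * (128 * (2 + p.e) * z ^ 2) ^ 2 * z ^ 2) *
        (128 * (2 + p.e) * z ^ 2 * (K * 2 / (p.scale * p.c) * z ^ 3)) + z ^ 11 := by gcongr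
    _ = _ := by ring

end Valid

end Tuning

end Parameters

/-! ### Assembly of the theorem. -/

theorem Prog.Reliable.mono {d : ℕ} {q : EstParams} {ν : (Fin d → ℝ) → Measure (Fin d → ℝ)}
    {R R' : (Fin d → ℝ) → (Fin d → ℝ) → Prop} {c : ℝ≥0∞} {g : Vec d}
    (h : Prog.Reliable q ν R c g) (hR : ∀ x y, R x y → R' x y) : Prog.Reliable q ν R' c g :=
  fun x => by
    obtain ⟨EX, EY, h1, h2, h3, h4, h5⟩ := h x
    exact ⟨EX, EY, h1, h2, h3, h4, fun X hX Y hY => hR _ _ (h5 X hX Y hY)⟩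

/-- The constant depends on `e` and `c` only. All sizes are at most `w * z ^ 11` and the cost is of
fifth degree in them, whence the exponent 55. -/
theorem Tuning.exists_cost_bounds (e c : ℝ) (he : 0 ≤ e) (hc : 0 < c) :
    ∃ C : ℝ, 1 ≤ C ∧ ∀ p : Tuning, p.Valid → p.e = e → p.c = c →
      2 * (p.estParams.N : ℝ) ≤ C * (p.logFactor ^ 5 / (p.η ^ 4 * p.α ^ 2)) ∧
      ∀ z : ℝ, 1 ≤ z → p.d ≤ z → 1 / p.α ≤ z → 1 / p.η ≤ z → p.logFactor ≤ 2 * z →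
        2 + 2 * (p.estParams.N : ℝ) + p.d + p.estParams.cost p.d ≤ C * z ^ 55 := by
  obtain ⟨S, hS⟩ : ∃ S, S = c / (5120 * (1 + e)) := ⟨_, rfl⟩
  have hS0 : 0 < S := by rw [hS]; positivity
  obtain ⟨A, hA⟩ : ∃ A, A = 1 + 6 * (8 * 2048 ^ 2 / (S * c) ^ 2) *
      (3 + Real.log (24577 * (2 + e))) ^ 4 := ⟨_, rfl⟩
  obtain ⟨B, hB⟩ : ∃ B, B = 1 + 2 * (2 ^ 20 * (128 * (2 + e)) ^ 2) * (128 * (2 + e) *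
      ((3 + Real.log (24577 * (2 + e))) * 2 / (S * c))) := ⟨_, rfl⟩
  have hlog := Real.log_nonneg (show 1 ≤ 24577 * (2 + e) by linarith)
  have hA0 : 0 < A := by rw [hA]; positivity
  have hB0 : 0 < B := by rw [hB]; positivity
  set w := 1 + 2 * 24577 * (2 + e) + 32 * A + B with hw
  have hM0 : 0 ≤ 2 * 24577 * (2 + e) := by positivity
  have hw0 : 0 < w := by positivity
  refine ⟨1 + 2 * A + 237 * w ^ 5, by
    have : 0 ≤ w ^ 5 := by positivity
    linarith, fun p hp hpe hpc => ⟨?_, fun z hz hd hα hη hL => ?_⟩⟩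
  · have h1 := hp.N_le
    have e1 : p.scale = S := by rw [Tuning.scale, hpe, hpc, hS]
    rw [e1, hpe, hpc, ← hA] at h1
    have h2 : 0 ≤ p.logFactor ^ 5 / (p.η ^ 4 * p.α ^ 2) := by
      have := hp.one_le_logFactor; have := hp.η; have := hp.α
      positivity
    have h3 : 0 ≤ (1 + 237 * w ^ 5) * (p.logFactor ^ 5 / (p.η ^ 4 * p.α ^ 2)) := by positivity
    linarith
  · have e1 : p.scale = S := by rw [Tuning.scale, hpe, hpc, hS]
    have hN := hp.N_le_pow hz hα hη hL
    have hs := hp.steps_le_pow hz hd hα hη hL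
    have hM := hp.M_le_pow hz hd hα
    rw [e1, hpe, hpc, ← hA] at hN
    rw [e1, hpe, hpc, ← hB] at hs
    rw [hpe] at hM
    have hz3 : z ^ 3 ≤ z ^ 11 := pow_le_pow_right₀ hz (by norm_num)
    have hz1 : z ≤ z ^ 11 := le_self_pow₀ hz (by norm_num)
    have hz11 : 1 ≤ z ^ 11 := one_le_pow₀ hz
    have hz0 : 0 ≤ z ^ 11 := by linarith
    have hwz : w * z ^ 11 =
        z ^ 11 + 2 * 24577 * (2 + e) * z ^ 11 + A * 32 * z ^ 11 + B * z ^ 11 := by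
      rw [hw]; ring
    have t1 : 0 ≤ A * 32 * z ^ 11 := by positivity
    have t2 : 0 ≤ B * z ^ 11 := by positivity
    have t3 : 0 ≤ 2 * 24577 * (2 + e) * z ^ 11 := by positivity
    have hM' : (p.M : ℝ) ≤ 2 * 24577 * (2 + e) * z ^ 11 := hM.trans (by gcongr)
    set W := w * z ^ 11 with hW
    have hW1 : 1 ≤ W := by linarith
    have hdW : (p.d : ℝ) ≤ W := by linarith
    have hNW : (p.estParams.N : ℝ) ≤ W := by linarith
    have hcost := EstParams.cost_le (q := p.estParams) (d := p.d) hW1 hdW hNW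
      (show (p.M : ℝ) ≤ W by linarith) (show (p.estParams.steps : ℝ) ≤ W by linarith)
    have hW5 : W ≤ W ^ 5 := le_self_pow₀ hW1 (by norm_num)
    calc _ ≤ 237 * W ^ 5 := by linarith
      _ = 237 * w ^ 5 * z ^ 55 := by rw [hW]; ring
      _ ≤ _ := by
        gcongr
        linarith

theorem theorem1 (cME cG : ℝ) (hME : 0 < cME) (hG : cME < cG) :
    ∃ (C : ℝ) (k : ℕ), 0 < C ∧
      ∀ (d m s T : ℕ) (α σ η δ : ℝ), 0 < T →
        0 < α → α < 1 → 0 < σ → 0 < η → η < 1 → 0 < δ → δ < 1 →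
        ∀ AG : Prog (gradientAccess d), AG.time ≤ T →
        ∃ B : Prog (optAccess d m s),
          (B.calls OptOp.oracle : ℝ) ≤
              m + s * (C * (1 + Real.log ((d + 1) * T / (α * η * δ))) ^ k *
                (T * (C / α) ^ (2 / η) / η ^ 5)) ∧
          B.calls OptOp.meanEstimator ≤ 1 ∧
          (B.time : ℝ) ≤
              m + s * (T * (C * (d + 1 / η + (C / α) ^ (1 / η) +
                Real.log (T / (α * η * δ))) ^ k)) ∧
          ∀ (c₀ δME : ℝ), 0 < c₀ → c₀ < 1 / 2 → 0 ≤ δME →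
          ∀ (AME : ProbabilityTheory.Kernel (Fin m → Vec d) (Fin s → Vec d)),
            ProbabilityTheory.IsMarkovKernel AME →
            IsLDME AME (boundedVarianceClass d σ) c₀ α (cME * (η * σ)) δME →
            ∀ (f : Vec d → ℝ) (L : NNReal) (ε : ℝ), IsObjective f L →
              IsInexactLearner AG f (cG * (η * σ)) ε →
              ∀ (Γ : Type*) [MeasurableSpace Γ] (F : Γ → Vec d → ℝ)
                (Q : MeasureTheory.Measure Γ) (Dξ : MeasureTheory.Measure (Vec d)),
                IsObliviousNoiseOracle F Q Dξ f α σ →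
                1 - ENNReal.ofReal (δME + δ) ≤
                  B.prob (optAnswers F Q Dξ AME)
                    {μ | ∃ j : Fin s, ‖gradient f (outputPoint d μ j)‖ ≤ cG * (η * σ) + ε}
                    (fun _ => 0) ∧
                (1 - α ≤ c₀ → s = 1 ∧
                  1 - ENNReal.ofReal (δME + δ) ≤
                    B.prob (optAnswers F Q Dξ AME)
                      {μ | ‖gradient f (outputPoint d μ 0)‖ ≤ cG * (η * σ) + ε}
                      (fun _ => 0)) := by
  -- The slack between the two constants is capped at one, as the parameter choice requires `c ≤ 1`.
  have hc : 0 < min (cG - cME) 1 := lt_min (by linarith) one_pos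
  obtain ⟨C, hC, hbd⟩ := Tuning.exists_cost_bounds cME (min (cG - cME) 1) hME.le hc
  -- The factor 32 absorbs `logFactor ^ 5 ≤ (2 x) ^ 5` in the query count.
  refine ⟨32 * C, 55, by linarith, fun d m s T α σ η δ hT hα hα1 hσ hη hη1 hδ hδ1 AG hAG => ?_⟩
  have hT0 : (0 : ℝ) < T := by exact_mod_cast hT
  have hT1 : (1 : ℝ) ≤ T := by exact_mod_cast hT
  have hd0 : (0 : ℝ) ≤ d := by positivity
  -- The failure probability is shared among at most `T` queries with two sample sets each.
  let p : Tuning := ⟨cME, min (cG - cME) 1, d, α, σ, η, δ / (2 * T)⟩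
  have hp : p.Valid := ⟨hME.le, hc, min_le_right _ _, hα, hα1.le, hσ, hη, hη1.le,
    div_pos hδ (by positivity), (div_le_one (by positivity)).2 (by linarith)⟩
  obtain ⟨hN, htime⟩ := hbd p hp rfl rfl
  -- the logarithms
  have hαηδ : 0 < α * η * δ := by positivity
  have hαηδ1 : α * η * δ ≤ 1 := by
    calc α * η * δ ≤ 1 * 1 * 1 := by gcongr
      _ = 1 := by norm_num
  have hratio : 1 ≤ T / (α * η * δ) := by rw [one_le_div hαηδ]; linarith
  have hℓ := Real.log_nonneg hratio
  have elog : Real.log ((d + 1) * T / (α * η * δ)) =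
      Real.log (d + 1) + Real.log (T / (α * η * δ)) := by
    rw [mul_div_assoc, Real.log_mul (by positivity) (by positivity)]
  have hlogd : 0 ≤ Real.log ((d : ℝ) + 1) := Real.log_nonneg (by linarith)
  have hlogd' : Real.log ((d : ℝ) + 1) ≤ d := by
    have := Real.log_le_sub_one_of_pos (show (0 : ℝ) < d + 1 by positivity)
    linarith
  have hfac : p.logFactor = 1 + Real.log 2 + Real.log ((d + 1) * T / (α * η * δ)) := by
    change 1 + Real.log ((d + 1) / (α * η * (δ / (2 * T)))) = _
    have : (d + 1) / (α * η * (δ / (2 * T))) = 2 * ((d + 1) * T / (α * η * δ)) := by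
      field_simp
    rw [this, Real.log_mul (by norm_num) (by positivity)]
    ring
  have hlog2 : Real.log 2 ≤ 1 := by linarith [Real.log_two_lt_d9]
  -- the powers of `1 / α`
  have hbase : 1 / α ≤ 32 * C / α := by gcongr; linarith
  have hbase1 : 1 ≤ 32 * C / α := by
    rw [le_div_iff₀ hα]; linarith
  have hη' : 1 ≤ 1 / η := by rw [one_le_div hη]; exact hη1.le
  have hpow1 : 1 / α ≤ (32 * C / α) ^ (1 / η) :=
    hbase.trans (Real.self_le_rpow_of_one_le hbase1 hη')
  have hpow2 : (1 / α) ^ 2 ≤ (32 * C / α) ^ (2 / η) := by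
    calc (1 / α) ^ 2 ≤ (32 * C / α) ^ 2 := by gcongr
      _ = (32 * C / α) ^ (2 : ℝ) := (Real.rpow_two _).symm
      _ ≤ _ := Real.rpow_le_rpow_of_exponent_le hbase1 (by
        rw [le_div_iff₀ hη]; linarith)
  -- For `s = 0` the time budget is only `m`, too small for the call of the mean estimator, but then
  -- `δME ≥ 1` and nothing has to be achieved.
  rcases Nat.eq_zero_or_pos s with hs | hs
  · refine ⟨.halt, ?_, Nat.zero_le _, ?_, ?_⟩
    · subst hs; simp [Prog.calls]
    · subst hs; simp [Prog.time]
    · intro c₀ δME hc₀ hc₀' hδME AME hAME hLD f L ε hf hAGf Γ _ F Q Dξ hO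
      have h1 := hLD.one_le_of_isEmpty hs hα1.le
      have h2 : 1 - ENNReal.ofReal (δME + δ) = 0 := by
        rw [tsub_eq_zero_iff_le, ENNReal.one_le_ofReal]; linarith
      rw [h2]
      exact ⟨zero_le, fun h => ⟨hLD.singleton h, zero_le⟩⟩
  have hs1 : (1 : ℝ) ≤ s := by exact_mod_cast hs
  have hAGT : (AG.time : ℝ) ≤ T := by exact_mod_cast hAG
  refine ⟨Prog.optimize p.estParams AG m s, ?_, Prog.calls_meanEstimator_optimize_le _ _ _ _, ?_,
    ?_⟩
  · have h1 : ((Prog.optimize p.estParams AG m s).calls OptOp.oracle : ℝ) ≤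
        m + s * (AG.time * (2 * p.estParams.N)) := by
      exact_mod_cast Prog.calls_oracle_optimize_le p.estParams AG m s
    refine h1.trans ?_
    gcongr m + s * ?_
    set x := 1 + Real.log ((d + 1) * T / (α * η * δ)) with hx
    have hx1 : 1 ≤ x := by rw [hx, elog]; linarith
    have hfx : p.logFactor ≤ 2 * x := by rw [hfac]; linarith
    have hf0 := hp.one_le_logFactor
    have hη5 : (1 / η) ^ 4 ≤ (1 / η) ^ 5 := pow_le_pow_right₀ hη' (by norm_num)
    calc (AG.time : ℝ) * (2 * p.estParams.N) ≤
          T * (C * (p.logFactor ^ 5 / (η ^ 4 * α ^ 2))) := by gcongr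
      _ = T * (C * (p.logFactor ^ 5 * ((1 / η) ^ 4 * (1 / α) ^ 2))) := by field_simp
      _ ≤ T * (C * ((2 * x) ^ 5 * ((1 / η) ^ 5 * (32 * C / α) ^ (2 / η)))) := by gcongr
      _ = 32 * C * x ^ 5 * (T * (32 * C / α) ^ (2 / η) / η ^ 5) := by field_simp; ring
      _ ≤ _ := by
        gcongr
        norm_num
  · have h1 : ((Prog.optimize p.estParams AG m s).time : ℝ) ≤
        m + (1 + s * (AG.time * (2 * p.estParams.N + p.estParams.cost d + 1) + d)) := by
      exact_mod_cast Prog.time_optimize_le p.estParams AG m s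
    have h3 : (AG.time : ℝ) * (2 * p.estParams.N + p.estParams.cost d + 1) + d + 1 ≤
        T * (2 + 2 * p.estParams.N + d + p.estParams.cost d) := by
      have h4 : (AG.time : ℝ) * (2 * p.estParams.N + p.estParams.cost d + 1) ≤
          T * (2 * p.estParams.N + p.estParams.cost d + 1) := by gcongr
      have h5 : 1 * ((d : ℝ) + 1) ≤ T * (d + 1) := by gcongr
      linarith
    obtain ⟨z, hz⟩ : ∃ z, z = d + 1 / η + (32 * C / α) ^ (1 / η) + Real.log (T / (α * η * δ)) :=
      ⟨_, rfl⟩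
    rw [← hz]
    have hpos : 0 < (32 * C / α) ^ (1 / η) := Real.rpow_pos_of_pos (by linarith) _
    have hα0 : 0 < 1 / α := by positivity
    have h2 := htime z (by linarith) (show (d : ℝ) ≤ z by linarith)
      (show 1 / α ≤ z by linarith) (show 1 / η ≤ z by linarith)
      (by rw [hfac, elog]; linarith)
    change 2 + 2 * (p.estParams.N : ℝ) + d + p.estParams.cost d ≤ C * z ^ 55 at h2
    have hz55 : 0 ≤ z ^ 55 := by
      have : 0 ≤ z := by linarith
      positivity
    calc _ ≤ _ := h1
      -- The single step for the mean estimator is absorbed using `s ≥ 1`.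
      _ ≤ m + s * (AG.time * (2 * p.estParams.N + p.estParams.cost d + 1) + d + 1) := by linarith
      _ ≤ m + s * (T * (2 + 2 * p.estParams.N + d + p.estParams.cost d)) := by gcongr
      _ ≤ m + s * (T * (32 * C * z ^ 55)) := by
        gcongr
        exact h2.trans (mul_le_mul_of_nonneg_right (by linarith) hz55)
  · intro c₀ δME hc₀ hc₀' hδME AME hAME hLD f L ε hf hAGf Γ _ F Q Dξ hO
    have key := hO.one_sub_le_prob_optimize (q := p.estParams) (δ := δ) (δ₁ := δ / (2 * T)) hAG hLD
      hδME (by positivity) (by apply le_of_eq; field_simp) hAGf fun v hv =>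
        (hp.reliable hO v hv).mono fun x y hxy => hxy.trans (by
          have : cME + min (cG - cME) 1 ≤ cG := by linarith [min_le_left (cG - cME) 1]
          exact mul_le_mul_of_nonneg_right this (by positivity))
    refine ⟨key, fun h => ⟨hLD.singleton h, key.trans (Prog.prob_mono _ (fun μ hμ => ?_) _ _)⟩⟩
    obtain ⟨j, hj⟩ := hμ
    have : (j : ℕ) = 0 := by
      have := hLD.singleton h
      have := j.2
      omega
    rw [this] at hj
    exact hj

end
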